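/- Let $N\ge 1$, let $\Omega\subset\mathbb R^N$ be a bounded domain, let $1<p<\infty$ and $Q=[0,1]^N$. Let $m,n:\mathbb R^N\to\mathbb R$ be measurable $Q$-periodic functions and let $m_\pm,n_\pm$ be real constants such that, almost everywhere, $$0<m_-\le m\le m_+<\infty,\qquad 0<n_-\le n\le n_+<\infty .$$ Put $\bar m=\int_Q m$, $\bar n=\int_Q n$ and, for $\varepsilon>0$, $m_\varepsilon(x)=m(x/\varepsilon)$, $n_\varepsilon(x)=n(x/\varepsilon)$. For a weight $r$ let $\lambda_1(r)$ denote the first eigenvalue of $$-\Delta_p u=\lambda\, r(x)\,|u|^{p-2}u\ \text{ in }\Omega,\qquad u=0\ \text{ on }\partial\Omega,$$ that is, the smallest real $\lambda$ for which this problem has a nontrivial weak solution $u\in W^{1,p}_0(\Omega)$, and let $\mu_1=\lambda_1(1)$. Let $c_1$ be the optimal constant in Poincaré's inequality $\|f-\int_Q f\|_{L^1(Q)}\le c_1\|\nabla f\|_{L^1(Q)}$, $f\in W^{1,1}(Q)$. Then the optimal constant $c_1$ and all the first eigenvalues below exist, $c_1\le\sqrt N/2$, and for every $\varepsilon>0$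 $$|\lambda_1(m_\varepsilon)-\lambda_1(\bar m)|\le C_m\,\varepsilon,\qquad |\lambda_1(n_\varepsilon)-\lambda_1(\bar n)|\le C_n\,\varepsilon,$$ where $$C_m=p\,c_1\,\|m-\bar m\|_{L^\infty(\mathbb R^N)}\,(m_+)^{1/p}\,(m_-)^{-\frac1p-2}\,\mu_1^{\frac1p+1}$$ and $C_n$ is given by the same formula with $n,\bar n,n_\pm$ in place of $m,\bar m,m_\pm$. -/

import Mathlib

open MeasureTheory

noncomputable section

/-- `φ ∈ C_c^∞(Ω)`. -/
def IsTestFunction {N : ℕ} (Ω : Set (EuclideanSpace ℝ (Fin N)))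
    (φ : EuclideanSpace ℝ (Fin N) → ℝ) : Prop :=
  ContDiff ℝ ((⊤ : ℕ∞) : WithTop ℕ∞) φ ∧ HasCompactSupport φ ∧ tsupport φ ⊆ Ω

/-- `u ∈ W^{1,p}(Ω)` with weak gradient `G`: both are in `L^p(Ω)` and
`∫_Ω u ∇φ = - ∫_Ω φ G` for all `φ ∈ C_c^∞(Ω)`. -/
def MemSobolev {N : ℕ} (Ω : Set (EuclideanSpace ℝ (Fin N))) (p : ENNReal)
    (u : EuclideanSpace ℝ (Fin N) → ℝ)
    (G : EuclideanSpace ℝ (Fin N) → EuclideanSpace ℝ (Fin N)) : Prop :=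
  MemLp u p (volume.restrict Ω) ∧ MemLp G p (volume.restrict Ω) ∧
    ∀ φ : EuclideanSpace ℝ (Fin N) → ℝ, IsTestFunction Ω φ →
      ∫ x in Ω, u x • gradient φ x = - ∫ x in Ω, φ x • G x

/-- `u ∈ W_0^{1,p}(Ω)` with weak gradient `G`: `u` belongs to the closure of `C_c^∞(Ω)` in
`W^{1,p}(Ω)`. -/
def MemSobolevZero {N : ℕ} (Ω : Set (EuclideanSpace ℝ (Fin N))) (p : ENNReal)
    (u : EuclideanSpace ℝ (Fin N) → ℝ)
    (G : EuclideanSpace ℝ (Fin N) → EuclideanSpace ℝ (Fin N)) : Prop :=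
  MemSobolev Ω p u G ∧
    ∀ δ : ENNReal, 0 < δ → ∃ φ : EuclideanSpace ℝ (Fin N) → ℝ, IsTestFunction Ω φ ∧
      eLpNorm (fun x => u x - φ x) p (volume.restrict Ω) +
        eLpNorm (fun x => G x - gradient φ x) p (volume.restrict Ω) < δ

/-- The set of real `lam` for which the problem `-Δ_p u = lam r |u|^{p-2} u` in `Ω`, `u = 0` on
`∂Ω`, has a nontrivial weak solution `u ∈ W_0^{1,p}(Ω)`. -/
def dirichletEigenvalues {N : ℕ} (Ω : Set (EuclideanSpace ℝ (Fin N))) (p : ℝ)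
    (r : EuclideanSpace ℝ (Fin N) → ℝ) : Set ℝ :=
  {lam : ℝ | ∃ (u : EuclideanSpace ℝ (Fin N) → ℝ)
      (G : EuclideanSpace ℝ (Fin N) → EuclideanSpace ℝ (Fin N)),
    MemSobolevZero Ω (ENNReal.ofReal p) u G ∧
    ¬ (∀ᵐ x ∂(volume.restrict Ω), u x = 0) ∧
    ∀ (v : EuclideanSpace ℝ (Fin N) → ℝ)
      (H : EuclideanSpace ℝ (Fin N) → EuclideanSpace ℝ (Fin N)),
      MemSobolevZero Ω (ENNReal.ofReal p) v H →
        ∫ x in Ω, ‖G x‖ ^ (p - 2) * inner ℝ (G x) (H x) =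
          lam * ∫ x in Ω, r x * (|u x| ^ (p - 2) * u x) * v x}

/-- The first (smallest) Dirichlet eigenvalue of the `p`-Laplacian in `Ω` with weight `r`. -/
def firstEigenvalue {N : ℕ} (Ω : Set (EuclideanSpace ℝ (Fin N))) (p : ℝ)
    (r : EuclideanSpace ℝ (Fin N) → ℝ) : ℝ :=
  sInf (dirichletEigenvalues Ω p r)

/-- The open unit cube of `ℝ^N` (its boundary is Lebesgue-null). -/
def unitCube (N : ℕ) : Set (EuclideanSpace ℝ (Fin N)) :=
  {x | ∀ i, x i ∈ Set.Ioo (0 : ℝ) 1}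

/-- The average of `w` over the unit cube, which has measure one. -/
def cubeAverage {N : ℕ} (w : EuclideanSpace ℝ (Fin N) → ℝ) : ℝ :=
  ∫ x in unitCube N, w x

/-- The constants `c ≥ 0` admissible in Poincaré's inequality
`‖f - f̄‖_{L^1(Q)} ≤ c ‖∇f‖_{L^1(Q)}`, `f ∈ W^{1,1}(Q)`, on the unit cube `Q`. -/
def cubePoincareConstants (N : ℕ) : Set ℝ :=
  {c : ℝ | 0 ≤ c ∧ ∀ (f : EuclideanSpace ℝ (Fin N) → ℝ)
      (G : EuclideanSpace ℝ (Fin N) → EuclideanSpace ℝ (Fin N)),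
    MemSobolev (unitCube N) 1 f G →
      ∫ x in unitCube N, |f x - cubeAverage f| ≤ c * ∫ x in unitCube N, ‖G x‖}

/-- The optimal constant in Poincaré's inequality in `L^1(Q)`. -/
def cubePoincareConstant (N : ℕ) : ℝ :=
  sInf (cubePoincareConstants N)

/-- `w` is a `Q`-periodic weight on `ℝ^N` with `0 < a ≤ w ≤ b < ∞`, in the almost everywhere
sense. -/
structure IsPeriodicWeight {N : ℕ} (w : EuclideanSpace ℝ (Fin N) → ℝ) (a b : ℝ) : Prop where
  aestronglyMeasurable : AEStronglyMeasurable w volume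
  periodic : ∀ i : Fin N, ∀ᵐ x ∂(volume : Measure (EuclideanSpace ℝ (Fin N))),
    w (x + EuclideanSpace.single i 1) = w x
  pos : 0 < a
  bounds : ∀ᵐ x ∂(volume : Measure (EuclideanSpace ℝ (Fin N))), a ≤ w x ∧ w x ≤ b

/-- The constant `p c₁ ‖w - w̄‖_{L^∞(ℝ^N)} b^{1/p} a^{-1/p-2} μ₁^{1/p+1}`, where `μ₁` is the first
eigenvalue of the Dirichlet `p`-Laplacian in `Ω`. -/
def rateConstant {N : ℕ} (Ω : Set (EuclideanSpace ℝ (Fin N))) (p : ℝ)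
    (w : EuclideanSpace ℝ (Fin N) → ℝ) (a b : ℝ) : ℝ :=
  p * cubePoincareConstant N *
    (eLpNorm (fun x => w x - cubeAverage w) ⊤ volume).toReal *
    b ^ (1 / p) * a ^ (-(1 / p) - 2) *
    firstEigenvalue Ω p (fun _ => 1) ^ (1 / p + 1)

end

/-! The first eigenvalue for a weight `r` is the largest `c` with `c ∫ r|φ|^p ≤ ∫ |∇φ|^p` for all
test functions `φ` (`exists_isLeast_dirichletEigenvalues`). Comparing the eigenvalues of two weights
therefore reduces to comparing the two integrals `∫ r|φ|^p` for one and the same `φ`; no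
eigenfunction enters the estimate.

For the weight `w(x/ε)` and its mean, the point is that `w - w̄` has mean zero on every period cell.
On a cell a function `g` may thus be replaced by `g` minus its mean, and the `L^1` Poincaré
inequality gives `|∫ (w - w̄) g| ≤ ‖w - w̄‖_∞ c₁ ∫ |∇g|`. Rescaling produces the factor `ε`
(`IsPeriodicWeight.abs_integral_comp_smul_le`). For `g = |φ|^p`, Hölder bounds `∫ |∇g|` by `p
‖φ‖_p^(p-1) ‖∇φ‖_p`. In `firstEigenvalue_sub_le_of_weights` these norms are absorbed into `∫ r|φ|^p`
using `λ ≤ μ₁/a`. This yields the rate `p c₁ ‖w - w̄‖_∞ a^(-2) μ₁^(1/p+1) ε`, which is at most the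
stated one because `(b/a)^(1/p) ≥ 1`.

Existence of the first eigenvalue is the direct method without weak topologies. A normalized
minimizing sequence converges in `L^p` along a subsequence by Rellich
(`exists_subseq_tendsto_eLpNorm`). Midpoints of the subsequence cannot have energy much below the
infimum, so uniform convexity makes the gradients converge strongly too
(`exists_tendsto_eLpNorm_of_midpoint_energy`). The Euler–Lagrange equation makes the minimum an
eigenvalue, and testing any weak solution against itself shows that no eigenvalue is smaller.

The bound `c₁ ≤ √N/2` comes from the symmetric inequality `∬ |f(x) - f(y)| ≤ (√N/2) ∫ |∇f|`. On an
interval of length at most one, a point separates pairs of total measure at most `1/2`; the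
inequality tensorizes, Cauchy–Schwarz contributes `√N`, and mollification on slightly smaller cubes
extends it to `W^{1,1}`. -/

open Filter Topology

/-! ### Uniform convexity and `L^p` energies -/

/-- A substitute for Clarkson's inequalities that treats all `p > 1` at once. Both sides are
homogeneous of degree `p`, so the claim reduces to a compact set of normalized pairs, where the
midpoint gap is continuous and, by strict convexity, positive. -/
theorem norm_sub_rpow_le_add_convexity_gap {F : Type*} [NormedAddCommGroup F]
    [InnerProductSpace ℝ F] [FiniteDimensional ℝ F] {p : ℝ} (hp : 1 < p) {η : ℝ} (hη : 0 < η) :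
    ∃ C : ℝ, 0 ≤ C ∧ ∀ a b : F, ‖a - b‖ ^ p ≤ η * (‖a‖ ^ p + ‖b‖ ^ p) +
      C * ((‖a‖ ^ p + ‖b‖ ^ p) / 2 - ‖(1 / 2 : ℝ) • (a + b)‖ ^ p) := by
  have hp0 : 0 < p := by linarith
  -- the gap is nonnegative, and positive off the diagonal
  have hsc := strictConvexOn_rpow hp
  have gap_nonneg : ∀ a b : F, 0 ≤ (‖a‖ ^ p + ‖b‖ ^ p) / 2 - ‖(1 / 2 : ℝ) • (a + b)‖ ^ p := by
    intro a b
    have h1 : ‖(1 / 2 : ℝ) • (a + b)‖ ≤ (1 / 2) * ‖a‖ + (1 / 2) * ‖b‖ := by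
      rw [norm_smul, Real.norm_of_nonneg (by norm_num)]
      linarith [norm_add_le a b]
    have h2 := hsc.convexOn.2 (norm_nonneg a) (norm_nonneg b)
      (show (0 : ℝ) ≤ 1 / 2 by norm_num) (show (0 : ℝ) ≤ 1 / 2 by norm_num) (by norm_num)
    simp only [smul_eq_mul] at h2
    have h3 := Real.rpow_le_rpow (norm_nonneg _) h1 hp0.le
    linarith
  have gap_pos : ∀ a b : F, a ≠ b →
      0 < (‖a‖ ^ p + ‖b‖ ^ p) / 2 - ‖(1 / 2 : ℝ) • (a + b)‖ ^ p := by
    intro a b hab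
    by_cases hn : ‖a‖ = ‖b‖
    · have h1 : ‖(1 / 2 : ℝ) • a + (1 / 2 : ℝ) • b‖ < ‖b‖ :=
        norm_combo_lt_of_ne hn.le le_rfl hab (by norm_num) (by norm_num) (by norm_num)
      rw [← smul_add] at h1
      have h3 := Real.rpow_lt_rpow (norm_nonneg _) h1 hp0
      rw [hn]
      linarith
    · have h1 : ‖(1 / 2 : ℝ) • (a + b)‖ ≤ (1 / 2) * ‖a‖ + (1 / 2) * ‖b‖ := by
        rw [norm_smul, Real.norm_of_nonneg (by norm_num)]
        linarith [norm_add_le a b]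
      have h2 := hsc.2 (norm_nonneg a) (norm_nonneg b) hn
        (show (0 : ℝ) < 1 / 2 by norm_num) (show (0 : ℝ) < 1 / 2 by norm_num) (by norm_num)
      simp only [smul_eq_mul] at h2
      have h3 := Real.rpow_le_rpow (norm_nonneg _) h1 hp0.le
      linarith
  -- The normalized pairs for which the `η` term alone does not suffice, up to the boundary case.
  -- They stay off the diagonal, and may be absent altogether for large `η`.
  let K : Set (F × F) := {z | ‖z.1‖ ^ p + ‖z.2‖ ^ p = 1 ∧ η ≤ ‖z.1 - z.2‖ ^ p}
  have cn : ∀ {g : F × F → F}, Continuous g → Continuous fun z => ‖g z‖ ^ p := fun hg =>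
    hg.norm.rpow_const fun _ => Or.inr hp0.le
  have hKc : IsCompact K := by
    refine Metric.isCompact_of_isClosed_isBounded ?_ ?_
    · exact (isClosed_eq ((cn continuous_fst).add (cn continuous_snd)) continuous_const).inter
        (isClosed_le continuous_const (cn (continuous_fst.sub continuous_snd)))
    · refine (Metric.isBounded_closedBall (x := (0 : F × F)) (r := 1)).subset ?_
      rintro ⟨a, b⟩ ⟨h, -⟩
      simp only [mem_closedBall_zero_iff, Prod.norm_def, sup_le_iff]
      have ha : (0 : ℝ) ≤ ‖a‖ ^ p := by positivity
      have hb : (0 : ℝ) ≤ ‖b‖ ^ p := by positivity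
      simp only at h
      constructor
      · exact le_of_not_gt fun h1 => by linarith [Real.one_lt_rpow h1 hp0]
      · exact le_of_not_gt fun h1 => by linarith [Real.one_lt_rpow h1 hp0]
  obtain ⟨δ, hδ, hδK⟩ : ∃ δ : ℝ, 0 < δ ∧ ∀ z ∈ K,
      δ ≤ (‖z.1‖ ^ p + ‖z.2‖ ^ p) / 2 - ‖(1 / 2 : ℝ) • (z.1 + z.2)‖ ^ p := by
    rcases K.eq_empty_or_nonempty with hK | hK
    · exact ⟨1, one_pos, by simp [hK]⟩
    · obtain ⟨z, hz, hmin⟩ := hKc.exists_isMinOn hK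
        (f := fun z => (‖z.1‖ ^ p + ‖z.2‖ ^ p) / 2 - ‖(1 / 2 : ℝ) • (z.1 + z.2)‖ ^ p)
        ((((cn continuous_fst).add (cn continuous_snd)).div_const _).sub
          (cn ((continuous_fst.add continuous_snd).const_smul (1 / 2 : ℝ)))).continuousOn
      refine ⟨_, gap_pos z.1 z.2 ?_, fun w hw => hmin hw⟩
      intro h
      have := hz.2
      rw [h, sub_self, norm_zero, Real.zero_rpow hp0.ne'] at this
      linarith
  -- With `s = ‖a‖^p + ‖b‖^p`, always `‖a - b‖^p ≤ 2^p s`, while the gap is at least `δ s` on the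
  -- cone over `K`; the quotient of the two constants is `C`.
  refine ⟨2 ^ p / δ, by positivity, fun a b => ?_⟩
  have hg := gap_nonneg a b
  set s := ‖a‖ ^ p + ‖b‖ ^ p with hs
  have hs0 : 0 ≤ s := by positivity
  have hab : ‖a - b‖ ^ p ≤ 2 ^ p * s := by
    have : ‖a - b‖ ≤ 2 * max ‖a‖ ‖b‖ := by
      linarith [norm_sub_le a b, le_max_left ‖a‖ ‖b‖, le_max_right ‖a‖ ‖b‖]
    calc ‖a - b‖ ^ p ≤ (2 * max ‖a‖ ‖b‖) ^ p := Real.rpow_le_rpow (norm_nonneg _) this hp0.le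
      _ = 2 ^ p * (max ‖a‖ ‖b‖) ^ p := Real.mul_rpow (by norm_num) (by positivity)
      _ ≤ 2 ^ p * s := by
        gcongr
        have ha : (0 : ℝ) ≤ ‖a‖ ^ p := by positivity
        have hb : (0 : ℝ) ≤ ‖b‖ ^ p := by positivity
        rcases max_choice ‖a‖ ‖b‖ with h | h <;> rw [h] <;> linarith
  by_cases hsm : ‖a - b‖ ^ p ≤ η * s
  · have : 0 ≤ 2 ^ p / δ * (s / 2 - ‖(1 / 2 : ℝ) • (a + b)‖ ^ p) := by positivity
    linarith
  push Not at hsm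
  have hspos : 0 < s := by
    rcases hs0.eq_or_lt with h | h
    · rw [← h] at hab hsm; simp at hab hsm; linarith
    · exact h
  -- The scaling factor with `t^p s = 1`, which moves `(a, b)` into `K`.
  set t : ℝ := (s ^ (1 / p))⁻¹ with ht
  have ht0 : 0 < t := by positivity
  have htp : t ^ p = s⁻¹ := by
    rw [ht, Real.inv_rpow (by positivity), ← Real.rpow_mul hs0, one_div_mul_cancel hp0.ne',
      Real.rpow_one]
  have hsmul : ∀ c : F, ‖t • c‖ ^ p = s⁻¹ * ‖c‖ ^ p := by
    intro c
    rw [norm_smul, Real.norm_of_nonneg ht0.le, Real.mul_rpow ht0.le (norm_nonneg _), htp]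
  have hz : (t • a, t • b) ∈ K := by
    refine ⟨?_, ?_⟩
    · simp only [hsmul]
      rw [← mul_add, ← hs, inv_mul_cancel₀ hspos.ne']
    · simp only [← smul_sub, hsmul]
      rw [← div_eq_inv_mul, le_div_iff₀ hspos]
      exact hsm.le
  have := hδK _ hz
  simp only [← smul_add, smul_comm (1 / 2 : ℝ) t, hsmul] at this
  rw [← mul_add, ← hs, smul_add, ← smul_add (1 / 2 : ℝ)] at this
  have h4 : δ * s ≤ s / 2 - ‖(1 / 2 : ℝ) • (a + b)‖ ^ p := by
    calc δ * s ≤ (s⁻¹ * s / 2 - s⁻¹ * ‖(1 / 2 : ℝ) • (a + b)‖ ^ p) * s := by gcongr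
      _ = _ := by field_simp
  have h5 : 2 ^ p * s ≤ 2 ^ p / δ * (s / 2 - ‖(1 / 2 : ℝ) • (a + b)‖ ^ p) := by
    calc 2 ^ p * s = 2 ^ p / δ * (δ * s) := by field_simp
      _ ≤ _ := by gcongr
  have : 0 ≤ η * s := by positivity
  linarith

theorem MeasureTheory.MemLp.integrable_norm_rpow_ofReal {α F : Type*} [MeasurableSpace α]
    {μ : Measure α} [NormedAddCommGroup F] {p : ℝ} (hp : 0 < p) {f : α → F}
    (hf : MemLp f (ENNReal.ofReal p) μ) : Integrable (fun x => ‖f x‖ ^ p) μ := by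
  simpa [ENNReal.toReal_ofReal hp.le] using
    hf.integrable_norm_rpow (by simpa using hp) ENNReal.ofReal_ne_top

theorem MeasureTheory.MemLp.eLpNorm_ofReal_eq {α F : Type*} [MeasurableSpace α]
    {μ : Measure α} [NormedAddCommGroup F] {p : ℝ} (hp : 0 < p) {f : α → F}
    (hf : MemLp f (ENNReal.ofReal p) μ) :
    eLpNorm f (ENNReal.ofReal p) μ = ENNReal.ofReal ((∫ x, ‖f x‖ ^ p ∂μ) ^ p⁻¹) := by
  simpa [ENNReal.toReal_ofReal hp.le] using
    hf.eLpNorm_eq_integral_rpow_norm (by simpa using hp) ENNReal.ofReal_ne_top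

theorem MeasureTheory.MemLp.integral_norm_rpow_eq {α F : Type*} [MeasurableSpace α]
    {μ : Measure α} [NormedAddCommGroup F] {p : ℝ} (hp : 0 < p) {f : α → F}
    (hf : MemLp f (ENNReal.ofReal p) μ) :
    ∫ x, ‖f x‖ ^ p ∂μ = (eLpNorm f (ENNReal.ofReal p) μ).toReal ^ p := by
  have h0 : 0 ≤ ∫ x, ‖f x‖ ^ p ∂μ := integral_nonneg fun x => by positivity
  rw [hf.eLpNorm_ofReal_eq hp, ENNReal.toReal_ofReal (by positivity), Real.rpow_inv_rpow h0 hp.ne']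

/-- Convergence in `L^p` entails convergence of `∫ ‖f‖ ^ p`. -/
theorem tendsto_integral_norm_rpow {α F ι : Type*} [MeasurableSpace α] {μ : Measure α}
    [NormedAddCommGroup F] {p : ℝ} (hp : 1 ≤ p) {l : Filter ι} {f : ι → α → F} {g : α → F}
    (hf : ∀ k, MemLp (f k) (ENNReal.ofReal p) μ) (hg : MemLp g (ENNReal.ofReal p) μ)
    (h : Tendsto (fun k => eLpNorm (f k - g) (ENNReal.ofReal p) μ) l (𝓝 0)) :
    Tendsto (fun k => ∫ x, ‖f k x‖ ^ p ∂μ) l (𝓝 (∫ x, ‖g x‖ ^ p ∂μ)) := by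
  have hp0 : 0 < p := by linarith
  have hP : (1 : ENNReal) ≤ ENNReal.ofReal p := by simpa using hp
  have : Fact ((1 : ENNReal) ≤ ENNReal.ofReal p) := ⟨hP⟩
  have h1 : Tendsto (fun k => (hf k).toLp (f k)) l (𝓝 (hg.toLp g)) :=
    (Lp.tendsto_Lp_iff_tendsto_eLpNorm'' f hf g hg).2 h
  have h2 := (h1.norm).rpow_const (p := p) (Or.inr hp0.le)
  simp only [Lp.norm_toLp] at h2
  simpa only [(hf _).integral_norm_rpow_eq hp0, hg.integral_norm_rpow_eq hp0] using h2

theorem tendsto_eLpNorm_of_tendsto_integral_norm_rpow {α F ι : Type*} [MeasurableSpace α]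
    {μ : Measure α}
    [NormedAddCommGroup F] {p : ℝ} (hp : 0 < p) {l : Filter ι} {f : ι → α → F}
    (hf : ∀ k, MemLp (f k) (ENNReal.ofReal p) μ)
    (h : Tendsto (fun k => ∫ x, ‖f k x‖ ^ p ∂μ) l (𝓝 0)) :
    Tendsto (fun k => eLpNorm (f k) (ENNReal.ofReal p) μ) l (𝓝 0) := by
  have h2 := h.rpow_const (p := p⁻¹) (Or.inr (by positivity))
  rw [Real.zero_rpow (by positivity)] at h2
  have := ENNReal.tendsto_ofReal h2
  simpa only [(hf _).eLpNorm_ofReal_eq hp, ENNReal.ofReal_zero] using this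

/-- A sequence whose energies tend to `L`, and whose midpoints have energy asymptotically at least
`L`, converges in `L^p`. -/
theorem exists_tendsto_eLpNorm_of_midpoint_energy {α F : Type*} [MeasurableSpace α] {μ : Measure α}
    [NormedAddCommGroup F] [InnerProductSpace ℝ F] [FiniteDimensional ℝ F]
    {p : ℝ} (hp : 1 < p) {g : ℕ → α → F} (hg : ∀ k, MemLp (g k) (ENNReal.ofReal p) μ)
    {L : ℝ} (hL : Tendsto (fun k => ∫ x, ‖g k x‖ ^ p ∂μ) atTop (𝓝 L))
    {e : ℕ × ℕ → ℝ} (he : Tendsto e atTop (𝓝 L))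
    (hmid : ∀ k l, e (k, l) ≤ ∫ x, ‖(1 / 2 : ℝ) • (g k x + g l x)‖ ^ p ∂μ) :
    ∃ G : α → F, MemLp G (ENNReal.ofReal p) μ ∧
      Tendsto (fun k => eLpNorm (g k - G) (ENNReal.ofReal p) μ) atTop (𝓝 0) := by
  have hp0 : 0 < p := by linarith
  have hP : (1 : ENNReal) ≤ ENNReal.ofReal p := by simpa using hp.le
  have : Fact ((1 : ENNReal) ≤ ENNReal.ofReal p) := ⟨hP⟩
  set I : ℕ → ℝ := fun k => ∫ x, ‖g k x‖ ^ p ∂μ with hI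
  have hint := fun k => (hg k).integrable_norm_rpow_ofReal hp0
  have h1 : Tendsto (fun z : ℕ × ℕ => I z.1) atTop (𝓝 L) := by
    rw [← prod_atTop_atTop_eq]; exact hL.comp tendsto_fst
  have h2 : Tendsto (fun z : ℕ × ℕ => I z.2) atTop (𝓝 L) := by
    rw [← prod_atTop_atTop_eq]; exact hL.comp tendsto_snd
  have hL0 : 0 ≤ L := ge_of_tendsto' hL fun k => integral_nonneg fun x => by positivity
  have key : Tendsto (fun z : ℕ × ℕ => ∫ x, ‖(g z.1 - g z.2) x‖ ^ p ∂μ) atTop (𝓝 0) := by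
    rw [Metric.tendsto_atTop']
    intro ε hε
    -- In the limit the `η` term contributes `2 L η = ε L / (2 L + 1) < ε`, and the gap term
    -- vanishes since endpoints and midpoints share the limiting energy `L`. The `+ 1` covers `L =
    -- 0`.
    have hη : 0 < ε / (2 * (2 * L + 1)) := by positivity
    obtain ⟨C, hC, hCab⟩ := norm_sub_rpow_le_add_convexity_gap (F := F) hp hη
    have hub : ∀ z : ℕ × ℕ, ∫ x, ‖(g z.1 - g z.2) x‖ ^ p ∂μ ≤
        ε / (2 * (2 * L + 1)) * (I z.1 + I z.2) + C * ((I z.1 + I z.2) / 2 - e z) := by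
      intro z
      have hm : Integrable (fun x => ‖(1 / 2 : ℝ) • (g z.1 x + g z.2 x)‖ ^ p) μ :=
        (((hg z.1).add (hg z.2)).const_smul (1 / 2 : ℝ)).integrable_norm_rpow_ofReal hp0
      have hs : Integrable (fun x => ‖g z.1 x‖ ^ p + ‖g z.2 x‖ ^ p) μ := (hint z.1).add (hint z.2)
      have hd : Integrable (fun x => (‖g z.1 x‖ ^ p + ‖g z.2 x‖ ^ p) / 2
          - ‖(1 / 2 : ℝ) • (g z.1 x + g z.2 x)‖ ^ p) μ := (hs.div_const 2).sub hm
      calc ∫ x, ‖(g z.1 - g z.2) x‖ ^ p ∂μ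
          ≤ ∫ x, (ε / (2 * (2 * L + 1)) * (‖g z.1 x‖ ^ p + ‖g z.2 x‖ ^ p) +
            C * ((‖g z.1 x‖ ^ p + ‖g z.2 x‖ ^ p) / 2
              - ‖(1 / 2 : ℝ) • (g z.1 x + g z.2 x)‖ ^ p)) ∂μ := by
            refine integral_mono (((hg z.1).sub (hg z.2)).integrable_norm_rpow_ofReal hp0)
              ((hs.const_mul _).add (hd.const_mul C)) fun x => hCab _ _
        _ = ε / (2 * (2 * L + 1)) * (I z.1 + I z.2) + C * ((I z.1 + I z.2) / 2 -
              ∫ x, ‖(1 / 2 : ℝ) • (g z.1 x + g z.2 x)‖ ^ p ∂μ) := by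
            rw [integral_add (hs.const_mul _) (hd.const_mul C),
              integral_const_mul, integral_const_mul, integral_sub (hs.div_const 2) hm,
              integral_div, integral_add (hint z.1) (hint z.2)]
        _ ≤ _ := by
            have := hmid z.1 z.2
            gcongr
    have hlim : Tendsto (fun z : ℕ × ℕ => ε / (2 * (2 * L + 1)) * (I z.1 + I z.2) +
        C * ((I z.1 + I z.2) / 2 - e z)) atTop
        (𝓝 (ε / (2 * (2 * L + 1)) * (L + L) + C * ((L + L) / 2 - L))) :=
      ((h1.add h2).const_mul _).add ((((h1.add h2).div_const 2).sub he).const_mul C)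
    have hlt : ε / (2 * (2 * L + 1)) * (L + L) + C * ((L + L) / 2 - L) < ε := by
      have : ε / (2 * (2 * L + 1)) * (L + L) = ε * (L / (2 * L + 1)) := by field_simp; ring
      rw [this, show (L + L) / 2 - L = 0 by ring, mul_zero, add_zero]
      have : L / (2 * L + 1) < 1 := by rw [div_lt_one (by positivity)]; linarith
      nlinarith
    obtain ⟨z₀, hz₀⟩ := eventually_atTop.1 (hlim.eventually_lt_const hlt)
    refine ⟨z₀, fun z hz => ?_⟩
    rw [Real.dist_0_eq_abs, abs_of_nonneg (integral_nonneg fun x => by positivity)]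
    exact (hub z).trans_lt (hz₀ z hz.le)
  have key2 := tendsto_eLpNorm_of_tendsto_integral_norm_rpow hp0
    (fun z : ℕ × ℕ => (hg z.1).sub (hg z.2)) key
  have hC : CauchySeq fun k => (hg k).toLp (g k) := by
    rw [EMetric.cauchySeq_iff]
    intro ε hε
    obtain ⟨⟨a, b⟩, hab⟩ := eventually_atTop.1 (key2.eventually_lt_const hε)
    refine ⟨max a b, fun m hm n hn => ?_⟩
    rw [Lp.edist_toLp_toLp]
    exact hab (m, n) ⟨(le_max_left a b).trans hm, (le_max_right a b).trans hn⟩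
  obtain ⟨G, hG⟩ := cauchySeq_tendsto_of_complete hC
  refine ⟨G, Lp.memLp G, ?_⟩
  exact (Lp.tendsto_Lp_iff_tendsto_eLpNorm'' g hg G (Lp.memLp G)).1 (by simpa using hG)

/-- The energy `t ↦ ∫ ‖f + t g‖ ^ p` is differentiable at `0`. -/
theorem hasDerivAt_integral_norm_add_smul_rpow {α F : Type*} [MeasurableSpace α] {μ : Measure α}
    [NormedAddCommGroup F] [InnerProductSpace ℝ F]
    {p : ℝ} (hp : 1 < p) {f g : α → F} (hf : MemLp f (ENNReal.ofReal p) μ)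
    (hg : MemLp g (ENNReal.ofReal p) μ) :
    HasDerivAt (fun t : ℝ => ∫ x, ‖f x + t • g x‖ ^ p ∂μ)
      (p * ∫ x, ‖f x‖ ^ (p - 2) * inner ℝ (f x) (g x) ∂μ) 0 := by
  have hp0 : 0 < p := by linarith
  have hd : ∀ x, ∀ t : ℝ, HasDerivAt (fun t : ℝ => ‖f x + t • g x‖ ^ p)
      (p * ‖f x + t • g x‖ ^ (p - 2) * inner ℝ (f x + t • g x) (g x)) t := by
    intro x t
    have h1 : HasDerivAt (fun t : ℝ => f x + t • g x) (g x) t := by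
      simpa using ((hasDerivAt_id t).smul_const (g x)).const_add (f x)
    have := (hasFDerivAt_norm_rpow (f x + t • g x) hp).comp_hasDerivAt t h1
    simp only [smul_apply, innerSL_apply_apply, smul_eq_mul] at this
    exact this
  have hm : ∀ t : ℝ, MemLp (fun x => f x + t • g x) (ENNReal.ofReal p) μ := fun t =>
    hf.add (hg.const_smul t)
  have hb : Integrable (fun x => p * (‖f x‖ + ‖g x‖) ^ p) μ := by
    have := (hf.norm.add hg.norm).integrable_norm_rpow_ofReal hp0
    refine (this.const_mul p).congr (Eventually.of_forall fun x => ?_)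
    simp only [Pi.add_apply]
    rw [Real.norm_of_nonneg (by positivity)]
  have := hasDerivAt_integral_of_dominated_loc_of_deriv_le (μ := μ) (x₀ := (0 : ℝ))
    (F := fun t x => ‖f x + t • g x‖ ^ p)
    (F' := fun t x => p * ‖f x + t • g x‖ ^ (p - 2) * inner ℝ (f x + t • g x) (g x))
    (bound := fun x => p * (‖f x‖ + ‖g x‖) ^ p) (Metric.ball_mem_nhds 0 one_pos)
    (Eventually.of_forall fun t => ((hm t).integrable_norm_rpow_ofReal hp0).aestronglyMeasurable)
    ((hm 0).integrable_norm_rpow_ofReal hp0) ?_ ?_ hb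
    (Eventually.of_forall fun x t _ => hd x t)
  · have e : ∫ x, p * ‖f x + (0 : ℝ) • g x‖ ^ (p - 2) * inner ℝ (f x + (0 : ℝ) • g x) (g x) ∂μ =
        p * ∫ x, ‖f x‖ ^ (p - 2) * inner ℝ (f x) (g x) ∂μ := by
      simp only [zero_smul, add_zero, mul_assoc]
      rw [integral_const_mul]
    rw [← e]
    exact this.2
  · simp only [zero_smul, add_zero]
    exact ((hf.1.norm.aemeasurable.pow_const _).aestronglyMeasurable.const_mul p).mul
      (hf.1.inner hg.1)
  · refine Eventually.of_forall fun x t ht => ?_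
    have ht1 : |t| ≤ 1 := by
      rw [mem_ball_zero_iff, Real.norm_eq_abs] at ht; exact ht.le
    set c := f x + t • g x with hc
    have hcb : ‖c‖ ≤ ‖f x‖ + ‖g x‖ := by
      refine (norm_add_le _ _).trans ?_
      rw [norm_smul, Real.norm_eq_abs]
      gcongr
      exact mul_le_of_le_one_left (norm_nonneg _) ht1
    -- The exponent `p - 2` may be negative, so powers of `‖c‖` can be merged only when `c ≠ 0`; at
    -- `c = 0` the inner product vanishes.
    rcases eq_or_ne c 0 with h0 | h0
    · rw [h0]; simp; positivity
    have hc0 : 0 < ‖c‖ := norm_pos_iff.2 h0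
    rw [norm_mul, norm_mul, Real.norm_of_nonneg hp0.le, Real.norm_of_nonneg (by positivity),
      mul_assoc]
    gcongr
    calc ‖c‖ ^ (p - 2) * ‖inner ℝ c (g x)‖ ≤ ‖c‖ ^ (p - 2) * (‖c‖ * ‖g x‖) := by
          gcongr; exact norm_inner_le_norm _ _
      _ = ‖c‖ ^ (p - 1) * ‖g x‖ := by
          rw [← mul_assoc, ← Real.rpow_add_one hc0.ne']; ring_nf
      _ ≤ (‖f x‖ + ‖g x‖) ^ (p - 1) * (‖f x‖ + ‖g x‖) := by
          gcongr
          linarith [norm_nonneg (f x)]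
      _ = (‖f x‖ + ‖g x‖) ^ p := by
          have : ‖f x‖ + ‖g x‖ ≠ 0 := by linarith
          rw [← Real.rpow_add_one this]; ring_nf

/-! ### Translation estimates and Rellich compactness -/

theorem lintegral_rpow_le_of_isProbabilityMeasure {α : Type*} [MeasurableSpace α] {μ : Measure α}
    [IsProbabilityMeasure μ] {p : ℝ} (hp : 1 ≤ p) {f : α → ENNReal} (hf : AEMeasurable f μ) :
    (∫⁻ x, f x ∂μ) ^ p ≤ ∫⁻ x, f x ^ p ∂μ := by
  have hp0 : 0 < p := by linarith
  have h := eLpNorm'_le_eLpNorm'_of_exponent_le (μ := μ) (f := f) one_pos hp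
    hf.aestronglyMeasurable
  simp only [eLpNorm', enorm_eq_self, ENNReal.rpow_one, div_one] at h
  rwa [one_div, ENNReal.le_rpow_inv_iff hp0] at h

section Translation

variable {E : Type*} [NormedAddCommGroup E] [NormedSpace ℝ E]
  [MeasurableSpace E] [BorelSpace E] {μ : Measure E} [SFinite μ] [μ.IsAddRightInvariant]

/-- The increment is the integral of the derivative along the segment from `x` to `x + z`. Jensen
moves the power inside, and after Tonelli the translation by `t • z` disappears by invariance of the
measure. -/
theorem lintegral_enorm_add_sub_rpow_le {φ : E → ℝ} (hφ : ContDiff ℝ 1 φ) {p : ℝ} (hp : 1 ≤ p)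
    (z : E) :
    ∫⁻ x, ‖φ (x + z) - φ x‖ₑ ^ p ∂μ ≤ ‖z‖ₑ ^ p * ∫⁻ x, ‖fderiv ℝ φ x‖ₑ ^ p ∂μ := by
  have hp0 : 0 ≤ p := by linarith
  have hc : Continuous (fderiv ℝ φ) := hφ.continuous_fderiv one_ne_zero
  let ρ : Measure ℝ := volume.restrict (Set.Ioc (0 : ℝ) 1)
  have : IsProbabilityMeasure ρ := ⟨by simp [ρ]⟩
  have pt : ∀ x, ‖φ (x + z) - φ x‖ₑ ^ p ≤
      ∫⁻ t, ‖z‖ₑ ^ p * ‖fderiv ℝ φ (x + t • z)‖ₑ ^ p ∂ρ := by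
    intro x
    have hd : ∀ t : ℝ, HasDerivAt (fun t : ℝ => φ (x + t • z)) (fderiv ℝ φ (x + t • z) z) t := by
      intro t
      have h1 : HasDerivAt (fun t : ℝ => x + t • z) z t := by
        simpa using ((hasDerivAt_id t).smul_const z).const_add x
      exact ((hφ.differentiable one_ne_zero) (x + t • z)).hasFDerivAt.comp_hasDerivAt t h1
    have hc' : Continuous fun t : ℝ => fderiv ℝ φ (x + t • z) := hc.comp (by fun_prop)
    have hcz : Continuous fun t : ℝ => fderiv ℝ φ (x + t • z) z := hc'.clm_apply continuous_const
    have h := intervalIntegral.integral_eq_sub_of_hasDerivAt (fun t _ => hd t)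
      (hcz.intervalIntegrable 0 1)
    simp only [one_smul, zero_smul, add_zero] at h
    rw [intervalIntegral.integral_of_le zero_le_one] at h
    calc ‖φ (x + z) - φ x‖ₑ ^ p ≤ (∫⁻ t, ‖z‖ₑ * ‖fderiv ℝ φ (x + t • z)‖ₑ ∂ρ) ^ p := by
          rw [← h]
          gcongr
          refine (enorm_integral_le_lintegral_enorm _).trans (lintegral_mono fun t => ?_)
          rw [mul_comm]
          exact ContinuousLinearMap.le_opENorm _ _
      _ ≤ ∫⁻ t, (‖z‖ₑ * ‖fderiv ℝ φ (x + t • z)‖ₑ) ^ p ∂ρ :=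
          lintegral_rpow_le_of_isProbabilityMeasure hp
            (hc'.enorm.measurable.const_mul _).aemeasurable
      _ = _ := by simp only [ENNReal.mul_rpow_of_nonneg _ _ hp0]
  have hmeas : Measurable fun q : E × ℝ => ‖z‖ₑ ^ p * ‖fderiv ℝ φ (q.1 + q.2 • z)‖ₑ ^ p := by
    have : Continuous fun q : E × ℝ => fderiv ℝ φ (q.1 + q.2 • z) := hc.comp (by fun_prop)
    exact (this.enorm.measurable.pow_const p).const_mul _
  calc ∫⁻ x, ‖φ (x + z) - φ x‖ₑ ^ p ∂μ
      ≤ ∫⁻ x, ∫⁻ t, ‖z‖ₑ ^ p * ‖fderiv ℝ φ (x + t • z)‖ₑ ^ p ∂ρ ∂μ := lintegral_mono pt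
    _ = ∫⁻ t, ∫⁻ x, ‖z‖ₑ ^ p * ‖fderiv ℝ φ (x + t • z)‖ₑ ^ p ∂μ ∂ρ :=
        lintegral_lintegral_swap hmeas.aemeasurable
    _ = ∫⁻ _t, ‖z‖ₑ ^ p * ∫⁻ x, ‖fderiv ℝ φ x‖ₑ ^ p ∂μ ∂ρ := by
        refine lintegral_congr fun t => ?_
        rw [lintegral_add_right_eq_self (fun x => ‖z‖ₑ ^ p * ‖fderiv ℝ φ x‖ₑ ^ p) (t • z),
          lintegral_const_mul _ (hc.enorm.measurable.pow_const p)]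
    _ = _ := by simp

end Translation

/-- The half-open cube of side `h` with lower corner `h k`. -/
def gridCell {N : ℕ} (h : ℝ) (k : Fin N → ℤ) : Set (EuclideanSpace ℝ (Fin N)) :=
  {x | ∀ i, ⌊x i / h⌋ = k i}

section GridCell

variable {N : ℕ} {h : ℝ} {k : Fin N → ℤ}

theorem gridCell_eq_preimage (hh : 0 < h) : gridCell h k =
    (@WithLp.ofLp 2 (Fin N → ℝ)) ⁻¹' (Set.univ.pi fun i => Set.Ico (k i * h) ((k i + 1) * h)) := by
  ext x
  simp [gridCell, Int.floor_eq_iff, le_div_iff₀ hh, div_lt_iff₀ hh]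

theorem measurableSet_gridCell (hh : 0 < h) : MeasurableSet (gridCell h k) := by
  rw [gridCell_eq_preimage hh]
  exact (PiLp.volume_preserving_ofLp (Fin N)).measurable
    (MeasurableSet.univ_pi fun i => measurableSet_Ico)

theorem volume_gridCell (hh : 0 < h) : volume (gridCell h k) = ENNReal.ofReal (h ^ N) := by
  rw [gridCell_eq_preimage hh, (PiLp.volume_preserving_ofLp (Fin N)).measure_preimage
    (MeasurableSet.univ_pi fun i => measurableSet_Ico).nullMeasurableSet, Real.volume_pi_Ico]
  have : ∀ i, (k i + 1) * h - k i * h = h := fun i => by ring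
  simp [this, ENNReal.ofReal_pow hh.le]

theorem norm_sub_le_of_mem_gridCell (hh : 0 < h) {x y : EuclideanSpace ℝ (Fin N)}
    (hx : x ∈ gridCell h k) (hy : y ∈ gridCell h k) : ‖y - x‖ ≤ h * √N := by
  rw [EuclideanSpace.norm_eq]
  refine Real.sqrt_le_iff.2 ⟨by positivity, ?_⟩
  rw [mul_pow, Real.sq_sqrt (Nat.cast_nonneg N)]
  calc ∑ i, ‖(y - x) i‖ ^ 2 ≤ ∑ _i : Fin N, h ^ 2 := by
        refine Finset.sum_le_sum fun i _ => ?_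
        gcongr
        rw [gridCell_eq_preimage hh] at hx hy
        have h1 := hx i (Set.mem_univ i)
        have h2 := hy i (Set.mem_univ i)
        rw [PiLp.sub_apply, Real.norm_eq_abs, abs_le]
        constructor <;> nlinarith [h1.1, h1.2, h2.1, h2.2]
    _ = h ^ 2 * N := by simp [mul_comm]

theorem pairwise_disjoint_gridCell (h : ℝ) :
    Pairwise (Function.onFun Disjoint (gridCell h : (Fin N → ℤ) → Set _)) := by
  intro k l hkl
  refine Set.disjoint_left.2 fun x hx hy => hkl (funext fun i => ?_)
  rw [← hx i, ← hy i]

theorem exists_finset_subset_iUnion_gridCell (hh : 0 < h) {U : Set (EuclideanSpace ℝ (Fin N))}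
    (hU : Bornology.IsBounded U) : ∃ S : Finset (Fin N → ℤ), U ⊆ ⋃ k ∈ S, gridCell h k := by
  obtain ⟨R, hR⟩ := hU.exists_norm_le
  refine ⟨Fintype.piFinset fun _ => Finset.Icc ⌊-R / h⌋ ⌊R / h⌋, fun x hx => ?_⟩
  simp only [Set.mem_iUnion]
  refine ⟨fun i => ⌊x i / h⌋, ?_, fun i => rfl⟩
  have hxi : ∀ i, |x i| ≤ R := fun i => (PiLp.norm_apply_le x i).trans (hR x hx)
  simp only [Fintype.mem_piFinset, Finset.mem_Icc]
  intro i
  have := abs_le.1 (hxi i)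
  exact ⟨Int.floor_le_floor (by gcongr; exact this.1), Int.floor_le_floor (by gcongr; exact this.2)⟩

/-- By Jensen, the deviation from a cell average is controlled by an average of increments `φ (x +
z) - φ x` with `‖z‖ ≤ h √N`, to which the translation estimate applies. The bound does not depend on
the number of cells and is of order `h^p`, which gives uniform approximation by step functions. -/
theorem sum_lintegral_gridCell_sub_average_rpow_le (hh : 0 < h) (S : Finset (Fin N → ℤ))
    {φ : EuclideanSpace ℝ (Fin N) → ℝ} (hφ : ContDiff ℝ 1 φ) {p : ℝ} (hp : 1 ≤ p) :
    ∑ k ∈ S, ∫⁻ x in gridCell h k, ‖φ x - ⨍ y in gridCell h k, φ y‖ₑ ^ p ≤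
      volume (Metric.closedBall (0 : EuclideanSpace ℝ (Fin N)) √N) *
        (ENNReal.ofReal (h * √N) ^ p * ∫⁻ x, ‖fderiv ℝ φ x‖ₑ ^ p) := by
  have hp0 : 0 ≤ p := by linarith
  set V := ENNReal.ofReal (h ^ N) with hV
  have hV0 : V ≠ 0 := by rw [hV]; simpa using pow_pos hh N
  have hVt : V ≠ ⊤ := ENNReal.ofReal_ne_top
  set B := Metric.closedBall (0 : EuclideanSpace ℝ (Fin N)) (h * √N) with hB
  have hmeas : Measurable fun q : EuclideanSpace ℝ (Fin N) × EuclideanSpace ℝ (Fin N) =>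
      ‖φ (q.1 + q.2) - φ q.1‖ₑ ^ p := by
    have : Continuous fun q : EuclideanSpace ℝ (Fin N) × EuclideanSpace ℝ (Fin N) =>
      φ (q.1 + q.2) - φ q.1 :=
        (hφ.continuous.comp (by fun_prop)).sub (hφ.continuous.comp continuous_fst)
    exact this.enorm.measurable.pow_const p
  have cell : ∀ k ∈ S, ∫⁻ x in gridCell h k, ‖φ x - ⨍ y in gridCell h k, φ y‖ₑ ^ p ≤
      ∫⁻ x in gridCell h k, V⁻¹ * ∫⁻ z in B, ‖φ (x + z) - φ x‖ₑ ^ p := by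
    intro k _
    refine setLIntegral_mono' (measurableSet_gridCell hh) fun x hx => ?_
    let ρ : Measure (EuclideanSpace ℝ (Fin N)) := V⁻¹ • volume.restrict (gridCell h k)
    have hρ1 : ρ Set.univ = 1 := by
      simp [ρ, volume_gridCell hh, ← hV, ENNReal.inv_mul_cancel hV0 hVt]
    have : IsProbabilityMeasure ρ := ⟨hρ1⟩
    have havg : ⨍ y in gridCell h k, φ y = ∫ y, φ y ∂ρ := by
      rw [average, Measure.restrict_apply_univ, volume_gridCell hh]
    have hint : Integrable φ ρ := by
      refine Integrable.smul_measure ?_ (ENNReal.inv_ne_top.2 hV0)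
      refine (hφ.continuous.continuousOn.integrableOn_compact
        (isCompact_closedBall x (h * √N))).mono_set fun y hy => ?_
      rw [mem_closedBall_iff_norm]
      exact norm_sub_le_of_mem_gridCell hh hx hy
    have hsub : φ x - ⨍ y in gridCell h k, φ y = ∫ y, (φ x - φ y) ∂ρ := by
      rw [integral_sub (integrable_const _) hint, havg]; simp
    calc ‖φ x - ⨍ y in gridCell h k, φ y‖ₑ ^ p ≤ (∫⁻ y, ‖φ x - φ y‖ₑ ∂ρ) ^ p := by
          rw [hsub]; gcongr; exact enorm_integral_le_lintegral_enorm _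
      _ ≤ ∫⁻ y, ‖φ x - φ y‖ₑ ^ p ∂ρ := lintegral_rpow_le_of_isProbabilityMeasure hp
          (continuous_const.sub hφ.continuous).enorm.measurable.aemeasurable
      _ = V⁻¹ * ∫⁻ y in gridCell h k, ‖φ x - φ y‖ₑ ^ p := by
          rw [lintegral_smul_measure, smul_eq_mul]
      _ ≤ V⁻¹ * ∫⁻ z in B, ‖φ (x + z) - φ x‖ₑ ^ p := by
          refine mul_le_mul_right ?_ _
          -- Substitution `y = x + z`: when `x` and `y` share a cell, `z` lies in `B` because the
          -- cell has diameter at most `h √N`.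
          rw [← lintegral_indicator (measurableSet_gridCell hh), ← lintegral_add_left_eq_self _ x,
            ← lintegral_indicator Metric.isClosed_closedBall.measurableSet]
          refine lintegral_mono fun z => ?_
          by_cases hz : x + z ∈ gridCell h k
          · have hzB : z ∈ B := by
              rw [hB, mem_closedBall_zero_iff]
              simpa using norm_sub_le_of_mem_gridCell hh hx hz
            rw [Set.indicator_of_mem hz, Set.indicator_of_mem hzB, ← enorm_neg, neg_sub]
          · rw [Set.indicator_of_notMem hz]; exact zero_le
  calc ∑ k ∈ S, ∫⁻ x in gridCell h k, ‖φ x - ⨍ y in gridCell h k, φ y‖ₑ ^ p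
      ≤ ∑ k ∈ S, ∫⁻ x in gridCell h k, V⁻¹ * ∫⁻ z in B, ‖φ (x + z) - φ x‖ₑ ^ p :=
        Finset.sum_le_sum cell
    _ = ∫⁻ x in ⋃ k ∈ S, gridCell h k, V⁻¹ * ∫⁻ z in B, ‖φ (x + z) - φ x‖ₑ ^ p :=
        (lintegral_biUnion_finset ((pairwise_disjoint_gridCell h).set_pairwise _)
          (fun k _ => measurableSet_gridCell hh) _).symm
    _ ≤ ∫⁻ x, V⁻¹ * ∫⁻ z in B, ‖φ (x + z) - φ x‖ₑ ^ p := setLIntegral_le_lintegral _ _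
    _ = V⁻¹ * ∫⁻ z in B, ∫⁻ x, ‖φ (x + z) - φ x‖ₑ ^ p := by
        rw [lintegral_const_mul _ hmeas.lintegral_prod_right',
          lintegral_lintegral_swap hmeas.aemeasurable]
    _ ≤ V⁻¹ * ∫⁻ _z in B, ENNReal.ofReal (h * √N) ^ p * ∫⁻ x, ‖fderiv ℝ φ x‖ₑ ^ p := by
        refine mul_le_mul_right (setLIntegral_mono' Metric.isClosed_closedBall.measurableSet
          fun z hz => (lintegral_enorm_add_sub_rpow_le hφ hp z).trans ?_) _
        gcongr
        rw [← ofReal_norm]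
        exact ENNReal.ofReal_le_ofReal (mem_closedBall_zero_iff.1 hz)
    _ = _ := by
        -- The ball of radius `h √N` has volume `h^N` times that of radius `√N`, and `h^N` cancels
        -- the cell normalization `V⁻¹`.
        rw [setLIntegral_const, hB, Measure.addHaar_closedBall_mul _ _ hh.le (Real.sqrt_nonneg _)]
        simp only [finrank_euclideanSpace, Fintype.card_fin]
        rw [← hV]
        calc _ = V⁻¹ * V * (volume (Metric.closedBall (0 : EuclideanSpace ℝ (Fin N)) √N) *
              (ENNReal.ofReal (h * √N) ^ p * ∫⁻ x, ‖fderiv ℝ φ x‖ₑ ^ p)) := by ring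
          _ = _ := by rw [ENNReal.inv_mul_cancel hV0 hVt, one_mul]

end GridCell

section Rellich

variable {N : ℕ} {h : ℝ}

theorem memLp_sum_indicator_gridCell (hh : 0 < h) (S : Finset (Fin N → ℤ)) (c : S → ℝ)
    {q : ENNReal} {μ : Measure (EuclideanSpace ℝ (Fin N))} [IsFiniteMeasure μ] :
    MemLp (fun x => ∑ k, c k * (gridCell h k.1).indicator (fun _ => (1 : ℝ)) x) q μ :=
  memLp_finsetSum _ fun k _ => ((memLp_const (1 : ℝ)).indicator
    (measurableSet_gridCell hh)).const_mul (c k)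

theorem sum_indicator_gridCell_eq {S : Finset (Fin N → ℤ)} (c : S → ℝ) (k : S)
    {x : EuclideanSpace ℝ (Fin N)} (hx : x ∈ gridCell h k.1) :
    ∑ l, c l * (gridCell h l.1).indicator (fun _ => (1 : ℝ)) x = c k := by
  rw [Finset.sum_eq_single k]
  · simp [hx]
  · intro l _ hl
    have : x ∉ gridCell h l.1 := fun hxl =>
      Set.disjoint_left.1 (pairwise_disjoint_gridCell h (fun e => hl (Subtype.ext e))) hxl hx
    simp [this]
  · simp

/-- The bound degenerates as `h → 0`, which is harmless: it is used at a fixed mesh, to confine the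
finitely many cell averages to a bounded set of coefficients. -/
theorem enorm_average_gridCell_rpow_le (hh : 0 < h) (k : Fin N → ℤ)
    {φ : EuclideanSpace ℝ (Fin N) → ℝ} (hφ : Continuous φ) {p : ℝ} (hp : 1 ≤ p) :
    ‖⨍ y in gridCell h k, φ y‖ₑ ^ p ≤ (ENNReal.ofReal (h ^ N))⁻¹ * ∫⁻ x, ‖φ x‖ₑ ^ p := by
  set V := ENNReal.ofReal (h ^ N) with hV
  have hV0 : V ≠ 0 := by rw [hV]; simpa using pow_pos hh N
  have hVt : V ≠ ⊤ := ENNReal.ofReal_ne_top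
  let ρ : Measure (EuclideanSpace ℝ (Fin N)) := V⁻¹ • volume.restrict (gridCell h k)
  have hρ1 : ρ Set.univ = 1 := by
    simp [ρ, volume_gridCell hh, ← hV, ENNReal.inv_mul_cancel hV0 hVt]
  have : IsProbabilityMeasure ρ := ⟨hρ1⟩
  have havg : ⨍ y in gridCell h k, φ y = ∫ y, φ y ∂ρ := by
    rw [average, Measure.restrict_apply_univ, volume_gridCell hh]
  calc ‖⨍ y in gridCell h k, φ y‖ₑ ^ p ≤ (∫⁻ y, ‖φ y‖ₑ ∂ρ) ^ p := by
        rw [havg]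
        exact ENNReal.rpow_le_rpow (enorm_integral_le_lintegral_enorm _) (by linarith)
    _ ≤ ∫⁻ y, ‖φ y‖ₑ ^ p ∂ρ := lintegral_rpow_le_of_isProbabilityMeasure hp
        hφ.enorm.measurable.aemeasurable
    _ = V⁻¹ * ∫⁻ y in gridCell h k, ‖φ y‖ₑ ^ p := by
        rw [lintegral_smul_measure, smul_eq_mul]
    _ ≤ _ := mul_le_mul_right (setLIntegral_le_lintegral _ _) _

/-- **Rellich–Kondrachov** for sequences of `C^1` functions: bounds on `∫ |φ| ^ p` and
`∫ ‖∇φ‖ ^ p` over the whole space give `L^p`-precompactness on bounded sets. -/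
theorem exists_subseq_tendsto_eLpNorm {U : Set (EuclideanSpace ℝ (Fin N))}
    (hU : Bornology.IsBounded U) {p : ℝ} (hp : 1 ≤ p) {φ : ℕ → EuclideanSpace ℝ (Fin N) → ℝ}
    (hφ : ∀ j, ContDiff ℝ 1 (φ j)) {B : ENNReal} (hB : B ≠ ⊤)
    (hφB : ∀ j, ∫⁻ x, ‖φ j x‖ₑ ^ p ≤ B) (hgB : ∀ j, ∫⁻ x, ‖fderiv ℝ (φ j) x‖ₑ ^ p ≤ B) :
    ∃ (u : EuclideanSpace ℝ (Fin N) → ℝ) (σ : ℕ → ℕ), StrictMono σ ∧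
      MemLp u (ENNReal.ofReal p) (volume.restrict U) ∧
      Tendsto (fun j => eLpNorm (φ (σ j) - u) (ENNReal.ofReal p) (volume.restrict U))
        atTop (𝓝 0) := by
  have hp0 : 0 < p := by linarith
  have hP : (1 : ENNReal) ≤ ENNReal.ofReal p := by simpa using hp
  have : Fact ((1 : ENNReal) ≤ ENNReal.ofReal p) := ⟨hP⟩
  have hP0 : ENNReal.ofReal p ≠ 0 := by simpa using hp0
  have hPt : (ENNReal.ofReal p).toReal = p := ENNReal.toReal_ofReal hp0.le
  set μ := (volume : Measure (EuclideanSpace ℝ (Fin N))).restrict U with hμ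
  have : IsFiniteMeasure μ := ⟨by simpa [hμ] using hU.measure_lt_top⟩
  have hm : ∀ j, MemLp (φ j) (ENNReal.ofReal p) μ := fun j => by
    refine ⟨(hφ j).continuous.aestronglyMeasurable, ?_⟩
    rw [eLpNorm_lt_top_iff_lintegral_rpow_enorm_lt_top hP0 ENNReal.ofReal_ne_top, hPt]
    exact ((setLIntegral_le_lintegral _ _).trans (hφB j)).trans_lt hB.lt_top
  -- Up to `ε/2` each `φ j` equals the step function of its cell averages on a fixed finite grid.
  -- These step functions lie in the linear image of a closed ball of a finite-dimensional space,
  -- which is compact and so has a finite `ε/2`-net.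
  have htb : TotallyBounded (Set.range fun j => (hm j).toLp (φ j)) := by
    rw [EMetric.totallyBounded_iff]
    intro ε hε
    -- choose the mesh
    obtain ⟨h, hh, hhε⟩ : ∃ h : ℝ, 0 < h ∧
        volume (Metric.closedBall (0 : EuclideanSpace ℝ (Fin N)) √N) *
          (ENNReal.ofReal (h * √N) ^ p * B) < (ε / 2) ^ p := by
      have hlim : Tendsto (fun h : ℝ => volume (Metric.closedBall
          (0 : EuclideanSpace ℝ (Fin N)) √N) * (ENNReal.ofReal (h * √N) ^ p * B))
          (𝓝[>] 0) (𝓝 (volume (Metric.closedBall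
          (0 : EuclideanSpace ℝ (Fin N)) √N) * (ENNReal.ofReal (0 * √N) ^ p * B))) := by
        refine Tendsto.mono_left ?_ nhdsWithin_le_nhds
        refine ENNReal.Tendsto.const_mul (ENNReal.Tendsto.mul_const ?_ (Or.inr hB))
          (Or.inr measure_closedBall_lt_top.ne)
        exact ((ENNReal.continuous_ofReal.comp (continuous_id.mul continuous_const)).tendsto
          0).ennrpow_const p
      have hpos : (0 : ENNReal) < (ε / 2) ^ p :=
        ENNReal.rpow_pos_of_nonneg (ENNReal.half_pos hε.ne') hp0.le
      rw [zero_mul, ENNReal.ofReal_zero, ENNReal.zero_rpow_of_pos hp0, zero_mul, mul_zero] at hlim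
      obtain ⟨h, h1, h2⟩ := ((hlim.eventually_lt_const hpos).and self_mem_nhdsWithin).exists
      exact ⟨h, h2, h1⟩
    obtain ⟨S, hS⟩ := exists_finset_subset_iUnion_gridCell hh hU
    let T : (S → ℝ) →ₗ[ℝ] Lp ℝ (ENNReal.ofReal p) μ :=
      { toFun := fun c => (memLp_sum_indicator_gridCell hh S c).toLp _
        map_add' := fun c d => by
          rw [← MemLp.toLp_add]
          congr 1
          ext x
          simp [add_mul, Finset.sum_add_distrib]
        map_smul' := fun a c => by
          rw [RingHom.id_apply, ← MemLp.toLp_const_smul]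
          congr 1
          ext x
          simp [mul_assoc, Finset.mul_sum] }
    set M : ENNReal := ((ENNReal.ofReal (h ^ N))⁻¹ * B) ^ p⁻¹ with hM
    have hMt : M ≠ ⊤ := by
      refine ENNReal.rpow_ne_top_of_nonneg (by positivity) (ENNReal.mul_ne_top ?_ hB)
      exact ENNReal.inv_ne_top.2 (by simpa using pow_pos hh N)
    have hK : IsCompact (T '' Metric.closedBall 0 M.toReal) :=
      (isCompact_closedBall _ _).image T.continuous_of_finiteDimensional
    obtain ⟨t, htf, ht⟩ := EMetric.totallyBounded_iff.1 hK.totallyBounded (ε / 2)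
      (ENNReal.half_pos hε.ne')
    refine ⟨t, htf, ?_⟩
    rintro _ ⟨j, rfl⟩
    let c : S → ℝ := fun k => ⨍ y in gridCell h k.1, φ j y
    have hc : c ∈ Metric.closedBall (0 : S → ℝ) M.toReal := by
      rw [mem_closedBall_zero_iff, pi_norm_le_iff_of_nonneg ENNReal.toReal_nonneg]
      intro k
      rw [← toReal_enorm]
      refine ENNReal.toReal_mono hMt ?_
      rw [hM, ENNReal.le_rpow_inv_iff hp0]
      exact (enorm_average_gridCell_rpow_le hh k.1 (hφ j).continuous hp).trans
        (mul_le_mul_right (hφB j) _)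
    have hclose : edist ((hm j).toLp (φ j)) (T c) < ε / 2 := by
      change edist ((hm j).toLp (φ j)) ((memLp_sum_indicator_gridCell hh S c).toLp _) < ε / 2
      rw [Lp.edist_toLp_toLp, eLpNorm_eq_lintegral_rpow_enorm_toReal hP0 ENNReal.ofReal_ne_top, hPt,
        one_div, ENNReal.rpow_inv_lt_iff hp0]
      refine lt_of_le_of_lt ?_ hhε
      calc _ ≤ ∫⁻ x in ⋃ k ∈ S, gridCell h k, ‖φ j x - ∑ k, c k *
              (gridCell h k.1).indicator (fun _ => (1 : ℝ)) x‖ₑ ^ p := lintegral_mono_set hS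
        _ = ∑ k ∈ S, ∫⁻ x in gridCell h k, ‖φ j x - ∑ k, c k *
              (gridCell h k.1).indicator (fun _ => (1 : ℝ)) x‖ₑ ^ p :=
            lintegral_biUnion_finset ((pairwise_disjoint_gridCell h).set_pairwise _)
              (fun k _ => measurableSet_gridCell hh) _
        _ = ∑ k ∈ S, ∫⁻ x in gridCell h k, ‖φ j x - ⨍ y in gridCell h k, φ j y‖ₑ ^ p := by
            refine Finset.sum_congr rfl fun k hk => ?_
            refine setLIntegral_congr_fun (measurableSet_gridCell hh) fun x hx => ?_
            rw [sum_indicator_gridCell_eq c ⟨k, hk⟩ hx]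
        _ ≤ _ := sum_lintegral_gridCell_sub_average_rpow_le hh S (hφ j) hp
        _ ≤ _ := by gcongr; exact hgB j
    obtain ⟨y, hy, hTy⟩ := Set.mem_iUnion₂.1 (ht ⟨c, hc, rfl⟩)
    refine Set.mem_iUnion₂.2 ⟨y, hy, ?_⟩
    calc edist ((hm j).toLp (φ j)) y ≤ edist ((hm j).toLp (φ j)) (T c) + edist (T c) y :=
          edist_triangle _ _ _
      _ < ε / 2 + ε / 2 := ENNReal.add_lt_add hclose hTy
      _ = ε := ENNReal.add_halves ε
  have hcpt : IsCompact (closure (Set.range fun j => (hm j).toLp (φ j))) :=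
    htb.closure.isCompact_of_isClosed isClosed_closure
  obtain ⟨u, -, σ, hσ, hu⟩ := hcpt.tendsto_subseq fun j => subset_closure (Set.mem_range_self j)
  refine ⟨u, σ, hσ, Lp.memLp u, ?_⟩
  exact (Lp.tendsto_Lp_iff_tendsto_eLpNorm'' (fun j => φ (σ j)) (fun j => hm (σ j)) u
    (Lp.memLp u)).1 (by simpa [Function.comp_def] using hu)

end Rellich

/-! ### Test functions, weak gradients and the space `W_0^{1,p}` -/

section Gradient

variable {N : ℕ} {φ ψ : EuclideanSpace ℝ (Fin N) → ℝ}

theorem norm_gradient (φ : EuclideanSpace ℝ (Fin N) → ℝ) (x : EuclideanSpace ℝ (Fin N)) :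
    ‖gradient φ x‖ = ‖fderiv ℝ φ x‖ :=
  LinearIsometryEquiv.norm_map _ _

theorem gradient_apply (φ : EuclideanSpace ℝ (Fin N) → ℝ) (x : EuclideanSpace ℝ (Fin N))
    (i : Fin N) : gradient φ x i = fderiv ℝ φ x (EuclideanSpace.single i 1) := by
  rw [← inner_gradient_left, EuclideanSpace.inner_single_right]; simp

theorem continuous_gradient (hφ : ContDiff ℝ 1 φ) : Continuous (gradient φ) :=
  (LinearIsometryEquiv.continuous _).comp (hφ.continuous_fderiv one_ne_zero)

theorem HasCompactSupport.gradient (hφ : HasCompactSupport φ) : HasCompactSupport (gradient φ) :=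
  (hφ.fderiv ℝ).comp_left (map_zero _)

theorem gradient_add_smul (hφ : ContDiff ℝ 1 φ) (hψ : ContDiff ℝ 1 ψ) (a b : ℝ) :
    gradient (fun x => a * φ x + b * ψ x) = fun x => a • gradient φ x + b • gradient ψ x := by
  ext1 x
  have h1 := ((hφ.differentiable one_ne_zero) x).hasFDerivAt
  have h2 := ((hψ.differentiable one_ne_zero) x).hasFDerivAt
  have h3 : HasFDerivAt (fun x => a * φ x + b * ψ x) (a • fderiv ℝ φ x + b • fderiv ℝ ψ x) x :=
    (h1.const_mul a).add (h2.const_mul b)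
  rw [gradient, h3.fderiv]
  simp [gradient]

theorem IsTestFunction.contDiff_one {Ω : Set (EuclideanSpace ℝ (Fin N))}
    (h : IsTestFunction Ω φ) : ContDiff ℝ 1 φ := h.1.of_le (by exact_mod_cast le_top)

theorem IsTestFunction.eq_zero {Ω : Set (EuclideanSpace ℝ (Fin N))} (h : IsTestFunction Ω φ)
    {x : EuclideanSpace ℝ (Fin N)} (hx : x ∉ Ω) : φ x = 0 :=
  image_eq_zero_of_notMem_tsupport fun hx' => hx (h.2.2 hx')

theorem IsTestFunction.gradient_eq_zero {Ω : Set (EuclideanSpace ℝ (Fin N))}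
    (h : IsTestFunction Ω φ) {x : EuclideanSpace ℝ (Fin N)} (hx : x ∉ Ω) : gradient φ x = 0 := by
  have : fderiv ℝ φ x = 0 := by
    by_contra h0
    exact hx (h.2.2 (support_fderiv_subset ℝ h0))
  simp [gradient, this]

theorem IsTestFunction.add_smul {Ω : Set (EuclideanSpace ℝ (Fin N))} (hφ : IsTestFunction Ω φ)
    (hψ : IsTestFunction Ω ψ) (a b : ℝ) : IsTestFunction Ω (fun x => a * φ x + b * ψ x) := by
  have hs : tsupport (fun x => a * φ x + b * ψ x) ⊆ tsupport φ ∪ tsupport ψ := by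
    refine closure_minimal (fun x hx => ?_) ((isClosed_tsupport φ).union (isClosed_tsupport ψ))
    by_contra h
    rw [Set.mem_union, not_or] at h
    exact hx (by simp [image_eq_zero_of_notMem_tsupport h.1, image_eq_zero_of_notMem_tsupport h.2])
  refine ⟨(contDiff_const.mul hφ.1).add (contDiff_const.mul hψ.1), ?_,
    hs.trans (Set.union_subset hφ.2.2 hψ.2.2)⟩
  exact (hφ.2.1.union hψ.2.1).of_isClosed_subset (isClosed_tsupport _) hs

theorem IsTestFunction.memLp {Ω : Set (EuclideanSpace ℝ (Fin N))} (hφ : IsTestFunction Ω φ)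
    {q : ENNReal} {μ : Measure (EuclideanSpace ℝ (Fin N))} [IsFiniteMeasureOnCompacts μ] :
    MemLp φ q μ :=
  hφ.1.continuous.memLp_of_hasCompactSupport hφ.2.1

theorem IsTestFunction.memLp_gradient {Ω : Set (EuclideanSpace ℝ (Fin N))}
    (hφ : IsTestFunction Ω φ) {q : ENNReal} {μ : Measure (EuclideanSpace ℝ (Fin N))}
    [IsFiniteMeasureOnCompacts μ] : MemLp (gradient φ) q μ :=
  (continuous_gradient hφ.contDiff_one).memLp_of_hasCompactSupport hφ.2.1.gradient

/-- Since `ψ` and its gradient vanish off `Ω`, both integrals extend to the whole space, where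
integration by parts holds in each direction `v`. No support condition falls on `φ`, and no
regularity on the boundary of `Ω`. -/
theorem integral_smul_gradient_eq_neg {Ω : Set (EuclideanSpace ℝ (Fin N))}
    (hφ : ContDiff ℝ 1 φ) (hψ : IsTestFunction Ω ψ) :
    ∫ x in Ω, φ x • gradient ψ x = - ∫ x in Ω, ψ x • gradient φ x := by
  rw [setIntegral_eq_integral_of_forall_compl_eq_zero
      fun x hx => by rw [hψ.gradient_eq_zero hx, smul_zero],
    setIntegral_eq_integral_of_forall_compl_eq_zero
      fun x hx => by rw [hψ.eq_zero hx, zero_smul]]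
  have hgψ := continuous_gradient hψ.contDiff_one
  have hgφ := continuous_gradient hφ
  have i1 : Integrable fun x => φ x • gradient ψ x :=
    (hφ.continuous.smul hgψ).integrable_of_hasCompactSupport hψ.2.1.gradient.smul_left
  have i2 : Integrable fun x => ψ x • gradient φ x :=
    (hψ.1.continuous.smul hgφ).integrable_of_hasCompactSupport hψ.2.1.smul_right
  refine ext_inner_right ℝ fun v => ?_
  rw [inner_neg_left, real_inner_comm, real_inner_comm v, ← integral_inner i1, ← integral_inner i2]
  simp only [inner_smul_right, inner_gradient_right, conj_trivial]
  have := integral_smul_fderiv_eq_neg_fderiv_smul_of_integrable (μ := volume) (𝕜 := ℝ) (f := φ)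
    (g := ψ) (v := v) ?_ ?_ ?_ (fun x _ => hφ.differentiable one_ne_zero x)
    (fun x _ => hψ.contDiff_one.differentiable one_ne_zero x)
  · simpa only [smul_eq_mul, mul_comm] using this
  · exact ((hφ.continuous_fderiv_apply one_ne_zero).comp (continuous_id.prodMk continuous_const)
      |>.smul hψ.1.continuous).integrable_of_hasCompactSupport hψ.2.1.smul_left
  · refine (hφ.continuous.smul ((hψ.contDiff_one.continuous_fderiv one_ne_zero).clm_apply
      continuous_const)).integrable_of_hasCompactSupport ?_
    exact HasCompactSupport.smul_left (hψ.2.1.fderiv_apply ℝ v)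
  · exact (hφ.continuous.smul hψ.1.continuous).integrable_of_hasCompactSupport hψ.2.1.smul_left

theorem memSobolev_of_contDiff {Ω : Set (EuclideanSpace ℝ (Fin N))} {q : ENNReal}
    (hφ : ContDiff ℝ 1 φ) (h1 : MemLp φ q (volume.restrict Ω))
    (h2 : MemLp (gradient φ) q (volume.restrict Ω)) : MemSobolev Ω q φ (gradient φ) :=
  ⟨h1, h2, fun _ hψ => integral_smul_gradient_eq_neg hφ hψ⟩

end Gradient

/-- On a finite measure space `L^q` convergence implies `L^1` convergence. The Lipschitz-type
hypothesis `hM` lets the same statement serve both sides of the weak gradient identity, where `Φ` is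
a product with a bounded factor. -/
theorem tendsto_integral_of_tendsto_eLpNorm {α F W : Type*} [MeasurableSpace α] {μ : Measure α}
    [IsFiniteMeasure μ] [NormedAddCommGroup F] [NormedAddCommGroup W] [NormedSpace ℝ W]
    {q : ENNReal} (hq : 1 ≤ q) {f : ℕ → α → F} {g : α → F} (hf : ∀ k, MemLp (f k) q μ)
    (hg : MemLp g q μ) (h : Tendsto (fun k => eLpNorm (f k - g) q μ) atTop (𝓝 0))
    {Φ : ℕ → α → W} {Ψ : α → W} (hΦ : ∀ k, Integrable (Φ k) μ) (hΨ : Integrable Ψ μ) {M : ℝ}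
    (hM : ∀ k x, ‖Φ k x - Ψ x‖ ≤ M * ‖f k x - g x‖) :
    Tendsto (fun k => ∫ x, Φ k x ∂μ) atTop (𝓝 (∫ x, Ψ x ∂μ)) := by
  refine tendsto_integral_of_L1 Ψ hΨ.aestronglyMeasurable (Eventually.of_forall hΦ) ?_
  have hup : ∀ k, ∫⁻ x, ‖Φ k x - Ψ x‖ₑ ∂μ ≤ ENNReal.ofReal M * (eLpNorm (f k - g) q μ *
      μ Set.univ ^ (1 / (1 : ENNReal).toReal - 1 / q.toReal)) := by
    intro k
    calc ∫⁻ x, ‖Φ k x - Ψ x‖ₑ ∂μ ≤ ∫⁻ x, ENNReal.ofReal M * ‖(f k - g) x‖ₑ ∂μ := by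
          refine lintegral_mono fun x => ?_
          rw [← ofReal_norm, ← ofReal_norm, ← ENNReal.ofReal_mul' (norm_nonneg _)]
          exact ENNReal.ofReal_le_ofReal (hM k x)
      _ = ENNReal.ofReal M * eLpNorm (f k - g) 1 μ := by
          rw [lintegral_const_mul' _ _ ENNReal.ofReal_ne_top, eLpNorm_one_eq_lintegral_enorm]
      _ ≤ _ := mul_le_mul_right (eLpNorm_le_eLpNorm_mul_rpow_measure_univ hq
          ((hf k).sub hg).1) _
  refine tendsto_of_tendsto_of_tendsto_of_le_of_le tendsto_const_nhds ?_ (fun _ => zero_le) hup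
  have hfin : μ Set.univ ^ (1 / (1 : ENNReal).toReal - 1 / q.toReal) ≠ ⊤ := by
    refine ENNReal.rpow_ne_top_of_nonneg ?_ (measure_ne_top μ _)
    rcases eq_or_ne q ⊤ with rfl | hqt
    · simp
    have : 1 ≤ q.toReal := by
      rw [← ENNReal.toReal_one]; exact ENNReal.toReal_mono hqt hq
    have : 1 / q.toReal ≤ 1 := by rw [div_le_one (by linarith)]; exact this
    simpa using this
  simpa using ENNReal.Tendsto.const_mul (ENNReal.Tendsto.mul_const h (Or.inr hfin))
    (Or.inr ENNReal.ofReal_ne_top)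

section SobolevZero

variable {N : ℕ} {Ω : Set (EuclideanSpace ℝ (Fin N))} {q : ENNReal}
  {u v : EuclideanSpace ℝ (Fin N) → ℝ}
  {G H : EuclideanSpace ℝ (Fin N) → EuclideanSpace ℝ (Fin N)}

theorem MemSobolevZero.exists_seq (h : MemSobolevZero Ω q u G) :
    ∃ φ : ℕ → EuclideanSpace ℝ (Fin N) → ℝ, (∀ k, IsTestFunction Ω (φ k)) ∧
      Tendsto (fun k => eLpNorm (φ k - u) q (volume.restrict Ω)) atTop (𝓝 0) ∧
      Tendsto (fun k => eLpNorm (gradient (φ k) - G) q (volume.restrict Ω)) atTop (𝓝 0) := by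
  have hδ : ∀ k : ℕ, (0 : ENNReal) < ((k : ENNReal) + 1)⁻¹ := fun k => by simp
  choose φ hφ hlt using fun k : ℕ => h.2 _ (hδ k)
  have hlim : Tendsto (fun k : ℕ => ((k : ENNReal) + 1)⁻¹) atTop (𝓝 0) := by
    have := ENNReal.tendsto_inv_nat_nhds_zero.comp (tendsto_add_atTop_nat 1)
    simpa [Function.comp_def] using this
  refine ⟨φ, hφ, ?_, ?_⟩
  · refine tendsto_of_tendsto_of_tendsto_of_le_of_le tendsto_const_nhds hlim
      (fun _ => zero_le) fun k => ?_
    change eLpNorm (φ k - u) q (volume.restrict Ω) ≤ _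
    rw [eLpNorm_sub_comm]
    exact le_self_add.trans (hlt k).le
  · refine tendsto_of_tendsto_of_tendsto_of_le_of_le tendsto_const_nhds hlim
      (fun _ => zero_le) fun k => ?_
    change eLpNorm (gradient (φ k) - G) q (volume.restrict Ω) ≤ _
    rw [eLpNorm_sub_comm]
    exact le_add_self.trans (hlt k).le

/-- Membership in `W^{1,q}` need not be assumed: the weak gradient identity holds for each `φ k` and
survives the `L^q` limit against a bounded test function. -/
theorem memSobolevZero_of_tendsto (hΩ : Bornology.IsBounded Ω) (hq : 1 ≤ q)
    (hu : MemLp u q (volume.restrict Ω)) (hG : MemLp G q (volume.restrict Ω))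
    {φ : ℕ → EuclideanSpace ℝ (Fin N) → ℝ} (hφ : ∀ k, IsTestFunction Ω (φ k))
    (h1 : Tendsto (fun k => eLpNorm (φ k - u) q (volume.restrict Ω)) atTop (𝓝 0))
    (h2 : Tendsto (fun k => eLpNorm (gradient (φ k) - G) q (volume.restrict Ω)) atTop (𝓝 0)) :
    MemSobolevZero Ω q u G := by
  have : IsFiniteMeasure (volume.restrict Ω) := ⟨by simpa using hΩ.measure_lt_top⟩
  refine ⟨⟨hu, hG, fun ψ hψ => ?_⟩, fun δ hδ => ?_⟩
  · have cψ := hψ.1.continuous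
    have cgψ := continuous_gradient hψ.contDiff_one
    obtain ⟨A, hA⟩ := cψ.bounded_above_of_compact_support hψ.2.1
    obtain ⟨B, hB⟩ := cgψ.bounded_above_of_compact_support hψ.2.1.gradient
    have l1 : Tendsto (fun k => ∫ x in Ω, φ k x • gradient ψ x) atTop
        (𝓝 (∫ x in Ω, u x • gradient ψ x)) := by
      refine tendsto_integral_of_tendsto_eLpNorm hq (fun k => (hφ k).memLp) hu h1 (M := B)
        (fun k => ?_) ?_ fun k x => ?_
      · exact ((hφ k).memLp (q := 1)).integrable le_rfl |>.smul_bdd B cgψ.aestronglyMeasurable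
          (Eventually.of_forall hB)
      · exact (hu.integrable hq).smul_bdd B cgψ.aestronglyMeasurable (Eventually.of_forall hB)
      · rw [← sub_smul, norm_smul, mul_comm]
        gcongr; exact hB x
    have l2 : Tendsto (fun k => ∫ x in Ω, ψ x • gradient (φ k) x) atTop
        (𝓝 (∫ x in Ω, ψ x • G x)) := by
      refine tendsto_integral_of_tendsto_eLpNorm hq (fun k => (hφ k).memLp_gradient) hG h2 (M := A)
        (fun k => ?_) ?_ fun k x => ?_
      · exact ((hφ k).memLp_gradient (q := 1)).integrable le_rfl |>.bdd_smul A cψ.aestronglyMeasurable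
          (Eventually.of_forall hA)
      · exact (hG.integrable hq).bdd_smul A cψ.aestronglyMeasurable (Eventually.of_forall hA)
      · rw [← smul_sub, norm_smul]
        gcongr; exact hA x
    refine tendsto_nhds_unique l1 ?_
    simp only [integral_smul_gradient_eq_neg (hφ _).contDiff_one hψ]
    exact l2.neg
  · have hsum := h1.add h2
    rw [add_zero] at hsum
    obtain ⟨k, hk⟩ := (hsum.eventually_lt_const hδ).exists
    refine ⟨φ k, hφ k, ?_⟩
    rw [eLpNorm_sub_comm, eLpNorm_sub_comm (gradient (φ k))] at hk
    exact hk

/-- Supplies the variations `u + t v` for the Euler–Lagrange equation. -/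
theorem MemSobolevZero.add_smul (hΩ : Bornology.IsBounded Ω) (hq : 1 ≤ q)
    (hu : MemSobolevZero Ω q u G) (hv : MemSobolevZero Ω q v H) (t : ℝ) :
    MemSobolevZero Ω q (fun x => u x + t • v x) (fun x => G x + t • H x) := by
  obtain ⟨φ, hφ, h1, h2⟩ := hu.exists_seq
  obtain ⟨ψ, hψ, h3, h4⟩ := hv.exists_seq
  -- Used once for the functions and once for the gradients. The coefficient `1` matches the shape
  -- `a φ + b ψ` of the linear combinations of test functions.
  have comb : ∀ {F : Type} [NormedAddCommGroup F] [NormedSpace ℝ F]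
      {f : ℕ → EuclideanSpace ℝ (Fin N) → F} {g : ℕ → EuclideanSpace ℝ (Fin N) → F}
      {a b : EuclideanSpace ℝ (Fin N) → F}, (∀ k, MemLp (f k) q (volume.restrict Ω)) →
      (∀ k, MemLp (g k) q (volume.restrict Ω)) → MemLp a q (volume.restrict Ω) →
      MemLp b q (volume.restrict Ω) →
      Tendsto (fun k => eLpNorm (f k - a) q (volume.restrict Ω)) atTop (𝓝 0) →
      Tendsto (fun k => eLpNorm (g k - b) q (volume.restrict Ω)) atTop (𝓝 0) →
      Tendsto (fun k => eLpNorm ((fun x => (1 : ℝ) • f k x + t • g k x) - fun x => a x + t • b x) q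
        (volume.restrict Ω)) atTop (𝓝 0) := by
    intro F _ _ f g a b hf hg ha hb hfa hgb
    have hlim := hfa.add (ENNReal.Tendsto.const_mul (a := ‖t‖ₑ) hgb (Or.inr enorm_ne_top))
    rw [mul_zero, add_zero] at hlim
    refine tendsto_of_tendsto_of_tendsto_of_le_of_le tendsto_const_nhds hlim
      (fun _ => zero_le) fun k => ?_
    have e : ((fun x => (1 : ℝ) • f k x + t • g k x) - fun x => a x + t • b x) =
        (f k - a) + t • (g k - b) := by
      ext1 x; simp [smul_sub]; abel
    change eLpNorm _ _ _ ≤ _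
    rw [e]
    refine (eLpNorm_add_le ((hf k).sub ha).1 (((hg k).sub hb).const_smul t).1 hq).trans ?_
    rw [eLpNorm_const_smul]
  refine memSobolevZero_of_tendsto hΩ hq (hu.1.1.add (hv.1.1.const_smul t))
    (hu.1.2.1.add (hv.1.2.1.const_smul t)) (fun k => (hφ k).add_smul (hψ k) 1 t) ?_ ?_
  · exact comb (fun k => (hφ k).memLp) (fun k => (hψ k).memLp) hu.1.1 hv.1.1 h1 h3
  · simp only [gradient_add_smul (hφ _).contDiff_one (hψ _).contDiff_one]
    exact comb (fun k => (hφ k).memLp_gradient) (fun k => (hψ k).memLp_gradient)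
      hu.1.2.1 hv.1.2.1 h2 h4

end SobolevZero

/-! ### Minimizers of the Rayleigh quotient -/

section Minimizer

variable {N : ℕ} {Ω : Set (EuclideanSpace ℝ (Fin N))} {p : ℝ}
  {ν : Measure (EuclideanSpace ℝ (Fin N))} {ca cb : ENNReal}

/-- The weight enters the minimization only as a measure `ν` comparable with Lebesgue measure on
`Ω`; this transfers `L^p` limits to `ν`. -/
theorem tendsto_eLpNorm_of_measure_le_smul {α F ι : Type*} [MeasurableSpace α] {μ ν : Measure α}
    [NormedAddCommGroup F] {q c : ENNReal} (hq : q ≠ ⊤) (hc : c ≠ ⊤) (hν : ν ≤ c • μ)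
    {l : Filter ι} {f : ι → α → F} (h : Tendsto (fun k => eLpNorm (f k) q μ) l (𝓝 0)) :
    Tendsto (fun k => eLpNorm (f k) q ν) l (𝓝 0) := by
  have hlim : Tendsto (fun k => c ^ (1 / q).toReal * eLpNorm (f k) q μ) l (𝓝 0) := by
    rw [← mul_zero (c ^ (1 / q).toReal)]
    exact ENNReal.Tendsto.const_mul h
      (Or.inr (ENNReal.rpow_ne_top_of_nonneg ENNReal.toReal_nonneg hc))
  refine tendsto_of_tendsto_of_tendsto_of_le_of_le tendsto_const_nhds hlim (fun _ => zero_le)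
    fun k => (eLpNorm_mono_measure _ hν).trans ?_
  rw [eLpNorm_smul_measure_of_ne_top hq, smul_eq_mul]

theorem lintegral_enorm_rpow_eq_ofReal {α F : Type*} [MeasurableSpace α] {μ : Measure α}
    [NormedAddCommGroup F] (hp : 0 < p) {f : α → F} (hf : MemLp f (ENNReal.ofReal p) μ) :
    ∫⁻ x, ‖f x‖ₑ ^ p ∂μ = ENNReal.ofReal (∫ x, ‖f x‖ ^ p ∂μ) := by
  rw [ofReal_integral_eq_lintegral_ofReal (hf.integrable_norm_rpow_ofReal hp)
    (Eventually.of_forall fun x => by positivity)]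
  refine lintegral_congr fun x => ?_
  rw [← ENNReal.ofReal_rpow_of_nonneg (norm_nonneg _) hp.le, ofReal_norm]

theorem lintegral_eq_setLIntegral_of_eq_zero {α : Type*} [MeasurableSpace α] {μ : Measure α}
    {s : Set α} (hs : MeasurableSet s) {f : α → ENNReal} (hf : ∀ x, x ∉ s → f x = 0) :
    ∫⁻ x, f x ∂μ = ∫⁻ x in s, f x ∂μ := by
  rw [← lintegral_indicator hs, Set.indicator_eq_self.2]
  exact Function.support_subset_iff'.2 hf

/-- Both energies are continuous along an approximating sequence of test functions, so the
inequality passes to the closure. -/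
theorem MemSobolevZero.mul_integral_le_of_forall_isTestFunction (hp : 1 ≤ p) (hcb : cb ≠ ⊤)
    (hν : ν ≤ cb • volume.restrict Ω) {lam : ℝ}
    (h : ∀ φ : EuclideanSpace ℝ (Fin N) → ℝ, IsTestFunction Ω φ →
      lam * ∫ x, ‖φ x‖ ^ p ∂ν ≤ ∫ x in Ω, ‖gradient φ x‖ ^ p)
    {v : EuclideanSpace ℝ (Fin N) → ℝ} {H : EuclideanSpace ℝ (Fin N) → EuclideanSpace ℝ (Fin N)}
    (hv : MemSobolevZero Ω (ENNReal.ofReal p) v H) :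
    lam * ∫ x, ‖v x‖ ^ p ∂ν ≤ ∫ x in Ω, ‖H x‖ ^ p := by
  obtain ⟨φ, hφ, h1, h2⟩ := hv.exists_seq
  have l1 := tendsto_integral_norm_rpow hp
    (fun k => (hφ k).memLp.of_measure_le_smul hcb hν) (hv.1.1.of_measure_le_smul hcb hν)
    (tendsto_eLpNorm_of_measure_le_smul ENNReal.ofReal_ne_top hcb hν h1)
  have l2 := tendsto_integral_norm_rpow hp (fun k => (hφ k).memLp_gradient) hv.1.2.1 h2
  exact le_of_tendsto_of_tendsto' (l1.const_mul lam) l2 fun k => h _ (hφ k)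

theorem exists_isTestFunction_ne_zero (hΩ : IsOpen Ω) (hne : Ω.Nonempty) :
    ∃ φ : EuclideanSpace ℝ (Fin N) → ℝ, IsTestFunction Ω φ ∧ φ ≠ 0 := by
  obtain ⟨x, hx⟩ := hne
  obtain ⟨ε, hε, hball⟩ := Metric.nhds_basis_closedBall.mem_iff.1 (hΩ.mem_nhds hx)
  let f : ContDiffBump x := ⟨ε / 2, ε, by positivity, by linarith⟩
  refine ⟨f, ⟨f.contDiff, f.hasCompactSupport, ?_⟩, fun h0 => ?_⟩
  · rw [f.tsupport_eq]; exact hball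
  · have : f x = 1 := f.one_of_mem_closedBall (Metric.mem_closedBall_self f.rIn_pos.le)
    rw [h0] at this
    simp at this

/-- A vanishing integral would make `φ` zero `ν`-a.e., hence a.e. in `Ω` by comparability, hence
everywhere by continuity. -/
theorem IsTestFunction.integral_norm_rpow_pos (hΩ : MeasurableSet Ω) (hp : 0 < p)
    (hcb : cb ≠ ⊤) (hν : ν ≤ cb • volume.restrict Ω) (hν' : volume.restrict Ω ≤ ca • ν)
    {φ : EuclideanSpace ℝ (Fin N) → ℝ} (hφ : IsTestFunction Ω φ) (h0 : φ ≠ 0) :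
    0 < ∫ x, ‖φ x‖ ^ p ∂ν := by
  have hnn : ∀ x, 0 ≤ ‖φ x‖ ^ p := fun x => by positivity
  refine (integral_nonneg hnn).lt_of_ne' fun h => h0 ?_
  have hm : MemLp φ (ENNReal.ofReal p) ν := hφ.memLp.of_measure_le_smul hcb hν
  rw [integral_eq_zero_iff_of_nonneg hnn (hm.integrable_norm_rpow_ofReal hp)] at h
  have h1 : φ =ᵐ[ν] 0 := by
    filter_upwards [h] with x hx
    simpa [Real.rpow_eq_zero_iff_of_nonneg, hp.ne'] using hx
  have h2 : φ =ᵐ[volume.restrict Ω] 0 :=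
    ((Measure.absolutelyContinuous_of_le hν').trans
      (Measure.smul_absolutelyContinuous)).ae_eq h1
  have h3 : φ =ᵐ[volume] 0 := by
    filter_upwards [(ae_restrict_iff' hΩ).1 h2] with x hx
    by_cases hxΩ : x ∈ Ω
    · exact hx hxΩ
    · exact hφ.eq_zero hxΩ
  exact hφ.1.continuous.ae_eq_iff_eq (μ := volume) continuous_const |>.1 h3

/-- The minimum of the Rayleigh quotient over `W_0^{1,p}` is attained. -/
theorem exists_rayleigh_minimizer (hΩ : IsOpen Ω) (hne : Ω.Nonempty)
    (hbdd : Bornology.IsBounded Ω) (hp : 1 < p) (hca : ca ≠ ⊤) (hcb : cb ≠ ⊤)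
    (hν : ν ≤ cb • volume.restrict Ω) (hν' : volume.restrict Ω ≤ ca • ν) :
    ∃ (lam : ℝ) (u : EuclideanSpace ℝ (Fin N) → ℝ)
      (G : EuclideanSpace ℝ (Fin N) → EuclideanSpace ℝ (Fin N)),
      0 ≤ lam ∧ MemSobolevZero Ω (ENNReal.ofReal p) u G ∧ ∫ x, ‖u x‖ ^ p ∂ν = 1 ∧
      ∫ x in Ω, ‖G x‖ ^ p = lam ∧
      ∀ φ : EuclideanSpace ℝ (Fin N) → ℝ, IsTestFunction Ω φ →
        lam * ∫ x, ‖φ x‖ ^ p ∂ν ≤ ∫ x in Ω, ‖gradient φ x‖ ^ p := by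
  have hp0 : 0 < p := by linarith
  have hpos : ∀ φ : EuclideanSpace ℝ (Fin N) → ℝ, IsTestFunction Ω φ → φ ≠ 0 →
      0 < ∫ x, ‖φ x‖ ^ p ∂ν := fun φ hφ h0 =>
    hφ.integral_norm_rpow_pos hΩ.measurableSet hp0 hcb hν hν' h0
  -- The infimum is taken over test functions only; density extends the resulting inequality to
  -- `W_0^{1,p}` when it is needed.
  let R : Set ℝ := {c | ∃ φ : EuclideanSpace ℝ (Fin N) → ℝ, IsTestFunction Ω φ ∧ φ ≠ 0 ∧
    c = (∫ x in Ω, ‖gradient φ x‖ ^ p) / ∫ x, ‖φ x‖ ^ p ∂ν}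
  have hR0 : ∀ c ∈ R, 0 ≤ c := by
    rintro c ⟨φ, hφ, h0, rfl⟩
    exact div_nonneg (integral_nonneg fun x => by positivity) (hpos φ hφ h0).le
  have hRb : BddBelow R := ⟨0, hR0⟩
  have hRne : R.Nonempty := by
    obtain ⟨φ, hφ, h0⟩ := exists_isTestFunction_ne_zero hΩ hne
    exact ⟨_, φ, hφ, h0, rfl⟩
  set lam := sInf R with hlam
  have hlam0 : 0 ≤ lam := le_csInf hRne hR0
  have htest : ∀ φ : EuclideanSpace ℝ (Fin N) → ℝ, IsTestFunction Ω φ →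
      lam * ∫ x, ‖φ x‖ ^ p ∂ν ≤ ∫ x in Ω, ‖gradient φ x‖ ^ p := by
    intro φ hφ
    by_cases h0 : φ = 0
    · have : 0 ≤ ∫ x in Ω, ‖gradient φ x‖ ^ p := integral_nonneg fun x => by positivity
      simpa [h0, hp0.ne'] using this
    · rw [← le_div_iff₀ (hpos φ hφ h0)]
      exact csInf_le hRb ⟨φ, hφ, h0, rfl⟩
  -- a normalized minimizing sequence
  obtain ⟨c, -, hc, hcR⟩ := exists_seq_tendsto_sInf hRne hRb
  have hnorm : ∀ k, ∃ φ : EuclideanSpace ℝ (Fin N) → ℝ, IsTestFunction Ω φ ∧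
      ∫ x, ‖φ x‖ ^ p ∂ν = 1 ∧ ∫ x in Ω, ‖gradient φ x‖ ^ p = c k := by
    intro k
    obtain ⟨φ, hφ, h0, hck⟩ := hcR k
    have hM := hpos φ hφ h0
    set M := ∫ x, ‖φ x‖ ^ p ∂ν with hMdef
    have hs : ‖M ^ (-p⁻¹)‖ ^ p = M⁻¹ := by
      rw [Real.norm_of_nonneg (by positivity), ← Real.rpow_mul hM.le, neg_mul,
        inv_mul_cancel₀ hp0.ne', Real.rpow_neg_one]
    -- The null summand casts the rescaled function as a linear combination, so the closure and
    -- gradient rules for combinations apply.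
    refine ⟨fun x => M ^ (-p⁻¹) * φ x + 0 * φ x, hφ.add_smul hφ _ _, ?_, ?_⟩
    · simp only [zero_mul, add_zero, norm_mul, Real.mul_rpow (norm_nonneg _) (norm_nonneg _), hs]
      rw [integral_const_mul, ← hMdef, inv_mul_cancel₀ hM.ne']
    · simp only [gradient_add_smul hφ.contDiff_one hφ.contDiff_one, zero_smul, add_zero, norm_smul,
        Real.mul_rpow (norm_nonneg _) (norm_nonneg _), hs]
      rw [integral_const_mul, hck, div_eq_inv_mul]
  choose φ hφ hφM hφJ using hnorm
  have hφμ : ∀ k, MemLp (φ k) (ENNReal.ofReal p) (volume.restrict Ω) := fun k => (hφ k).memLp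
  have hφg : ∀ k, MemLp (gradient (φ k)) (ENNReal.ofReal p) (volume.restrict Ω) :=
    fun k => (hφ k).memLp_gradient
  -- uniform bounds
  obtain ⟨K, hK⟩ := hc.bddAbove_range
  have bd1 : ∀ k, ∫⁻ x, ‖φ k x‖ₑ ^ p ≤ ca := by
    intro k
    have e1 := lintegral_eq_setLIntegral_of_eq_zero (μ := volume) hΩ.measurableSet
      (f := fun x => ‖φ k x‖ₑ ^ p) fun x hx => by simp [(hφ k).eq_zero hx, hp0]
    have e2 := lintegral_enorm_rpow_eq_ofReal hp0 ((hφμ k).of_measure_le_smul hcb hν)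
    rw [hφM, ENNReal.ofReal_one] at e2
    rw [e1]
    calc ∫⁻ x in Ω, ‖φ k x‖ₑ ^ p ≤ ∫⁻ x, ‖φ k x‖ₑ ^ p ∂(ca • ν) := lintegral_mono' hν' le_rfl
      _ = ca := by rw [lintegral_smul_measure, e2, smul_eq_mul, mul_one]
  have bd2 : ∀ k, ∫⁻ x, ‖fderiv ℝ (φ k) x‖ₑ ^ p ≤ ENNReal.ofReal K := by
    intro k
    have e : ∀ x, ‖fderiv ℝ (φ k) x‖ₑ = ‖gradient (φ k) x‖ₑ := fun x => by
      rw [← ofReal_norm, ← norm_gradient, ofReal_norm]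
    simp only [e]
    rw [lintegral_eq_setLIntegral_of_eq_zero hΩ.measurableSet
      fun x hx => by simp [(hφ k).gradient_eq_zero hx, hp0],
      lintegral_enorm_rpow_eq_ofReal hp0 (hφg k), hφJ]
    exact ENNReal.ofReal_le_ofReal (hK (Set.mem_range_self k))
  obtain ⟨u, σ, hσ, hu, hlim⟩ := exists_subseq_tendsto_eLpNorm hbdd hp.le
    (fun k => (hφ k).contDiff_one) (B := max ca (ENNReal.ofReal K))
    (max_lt hca.lt_top ENNReal.ofReal_lt_top).ne
    (fun k => (bd1 k).trans (le_max_left _ _)) (fun k => (bd2 k).trans (le_max_right _ _))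
  have hlimν := tendsto_eLpNorm_of_measure_le_smul ENNReal.ofReal_ne_top hcb hν hlim
  have huν : MemLp u (ENNReal.ofReal p) ν := hu.of_measure_le_smul hcb hν
  have hφν : ∀ k, MemLp (φ k) (ENNReal.ofReal p) ν := fun k => (hφμ k).of_measure_le_smul hcb hν
  have hu1 : ∫ x, ‖u x‖ ^ p ∂ν = 1 := by
    refine tendsto_nhds_unique (tendsto_integral_norm_rpow hp.le (fun k => hφν (σ k)) huν hlimν) ?_
    simp only [hφM]
    exact tendsto_const_nhds
  -- midpoints
  have hmid : Tendsto (fun z : ℕ × ℕ => ∫ x, ‖(1 / 2 : ℝ) * φ (σ z.1) x + (1 / 2 : ℝ) * φ (σ z.2) x‖ ^ p ∂ν)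
      atTop (𝓝 1) := by
    have t0 : ∀ f : ℕ × ℕ → ℝ, Tendsto f atTop (𝓝 (∫ x, ‖u x‖ ^ p ∂ν)) → Tendsto f atTop (𝓝 1) :=
      fun f hf => hu1 ▸ hf
    apply t0
    have t1 : Tendsto (fun z : ℕ × ℕ => eLpNorm (φ (σ z.1) - u) (ENNReal.ofReal p) ν) atTop (𝓝 0) := by
      rw [← prod_atTop_atTop_eq]; exact hlimν.comp tendsto_fst
    have t2 : Tendsto (fun z : ℕ × ℕ => eLpNorm (φ (σ z.2) - u) (ENNReal.ofReal p) ν) atTop (𝓝 0) := by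
      rw [← prod_atTop_atTop_eq]; exact hlimν.comp tendsto_snd
    have t3 := (ENNReal.Tendsto.const_mul (a := ‖(1 / 2 : ℝ)‖ₑ) t1 (Or.inr enorm_ne_top)).add
      (ENNReal.Tendsto.const_mul (a := ‖(1 / 2 : ℝ)‖ₑ) t2 (Or.inr enorm_ne_top))
    rw [mul_zero, add_zero] at t3
    refine tendsto_integral_norm_rpow hp.le (fun z => ?_) huν
      (tendsto_of_tendsto_of_tendsto_of_le_of_le tendsto_const_nhds t3 (fun _ => zero_le)
      fun z => ?_)
    · exact ((hφν _).const_mul _).add ((hφν _).const_mul _)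
    · have e : ((fun x => (1 / 2 : ℝ) * φ (σ z.1) x + (1 / 2 : ℝ) * φ (σ z.2) x) - u) =
          (1 / 2 : ℝ) • (φ (σ z.1) - u) + (1 / 2 : ℝ) • (φ (σ z.2) - u) := by
        ext1 x; simp; ring
      change eLpNorm _ _ _ ≤ _
      rw [e]
      refine (eLpNorm_add_le (((hφν _).sub huν).const_smul (1 / 2 : ℝ)).1
        (((hφν _).sub huν).const_smul (1 / 2 : ℝ)).1 (by simpa using hp.le)).trans ?_
      rw [eLpNorm_const_smul, eLpNorm_const_smul]
  have hmid' := hmid.const_mul lam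
  rw [mul_one] at hmid'
  -- Midpoints are again test functions, so their gradient energy is at least `lam` times their
  -- `ν`-mass. That mass tends to `1` because the functions converge strongly, and strong
  -- convergence of the gradients follows.
  obtain ⟨G, hG, hGlim⟩ := exists_tendsto_eLpNorm_of_midpoint_energy hp (fun k => hφg (σ k))
    (L := lam) (by simp only [hφJ]; exact hc.comp hσ.tendsto_atTop) hmid' (fun k l => by
      have := htest _ ((hφ (σ k)).add_smul (hφ (σ l)) (1 / 2) (1 / 2))
      rw [gradient_add_smul (hφ _).contDiff_one (hφ _).contDiff_one] at this
      simpa only [smul_add] using this)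
  refine ⟨lam, u, G, hlam0, memSobolevZero_of_tendsto hbdd (by simpa using hp.le) hu hG
    (fun k => hφ (σ k)) hlim hGlim, hu1, ?_, htest⟩
  refine tendsto_nhds_unique (tendsto_integral_norm_rpow hp.le (fun k => hφg (σ k)) hG hGlim) ?_
  simp only [hφJ]
  exact hc.comp hσ.tendsto_atTop

/-- The Euler–Lagrange equation of a minimizer of the Rayleigh quotient. -/
theorem rayleigh_minimizer_euler_lagrange (hbdd : Bornology.IsBounded Ω) (hp : 1 < p)
    (hcb : cb ≠ ⊤) (hν : ν ≤ cb • volume.restrict Ω) {lam : ℝ}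
    (h : ∀ φ : EuclideanSpace ℝ (Fin N) → ℝ, IsTestFunction Ω φ →
      lam * ∫ x, ‖φ x‖ ^ p ∂ν ≤ ∫ x in Ω, ‖gradient φ x‖ ^ p)
    {u v : EuclideanSpace ℝ (Fin N) → ℝ} {G H : EuclideanSpace ℝ (Fin N) → EuclideanSpace ℝ (Fin N)}
    (hu : MemSobolevZero Ω (ENNReal.ofReal p) u G)
    (heq : ∫ x in Ω, ‖G x‖ ^ p = lam * ∫ x, ‖u x‖ ^ p ∂ν)
    (hv : MemSobolevZero Ω (ENNReal.ofReal p) v H) :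
    ∫ x in Ω, ‖G x‖ ^ (p - 2) * inner ℝ (G x) (H x) =
      lam * ∫ x, ‖u x‖ ^ (p - 2) * inner ℝ (u x) (v x) ∂ν := by
  have hp0 : 0 < p := by linarith
  have d1 := hasDerivAt_integral_norm_add_smul_rpow hp hu.1.2.1 hv.1.2.1
  have d2 := hasDerivAt_integral_norm_add_smul_rpow hp (hu.1.1.of_measure_le_smul hcb hν)
    (hv.1.1.of_measure_le_smul hcb hν)
  have d3 := d1.sub (d2.const_mul lam)
  -- The difference of energies along `u + t v` is nonnegative and vanishes at `t = 0` by `heq`, so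
  -- its derivative there is zero.
  have hmin : IsLocalMin ((fun t : ℝ => ∫ x in Ω, ‖G x + t • H x‖ ^ p) -
      fun t : ℝ => lam * ∫ x, ‖u x + t • v x‖ ^ p ∂ν) 0 := by
    refine Eventually.of_forall fun t => ?_
    have h1 := (hu.add_smul hbdd (by simpa using hp.le) hv
      t).mul_integral_le_of_forall_isTestFunction hp.le hcb hν h
    simp only [Pi.sub_apply, zero_smul, add_zero]
    rw [heq]
    linarith
  have h0 := hmin.hasDerivAt_eq_zero d3
  have : p * (∫ x in Ω, ‖G x‖ ^ (p - 2) * inner ℝ (G x) (H x)) =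
      p * (lam * ∫ x, ‖u x‖ ^ (p - 2) * inner ℝ (u x) (v x) ∂ν) := by linarith
  exact mul_left_cancel₀ hp0.ne' this

end Minimizer

/-! ### The first eigenvalue and its variational characterization -/

section Eigenvalue

variable {N : ℕ} {Ω : Set (EuclideanSpace ℝ (Fin N))} {p : ℝ}
  {r : EuclideanSpace ℝ (Fin N) → ℝ} {a b : ℝ}

theorem integral_withDensity_ofReal {α : Type*} [MeasurableSpace α] {μ : Measure α} {r : α → ℝ}
    (hr : AEStronglyMeasurable r μ) (h0 : ∀ᵐ x ∂μ, 0 ≤ r x) (f : α → ℝ) :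
    ∫ x, f x ∂(μ.withDensity fun x => ENNReal.ofReal (r x)) = ∫ x, r x * f x ∂μ := by
  rw [integral_withDensity_eq_integral_toReal_smul₀ hr.aemeasurable.ennreal_ofReal
    (Eventually.of_forall fun x => ENNReal.ofReal_lt_top)]
  refine integral_congr_ae ?_
  filter_upwards [h0] with x hx
  rw [ENNReal.toReal_ofReal hx, smul_eq_mul]

theorem withDensity_ofReal_le_smul {α : Type*} [MeasurableSpace α] {μ : Measure α} {r : α → ℝ}
    {b : ℝ} (h : ∀ᵐ x ∂μ, r x ≤ b) :
    μ.withDensity (fun x => ENNReal.ofReal (r x)) ≤ ENNReal.ofReal b • μ := by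
  rw [← withDensity_const]
  refine withDensity_mono ?_
  filter_upwards [h] with x hx using ENNReal.ofReal_le_ofReal hx

theorem le_smul_withDensity_ofReal {α : Type*} [MeasurableSpace α] {μ : Measure α} {r : α → ℝ}
    {a : ℝ} (ha : 0 < a) (h : ∀ᵐ x ∂μ, a ≤ r x) :
    μ ≤ ENNReal.ofReal a⁻¹ • μ.withDensity (fun x => ENNReal.ofReal (r x)) := by
  have h1 : ENNReal.ofReal a • μ ≤ μ.withDensity (fun x => ENNReal.ofReal (r x)) := by
    rw [← withDensity_const]
    refine withDensity_mono ?_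
    filter_upwards [h] with x hx using ENNReal.ofReal_le_ofReal hx
  calc μ = ENNReal.ofReal a⁻¹ • ENNReal.ofReal a • μ := by
        rw [smul_smul, ← ENNReal.ofReal_mul (by positivity), inv_mul_cancel₀ ha.ne',
          ENNReal.ofReal_one, one_smul]
    _ ≤ _ := by gcongr

/-- Existence and variational characterization of the first eigenvalue. -/
theorem exists_isLeast_dirichletEigenvalues (hΩ : IsOpen Ω) (hne : Ω.Nonempty)
    (hbdd : Bornology.IsBounded Ω) (hp : 1 < p)
    (hr : AEStronglyMeasurable r (volume.restrict Ω)) (ha : 0 < a)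
    (hab : ∀ᵐ x ∂(volume.restrict Ω), a ≤ r x ∧ r x ≤ b) :
    ∃ lam : ℝ, 0 ≤ lam ∧ IsLeast (dirichletEigenvalues Ω p r) lam ∧
      (∀ φ : EuclideanSpace ℝ (Fin N) → ℝ, IsTestFunction Ω φ →
        lam * ∫ x in Ω, r x * ‖φ x‖ ^ p ≤ ∫ x in Ω, ‖gradient φ x‖ ^ p) ∧
      ∀ c : ℝ, (∀ φ : EuclideanSpace ℝ (Fin N) → ℝ, IsTestFunction Ω φ →
        c * ∫ x in Ω, r x * ‖φ x‖ ^ p ≤ ∫ x in Ω, ‖gradient φ x‖ ^ p) → c ≤ lam := by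
  have hp0 : 0 < p := by linarith
  have h0 : ∀ᵐ x ∂(volume.restrict Ω), 0 ≤ r x := by
    filter_upwards [hab] with x hx using ha.le.trans hx.1
  set ν := (volume.restrict Ω).withDensity fun x => ENNReal.ofReal (r x) with hνdef
  have hI : ∀ f : EuclideanSpace ℝ (Fin N) → ℝ, ∫ x, f x ∂ν = ∫ x in Ω, r x * f x :=
    integral_withDensity_ofReal hr h0
  have hν : ν ≤ ENNReal.ofReal b • volume.restrict Ω := withDensity_ofReal_le_smul (by
    filter_upwards [hab] with x hx using hx.2)
  have hν' : volume.restrict Ω ≤ ENNReal.ofReal a⁻¹ • ν := le_smul_withDensity_ofReal ha (by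
    filter_upwards [hab] with x hx using hx.1)
  have hcb : ENNReal.ofReal b ≠ ⊤ := ENNReal.ofReal_ne_top
  obtain ⟨lam, u, G, hlam, hu, hu1, hG, htest⟩ := exists_rayleigh_minimizer hΩ hne hbdd hp
    ENNReal.ofReal_ne_top hcb hν hν'
  refine ⟨lam, hlam, ⟨⟨u, G, hu, fun hu0 => ?_, fun v H hv => ?_⟩, ?_⟩, ?_, fun c hc => ?_⟩
  · have : ∫ x, ‖u x‖ ^ p ∂ν = 0 := by
      rw [hI]
      refine integral_eq_zero_of_ae ?_
      filter_upwards [hu0] with x hx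
      simp [hx, hp0.ne']
    rw [this] at hu1
    exact zero_ne_one hu1
  · rw [rayleigh_minimizer_euler_lagrange hbdd hp hcb hν htest hu (by rw [hu1, mul_one, hG]) hv, hI]
    congr 1
    refine integral_congr_ae (Eventually.of_forall fun x => ?_)
    simp only [Real.norm_eq_abs, RCLike.inner_apply, conj_trivial]
    ring
  -- Minimality: testing the equation of an eigenfunction `w` with `w` itself gives `∫ ‖W‖^p = l ∫
  -- r|w|^p`, and the Rayleigh inequality for `w` forces `lam ≤ l`.
  · rintro l ⟨w, W, hw, hw0, hweak⟩
    have h1 := hweak w W hw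
    have sq : ∀ {F : Type} [NormedAddCommGroup F] [InnerProductSpace ℝ F] (z : F),
        ‖z‖ ^ (p - 2) * inner ℝ z z = ‖z‖ ^ p := by
      intro F _ _ z
      rcases eq_or_ne z 0 with rfl | hz
      · simp [hp0.ne']
      · rw [real_inner_self_eq_norm_sq, ← Real.rpow_natCast, ← Real.rpow_add (norm_pos_iff.2 hz)]
        norm_num
    have h2 : ∀ x, r x * (|w x| ^ (p - 2) * w x) * w x = r x * ‖w x‖ ^ p := by
      intro x
      rw [← sq (w x), real_inner_self_eq_norm_sq, Real.norm_eq_abs, sq_abs]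
      ring
    simp only [sq, h2] at h1
    rw [← hI fun x => ‖w x‖ ^ p] at h1
    have h3 := hw.mul_integral_le_of_forall_isTestFunction hp.le hcb hν htest
    have hwν : MemLp w (ENNReal.ofReal p) ν := hw.1.1.of_measure_le_smul hcb hν
    have hnn : ∀ x, 0 ≤ ‖w x‖ ^ p := fun x => by positivity
    have hpos : 0 < ∫ x, ‖w x‖ ^ p ∂ν := by
      refine (integral_nonneg hnn).lt_of_ne' fun h => hw0 ?_
      rw [integral_eq_zero_iff_of_nonneg hnn (hwν.integrable_norm_rpow_ofReal hp0)] at h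
      have h4 : w =ᵐ[ν] 0 := by
        filter_upwards [h] with x hx
        simpa [Real.rpow_eq_zero_iff_of_nonneg, hp0.ne'] using hx
      exact ((Measure.absolutelyContinuous_of_le hν').trans
        Measure.smul_absolutelyContinuous).ae_eq h4
    rw [h1] at h3
    exact le_of_mul_le_mul_right h3 hpos
  · intro φ hφ
    rw [← hI]
    exact htest φ hφ
  -- Any admissible `c` satisfies the inequality at the normalized minimizer `u` as well, where it
  -- reads `c ≤ lam`.
  · have h1 := hu.mul_integral_le_of_forall_isTestFunction hp.le hcb hν (lam := c)
      fun φ hφ => by rw [hI]; exact hc φ hφ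
    rwa [hu1, mul_one, hG] at h1

end Eigenvalue

/-! ### The `L^1` Poincaré inequality for `C^1` functions on cubes -/

/-- The `L^1` Poincaré inequality on an interval of length at most one, in symmetric form. -/
theorem lintegral_lintegral_enorm_sub_le_half {g : ℝ → ℝ} (hg : ContDiff ℝ 1 g) {a b : ℝ}
    (hab : b - a ≤ 1) :
    ∫⁻ s in Set.Ioo a b, ∫⁻ t in Set.Ioo a b, ‖g s - g t‖ₑ ≤
      ∫⁻ s in Set.Ioo a b, ENNReal.ofReal (1 / 2) * ‖deriv g s‖ₑ := by
  set μ : Measure ℝ := volume.restrict (Set.Ioo a b) with hμ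
  have hc : Continuous (deriv g) := hg.continuous_deriv le_rfl
  -- `I` and `J` indicate `s < τ` and `τ ≤ s`, so `I s τ * J t τ + I t τ * J s τ` indicates that `τ`
  -- separates `s` from `t`. After Tonelli only the measure of the pairs separated by `τ` matters.
  let I : ℝ → ℝ → ENNReal := fun s τ => (Set.Iio τ).indicator 1 s
  let J : ℝ → ℝ → ENNReal := fun s τ => (Set.Ici τ).indicator 1 s
  have hI : Measurable fun z : ℝ × ℝ => I z.1 z.2 :=
    (measurable_const (a := (1 : ENNReal))).indicator (measurableSet_lt measurable_fst measurable_snd)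
  have hJ : Measurable fun z : ℝ × ℝ => J z.1 z.2 :=
    (measurable_const (a := (1 : ENNReal))).indicator (measurableSet_le measurable_snd measurable_fst)
  have key : ∀ s ∈ Set.Ioo a b, ∀ t ∈ Set.Ioo a b,
      ‖g s - g t‖ₑ ≤ ∫⁻ τ, (I s τ * J t τ + I t τ * J s τ) * ‖deriv g τ‖ₑ ∂μ := by
    intro s hs t ht
    have h := intervalIntegral.integral_deriv_eq_sub (f := g) (a := t) (b := s)
      (fun x _ => hg.differentiable one_ne_zero x) (hc.intervalIntegrable _ _)
    rw [← h]
    have hsub : Set.uIoc t s ⊆ Set.Ioo a b := by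
      intro τ hτ
      rw [Set.mem_uIoc] at hτ
      rcases hτ with hτ | hτ
      · exact ⟨ht.1.trans hτ.1, hτ.2.trans_lt hs.2⟩
      · exact ⟨hs.1.trans hτ.1, hτ.2.trans_lt ht.2⟩
    calc ‖∫ τ in t..s, deriv g τ‖ₑ = ‖∫ τ in Set.uIoc t s, deriv g τ‖ₑ := by
          rw [← ofReal_norm, intervalIntegral.norm_intervalIntegral_eq, ofReal_norm]
      _ ≤ ∫⁻ τ in Set.uIoc t s, ‖deriv g τ‖ₑ := enorm_integral_le_lintegral_enorm _
      _ = ∫⁻ τ, (Set.uIoc t s).indicator (fun τ => ‖deriv g τ‖ₑ) τ ∂μ := by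
          rw [lintegral_indicator measurableSet_uIoc, hμ, Measure.restrict_restrict_of_subset hsub]
      _ ≤ _ := by
          refine lintegral_mono fun τ => ?_
          by_cases hτ : τ ∈ Set.uIoc t s
          · rw [Set.indicator_of_mem hτ]
            refine le_mul_of_one_le_left zero_le ?_
            rw [Set.mem_uIoc] at hτ
            rcases hτ with hτ | hτ
            · have h1 : I t τ = 1 := Set.indicator_of_mem (Set.mem_Iio.2 hτ.1) _
              have h2 : J s τ = 1 := Set.indicator_of_mem (Set.mem_Ici.2 hτ.2) _
              rw [h1, h2, one_mul]; exact le_add_self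
            · have h1 : I s τ = 1 := Set.indicator_of_mem (Set.mem_Iio.2 hτ.1) _
              have h2 : J t τ = 1 := Set.indicator_of_mem (Set.mem_Ici.2 hτ.2) _
              rw [h1, h2, one_mul]; exact le_self_add
          · rw [Set.indicator_of_notMem hτ]; exact zero_le
  have mI : ∀ τ, Measurable fun s => I s τ := fun τ => hI.comp (measurable_id.prodMk measurable_const)
  have mJ : ∀ τ, Measurable fun s => J s τ := fun τ => hJ.comp (measurable_id.prodMk measurable_const)
  have mD : Measurable fun τ => ‖deriv g τ‖ₑ := hc.enorm.measurable
  -- the measure of the pairs separated by `τ`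
  have area : ∀ τ ∈ Set.Ioo a b,
      ∫⁻ s, ∫⁻ t, (I s τ * J t τ + I t τ * J s τ) * ‖deriv g τ‖ₑ ∂μ ∂μ ≤
        ENNReal.ofReal (1 / 2) * ‖deriv g τ‖ₑ := by
    intro τ hτ
    have i1 : ∫⁻ s, I s τ ∂μ = ENNReal.ofReal (τ - a) := by
      change ∫⁻ s, (Set.Iio τ).indicator 1 s ∂μ = _
      rw [lintegral_indicator_one measurableSet_Iio, hμ, Measure.restrict_apply measurableSet_Iio,
        show Set.Iio τ ∩ Set.Ioo a b = Set.Ioo a τ by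
          ext x; simp only [Set.mem_inter_iff, Set.mem_Iio, Set.mem_Ioo]
          constructor
          · rintro ⟨h1, h2, h3⟩; exact ⟨h2, h1⟩
          · rintro ⟨h1, h2⟩; exact ⟨h2, h1, h2.trans hτ.2⟩, Real.volume_Ioo]
    have j1 : ∫⁻ s, J s τ ∂μ = ENNReal.ofReal (b - τ) := by
      change ∫⁻ s, (Set.Ici τ).indicator 1 s ∂μ = _
      rw [lintegral_indicator_one measurableSet_Ici, hμ, Measure.restrict_apply measurableSet_Ici,
        show Set.Ici τ ∩ Set.Ioo a b = Set.Ico τ b by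
          ext x; simp only [Set.mem_inter_iff, Set.mem_Ici, Set.mem_Ioo, Set.mem_Ico]
          constructor
          · rintro ⟨h1, h2, h3⟩; exact ⟨h1, h3⟩
          · rintro ⟨h1, h2⟩; exact ⟨h1, hτ.1.trans_le h1, h2⟩, Real.volume_Ico]
    have inner : ∀ s, ∫⁻ t, (I s τ * J t τ + I t τ * J s τ) * ‖deriv g τ‖ₑ ∂μ =
        (I s τ * ENNReal.ofReal (b - τ) + ENNReal.ofReal (τ - a) * J s τ) * ‖deriv g τ‖ₑ := by
      intro s
      have m : Measurable fun t => I s τ * J t τ + I t τ * J s τ :=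
        ((mJ τ).const_mul _).add ((mI τ).mul_const _)
      rw [lintegral_mul_const _ m, lintegral_add_left ((mJ τ).const_mul _), lintegral_const_mul _ (mJ τ),
        lintegral_mul_const _ (mI τ), i1, j1]
    simp only [inner]
    have m : Measurable fun s => I s τ * ENNReal.ofReal (b - τ) + ENNReal.ofReal (τ - a) * J s τ :=
      ((mI τ).mul_const _).add ((mJ τ).const_mul _)
    rw [lintegral_mul_const _ m, lintegral_add_left ((mI τ).mul_const _), lintegral_mul_const _ (mI τ),
      lintegral_const_mul _ (mJ τ), i1, j1]
    gcongr
    have h1 : 0 ≤ τ - a := by linarith [hτ.1]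
    have h2 : 0 ≤ b - τ := by linarith [hτ.2]
    rw [← ENNReal.ofReal_mul h1, ← ENNReal.ofReal_add (by positivity) (by positivity)]
    refine ENNReal.ofReal_le_ofReal ?_
    -- By the arithmetic–geometric mean inequality `2 (τ - a)(b - τ) ≤ (b - a)² / 2 ≤ 1/2`.
    nlinarith [sq_nonneg (τ - a - (b - τ))]
  have m3 : Measurable fun z : (ℝ × ℝ) × ℝ =>
      (I z.1.1 z.2 * J z.1.2 z.2 + I z.1.2 z.2 * J z.1.1 z.2) * ‖deriv g z.2‖ₑ := by
    have a1 : Measurable fun z : (ℝ × ℝ) × ℝ => I z.1.1 z.2 :=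
      hI.comp ((measurable_fst.comp measurable_fst).prodMk measurable_snd)
    have a2 : Measurable fun z : (ℝ × ℝ) × ℝ => I z.1.2 z.2 :=
      hI.comp ((measurable_snd.comp measurable_fst).prodMk measurable_snd)
    have a3 : Measurable fun z : (ℝ × ℝ) × ℝ => J z.1.1 z.2 :=
      hJ.comp ((measurable_fst.comp measurable_fst).prodMk measurable_snd)
    have a4 : Measurable fun z : (ℝ × ℝ) × ℝ => J z.1.2 z.2 :=
      hJ.comp ((measurable_snd.comp measurable_fst).prodMk measurable_snd)
    exact ((a1.mul a4).add (a2.mul a3)).mul (mD.comp measurable_snd)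
  calc ∫⁻ s, ∫⁻ t, ‖g s - g t‖ₑ ∂μ ∂μ
      ≤ ∫⁻ s, ∫⁻ t, ∫⁻ τ, (I s τ * J t τ + I t τ * J s τ) * ‖deriv g τ‖ₑ ∂μ ∂μ ∂μ :=
        setLIntegral_mono' measurableSet_Ioo fun s hs =>
          setLIntegral_mono' measurableSet_Ioo fun t ht => key s hs t ht
    _ = ∫⁻ z, ∫⁻ τ, (I z.1 τ * J z.2 τ + I z.2 τ * J z.1 τ) * ‖deriv g τ‖ₑ ∂μ ∂(μ.prod μ) :=
        (lintegral_prod (μ := μ) (ν := μ) _ m3.lintegral_prod_right'.aemeasurable).symm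
    _ = ∫⁻ τ, ∫⁻ z, (I z.1 τ * J z.2 τ + I z.2 τ * J z.1 τ) * ‖deriv g τ‖ₑ ∂(μ.prod μ) ∂μ :=
        lintegral_lintegral_swap m3.aemeasurable
    _ = ∫⁻ τ, ∫⁻ s, ∫⁻ t, (I s τ * J t τ + I t τ * J s τ) * ‖deriv g τ‖ₑ ∂μ ∂μ ∂μ := by
        refine lintegral_congr fun τ => lintegral_prod _ ?_
        exact (m3.comp (measurable_id.prodMk measurable_const)).aemeasurable
    _ ≤ _ := setLIntegral_mono' measurableSet_Ioo area

theorem piFinSuccAbove_zero_symm_apply {n : ℕ} (q : ℝ × (Fin n → ℝ)) :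
    (MeasurableEquiv.piFinSuccAbove (fun _ : Fin (n + 1) => ℝ) 0).symm q = Fin.cons q.1 q.2 := by
  change Fin.insertNth (α := fun _ => ℝ) 0 q.1 q.2 = _
  rw [Fin.insertNth_zero']

theorem lintegral_pi_fin_succ {n : ℕ} (μ : Measure ℝ) [SigmaFinite μ]
    {f : (Fin (n + 1) → ℝ) → ENNReal} (hf : Measurable f) :
    ∫⁻ x, f x ∂(Measure.pi fun _ => μ) =
      ∫⁻ s, ∫⁻ z, f (Fin.cons s z) ∂(Measure.pi fun _ : Fin n => μ) ∂μ := by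
  have h := (measurePreserving_piFinSuccAbove (fun _ : Fin (n + 1) => μ) 0).symm
  rw [← h.lintegral_comp hf]
  refine (lintegral_prod _ (hf.comp h.measurable).aemeasurable).trans ?_
  simp only [Function.comp_apply, piFinSuccAbove_zero_symm_apply]

/-- Tensorization of a symmetric `L^1` Poincaré inequality. -/
theorem lintegral_pi_enorm_sub_le_sum {μ : Measure ℝ} [SigmaFinite μ] (hμ : μ Set.univ ≤ 1) :
    ∀ {n : ℕ} {F : (Fin n → ℝ) → ℝ} {D : Fin n → (Fin n → ℝ) → ENNReal}, Measurable F →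
      (∀ i, Measurable (D i)) →
      (∀ i x, ∫⁻ s, ∫⁻ t, ‖F (Function.update x i s) - F (Function.update x i t)‖ₑ ∂μ ∂μ ≤
        ∫⁻ s, D i (Function.update x i s) ∂μ) →
      ∫⁻ x, ∫⁻ y, ‖F x - F y‖ₑ ∂(Measure.pi fun _ => μ) ∂(Measure.pi fun _ => μ) ≤
        ∑ i, ∫⁻ x, D i x ∂(Measure.pi fun _ => μ) := by
  intro n
  induction n with
  | zero =>
    intro F D _ _ _
    have h0 : ∀ x y, F x - F y = 0 := fun x y => by rw [Subsingleton.elim x y, sub_self]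
    simp [h0]
  | succ n ih =>
    intro F D hF hD h
    let π : Measure (Fin n → ℝ) := Measure.pi fun _ => μ
    have hπ : π Set.univ ≤ 1 := by
      simp only [π, Measure.pi_univ]
      exact Finset.prod_le_one' fun _ _ => hμ
    have hcons : Measurable fun q : ℝ × (Fin n → ℝ) => (Fin.cons q.1 q.2 : Fin (n + 1) → ℝ) := by
      have := (MeasurableEquiv.piFinSuccAbove (fun _ : Fin (n + 1) => ℝ) 0).symm.measurable
      rwa [funext piFinSuccAbove_zero_symm_apply] at this
    have hcs : ∀ s : ℝ, Measurable fun z : Fin n → ℝ => (Fin.cons s z : Fin (n + 1) → ℝ) := fun s =>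
      hcons.comp (measurable_const.prodMk measurable_id)
    have m2 : Measurable fun q : (Fin (n + 1) → ℝ) × (Fin (n + 1) → ℝ) => ‖F q.1 - F q.2‖ₑ :=
      ((hF.comp measurable_fst).sub (hF.comp measurable_snd)).enorm
    -- first coordinate
    have t1 : ∫⁻ s, ∫⁻ z, ∫⁻ t, ‖F (Fin.cons s z) - F (Fin.cons t z)‖ₑ ∂μ ∂π ∂μ ≤
        ∫⁻ x, D 0 x ∂(Measure.pi fun _ => μ) := by
      have ms : Measurable fun q : ℝ × (Fin n → ℝ) =>
          ∫⁻ t, ‖F (Fin.cons q.1 q.2) - F (Fin.cons t q.2)‖ₑ ∂μ := by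
        refine Measurable.lintegral_prod_right' (f := fun w : (ℝ × (Fin n → ℝ)) × ℝ =>
          ‖F (Fin.cons w.1.1 w.1.2) - F (Fin.cons w.2 w.1.2)‖ₑ) ?_
        exact m2.comp ((hcons.comp measurable_fst).prodMk
          (hcons.comp (measurable_snd.prodMk (measurable_snd.comp measurable_fst))))
      rw [lintegral_pi_fin_succ μ (hD 0), lintegral_lintegral_swap ms.aemeasurable,
        lintegral_lintegral_swap (f := fun s z => D 0 (Fin.cons s z))
          ((hD 0).comp hcons).aemeasurable]
      refine lintegral_mono fun z => ?_
      simpa only [Fin.update_cons_zero] using h 0 (Fin.cons 0 z)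
    -- remaining coordinates
    have t2 : ∀ t : ℝ, ∫⁻ z, ∫⁻ w, ‖F (Fin.cons t z) - F (Fin.cons t w)‖ₑ ∂π ∂π ≤
        ∑ i : Fin n, ∫⁻ z, D i.succ (Fin.cons t z) ∂π := by
      intro t
      refine ih (F := fun z => F (Fin.cons t z)) (D := fun i z => D i.succ (Fin.cons t z))
        (hF.comp (hcs t)) (fun i => (hD _).comp (hcs t)) fun i x => ?_
      simpa only [Fin.cons_update] using h i.succ (Fin.cons t x)
    have mm : Measurable fun q : ((Fin n → ℝ) × ℝ) × (Fin n → ℝ) =>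
        ‖F (Fin.cons q.1.2 q.1.1) - F (Fin.cons q.1.2 q.2)‖ₑ :=
      m2.comp ((hcons.comp (measurable_fst.snd.prodMk measurable_fst.fst)).prodMk
        (hcons.comp (measurable_fst.snd.prodMk measurable_snd)))
    calc ∫⁻ x, ∫⁻ y, ‖F x - F y‖ₑ ∂(Measure.pi fun _ => μ) ∂(Measure.pi fun _ => μ)
        = ∫⁻ s, ∫⁻ z, ∫⁻ t, ∫⁻ w, ‖F (Fin.cons s z) - F (Fin.cons t w)‖ₑ ∂π ∂μ ∂π ∂μ := by
          rw [lintegral_pi_fin_succ μ m2.lintegral_prod_right']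
          refine lintegral_congr fun s => lintegral_congr fun z => ?_
          exact lintegral_pi_fin_succ μ (m2.comp (measurable_const.prodMk measurable_id))
      -- Passing from `(s, z)` to `(t, w)` through `(t, z)` changes the first coordinate, then the
      -- others. Each difference is free of one of the four variables, and integrating that one out
      -- costs nothing since `μ` has mass at most one.
      _ ≤ ∫⁻ s, ∫⁻ z, ∫⁻ t, (‖F (Fin.cons s z) - F (Fin.cons t z)‖ₑ +
            ∫⁻ w, ‖F (Fin.cons t z) - F (Fin.cons t w)‖ₑ ∂π) ∂μ ∂π ∂μ := by
          refine lintegral_mono fun s => lintegral_mono fun z => lintegral_mono fun t => ?_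
          calc ∫⁻ w, ‖F (Fin.cons s z) - F (Fin.cons t w)‖ₑ ∂π
              ≤ ∫⁻ w, (‖F (Fin.cons s z) - F (Fin.cons t z)‖ₑ +
                ‖F (Fin.cons t z) - F (Fin.cons t w)‖ₑ) ∂π := by
                refine lintegral_mono fun w => ?_
                rw [← sub_add_sub_cancel (F (Fin.cons s z)) (F (Fin.cons t z))]
                exact enorm_add_le _ _
            _ = ‖F (Fin.cons s z) - F (Fin.cons t z)‖ₑ * π Set.univ +
                ∫⁻ w, ‖F (Fin.cons t z) - F (Fin.cons t w)‖ₑ ∂π := by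
                rw [lintegral_add_left measurable_const, lintegral_const]
            _ ≤ _ := by
                gcongr
                exact mul_le_of_le_one_right zero_le hπ
      _ = ∫⁻ s, ∫⁻ z, ∫⁻ t, ‖F (Fin.cons s z) - F (Fin.cons t z)‖ₑ ∂μ ∂π ∂μ +
            ∫⁻ _s, ∫⁻ z, ∫⁻ t, ∫⁻ w, ‖F (Fin.cons t z) - F (Fin.cons t w)‖ₑ ∂π ∂μ ∂π ∂μ := by
          have mt : ∀ s z, Measurable fun t => ‖F (Fin.cons s z) - F (Fin.cons t z)‖ₑ := fun s z =>
            m2.comp (measurable_const.prodMk (hcons.comp (measurable_id.prodMk measurable_const)))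
          have mzt : Measurable fun q : (Fin n → ℝ) × ℝ =>
              ∫⁻ w, ‖F (Fin.cons q.2 q.1) - F (Fin.cons q.2 w)‖ₑ ∂π := mm.lintegral_prod_right'
          have mz : Measurable fun z =>
              ∫⁻ t, ∫⁻ w, ‖F (Fin.cons t z) - F (Fin.cons t w)‖ₑ ∂π ∂μ := mzt.lintegral_prod_right'
          rw [← lintegral_add_right _ measurable_const]
          refine lintegral_congr fun s => ?_
          rw [← lintegral_add_right _ mz]
          refine lintegral_congr fun z => ?_
          rw [← lintegral_add_left (mt s z)]
      _ ≤ ∫⁻ x, D 0 x ∂(Measure.pi fun _ => μ) +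
            ∑ i : Fin n, ∫⁻ x, D i.succ x ∂(Measure.pi fun _ => μ) := by
          refine add_le_add t1 ?_
          rw [lintegral_const, lintegral_lintegral_swap mm.lintegral_prod_right'.aemeasurable]
          refine (mul_le_of_le_one_right zero_le hμ).trans ?_
          calc _ ≤ ∫⁻ t, ∑ i : Fin n, ∫⁻ z, D i.succ (Fin.cons t z) ∂π ∂μ := lintegral_mono t2
            _ = ∑ i : Fin n, ∫⁻ t, ∫⁻ z, D i.succ (Fin.cons t z) ∂π ∂μ :=
                lintegral_finsetSum _ fun i _ => ((hD i.succ).comp hcons).lintegral_prod_right'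
            _ = _ := by simp only [lintegral_pi_fin_succ μ (hD _)]; rfl
      _ = _ := (Fin.sum_univ_succ fun i => ∫⁻ x, D i x ∂(Measure.pi fun _ => μ)).symm

/-- The open cube `(a, b)^N`. -/
def openCube (N : ℕ) (a b : ℝ) : Set (EuclideanSpace ℝ (Fin N)) :=
  {x | ∀ i, x i ∈ Set.Ioo a b}

section Cube

variable {N : ℕ} {a b : ℝ}

theorem isOpen_openCube : IsOpen (openCube N a b) := by
  rw [openCube, Set.ofPred_forall]
  exact isOpen_iInter_of_finite fun i => isOpen_Ioo.preimage (by fun_prop)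

theorem preimage_toLp_openCube : (@WithLp.toLp 2 (Fin N → ℝ)) ⁻¹' openCube N a b =
    Set.univ.pi fun _ => Set.Ioo a b := by
  ext x; simp [openCube]

theorem setLIntegral_openCube {f : EuclideanSpace ℝ (Fin N) → ENNReal} (hf : Measurable f) :
    ∫⁻ x in openCube N a b, f x =
      ∫⁻ y, f (WithLp.toLp 2 y) ∂(Measure.pi fun _ => volume.restrict (Set.Ioo a b)) := by
  rw [← (PiLp.volume_preserving_toLp (Fin N)).setLIntegral_comp_preimage
    isOpen_openCube.measurableSet hf, preimage_toLp_openCube, volume_pi, Measure.restrict_pi_pi]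

theorem volume_openCube (N : ℕ) (a b : ℝ) :
    volume (openCube N a b) = ENNReal.ofReal (b - a) ^ N := by
  rw [← (PiLp.volume_preserving_toLp (Fin N)).measure_preimage
    isOpen_openCube.measurableSet.nullMeasurableSet, preimage_toLp_openCube, Real.volume_pi_Ioo]
  simp

/-- Cauchy–Schwarz; this is the source of `√N`, the factor `1/2` being the one-dimensional constant.
-/
theorem sum_enorm_gradient_le (F : EuclideanSpace ℝ (Fin N) → ℝ) (x : EuclideanSpace ℝ (Fin N)) :
    ∑ i, ‖gradient F x i‖ₑ ≤ ENNReal.ofReal √N * ‖gradient F x‖ₑ := by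
  simp only [← ofReal_norm]
  rw [← ENNReal.ofReal_sum_of_nonneg fun i _ => norm_nonneg _,
    ← ENNReal.ofReal_mul (Real.sqrt_nonneg _)]
  refine ENNReal.ofReal_le_ofReal ?_
  rw [EuclideanSpace.norm_eq, ← Real.sqrt_mul (Nat.cast_nonneg _)]
  refine Real.le_sqrt_of_sq_le ?_
  simpa using sq_sum_le_card_mul_sum_sq (s := Finset.univ) (f := fun i => ‖gradient F x i‖)

/-- The symmetric `L^1` Poincaré inequality for `C^1` functions on a cube of side at most one. -/
theorem lintegral_openCube_enorm_sub_le {F : EuclideanSpace ℝ (Fin N) → ℝ} (hF : ContDiff ℝ 1 F)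
    (hab : b - a ≤ 1) :
    ∫⁻ x in openCube N a b, ∫⁻ y in openCube N a b, ‖F x - F y‖ₑ ≤
      ENNReal.ofReal (√N / 2) * ∫⁻ x in openCube N a b, ‖gradient F x‖ₑ := by
  set μ : Measure ℝ := volume.restrict (Set.Ioo a b) with hμ
  have hμ1 : μ Set.univ ≤ 1 := by
    rw [hμ, Measure.restrict_apply_univ, Real.volume_Ioo]
    exact ENNReal.ofReal_le_one.2 hab
  have hL : Measurable (@WithLp.toLp 2 (Fin N → ℝ)) :=
    (PiLp.volume_preserving_toLp (Fin N)).measurable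
  have hcF := hF.continuous.measurable
  have hg := continuous_gradient hF
  have hgi : ∀ i, Continuous fun x => gradient F x i := fun i => by fun_prop
  have m2 : Measurable fun q : EuclideanSpace ℝ (Fin N) × EuclideanSpace ℝ (Fin N) =>
      ‖F q.1 - F q.2‖ₑ := ((hcF.comp measurable_fst).sub (hcF.comp measurable_snd)).enorm
  have main := lintegral_pi_enorm_sub_le_sum hμ1 (n := N) (F := fun x => F (WithLp.toLp 2 x))
    (D := fun i x => ENNReal.ofReal (1 / 2) * ‖gradient F (WithLp.toLp 2 x) i‖ₑ) (hcF.comp hL)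
    (fun i => ((hgi i).measurable.comp hL).enorm.const_mul _) (fun i x => by
      have hline : ∀ s : ℝ, HasDerivAt (fun s => (WithLp.toLp 2 (Function.update x i s) :
          EuclideanSpace ℝ (Fin N))) (EuclideanSpace.single i 1) s := fun s =>
        ((PiLp.continuousLinearEquiv 2 ℝ (fun _ : Fin N => ℝ)).symm :
          (Fin N → ℝ) →L[ℝ] EuclideanSpace ℝ (Fin N)).hasFDerivAt.comp_hasDerivAt s
          (hasDerivAt_update x i s)
      have hC : ContDiff ℝ 1 fun s : ℝ => F (WithLp.toLp 2 (Function.update x i s)) := by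
        refine hF.comp ?_
        exact ((PiLp.continuousLinearEquiv 2 ℝ (fun _ : Fin N => ℝ)).symm :
          (Fin N → ℝ) →L[ℝ] EuclideanSpace ℝ (Fin N)).contDiff.comp (contDiff_update 1 x i)
      have hd : ∀ s, deriv (fun s : ℝ => F (WithLp.toLp 2 (Function.update x i s))) s =
          gradient F (WithLp.toLp 2 (Function.update x i s)) i := fun s => by
        rw [gradient_apply]
        exact ((hF.differentiable one_ne_zero _).hasFDerivAt.comp_hasDerivAt s (hline s)).deriv
      have := lintegral_lintegral_enorm_sub_le_half hC hab
      simpa only [hd] using this)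
  rw [setLIntegral_openCube m2.lintegral_prod_right']
  calc _ = ∫⁻ x, ∫⁻ y, ‖F (WithLp.toLp 2 x) - F (WithLp.toLp 2 y)‖ₑ ∂(Measure.pi fun _ => μ)
          ∂(Measure.pi fun _ => μ) := lintegral_congr fun x =>
        setLIntegral_openCube (m2.comp (measurable_const.prodMk measurable_id))
    _ ≤ _ := main
    _ = ∫⁻ x in openCube N a b, ∑ i, ENNReal.ofReal (1 / 2) * ‖gradient F x i‖ₑ := by
        rw [lintegral_finsetSum _ fun i _ => (hgi i).measurable.enorm.const_mul _]
        exact Finset.sum_congr rfl fun i _ =>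
          (setLIntegral_openCube ((hgi i).measurable.enorm.const_mul _)).symm
    _ ≤ ∫⁻ x in openCube N a b, ENNReal.ofReal (√N / 2) * ‖gradient F x‖ₑ := by
        refine lintegral_mono fun x => ?_
        rw [← Finset.mul_sum]
        refine (mul_le_mul_right (sum_enorm_gradient_le F x) _).trans ?_
        rw [← mul_assoc, ← ENNReal.ofReal_mul (by norm_num), one_div_mul_eq_div]
    _ = _ := lintegral_const_mul _ hg.measurable.enorm

end Cube

/-! ### Mollification, and the Poincaré constant for `W^{1,1}` -/

section Mollification

open scoped Convolution

variable {N : ℕ}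

theorem fderiv_convolution_lsmul_apply {ρ f : EuclideanSpace ℝ (Fin N) → ℝ}
    (hρ : ContDiff ℝ 1 ρ) (hρc : HasCompactSupport ρ) (hf : LocallyIntegrable f)
    (x v : EuclideanSpace ℝ (Fin N)) :
    fderiv ℝ (ρ ⋆[ContinuousLinearMap.lsmul ℝ ℝ, volume] f) x v =
      ∫ t, fderiv ℝ ρ (x - t) v * f t := by
  have h := hρc.hasFDerivAt_convolution_left (ContinuousLinearMap.lsmul ℝ ℝ) hρ hf x
  rw [h.fderiv, convolution_eq_swap]
  have hint : Integrable fun t =>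
      ((ContinuousLinearMap.lsmul ℝ ℝ).precompL (EuclideanSpace ℝ (Fin N)) (fderiv ℝ ρ (x - t)))
        (f t) :=
    ((hρc.fderiv ℝ).convolutionExists_left _ (hρ.continuous_fderiv one_ne_zero) hf x).integrable_swap
  rw [ContinuousLinearMap.integral_apply hint]
  simp

theorem isTestFunction_comp_sub {ρ : EuclideanSpace ℝ (Fin N) → ℝ} {r : ℝ}
    {Ω : Set (EuclideanSpace ℝ (Fin N))}
    (hρ : ContDiff ℝ ((⊤ : ℕ∞) : WithTop ℕ∞) ρ) (hρr : tsupport ρ ⊆ Metric.closedBall 0 r)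
    {x : EuclideanSpace ℝ (Fin N)} (hx : Metric.closedBall x r ⊆ Ω) :
    IsTestFunction Ω fun t => ρ (x - t) := by
  have hs : tsupport (fun t => ρ (x - t)) ⊆ Metric.closedBall x r := by
    refine closure_minimal (fun t ht => ?_) Metric.isClosed_closedBall
    have := hρr (subset_tsupport _ ht)
    rw [mem_closedBall_zero_iff] at this
    rwa [mem_closedBall_iff_norm']
  exact ⟨hρ.comp (contDiff_const.sub contDiff_id),
    (isCompact_closedBall x r).of_isClosed_subset (isClosed_tsupport _) hs, hs.trans hx⟩

/-- When the closed ball about `x` lies in `Ω`, the kernel `t ↦ ρ (x - t)` is a test function in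
`Ω`, and the weak gradient identity moves the derivative from the kernel to `f`. Extending `f` by
zero has no effect at such points. -/
theorem MemSobolev.gradient_convolution {Ω : Set (EuclideanSpace ℝ (Fin N))}
    (hΩ : MeasurableSet Ω) {f : EuclideanSpace ℝ (Fin N) → ℝ}
    {G : EuclideanSpace ℝ (Fin N) → EuclideanSpace ℝ (Fin N)} (hf : MemSobolev Ω 1 f G)
    {ρ : EuclideanSpace ℝ (Fin N) → ℝ} {r : ℝ} (hρ : ContDiff ℝ ((⊤ : ℕ∞) : WithTop ℕ∞) ρ)
    (hρc : HasCompactSupport ρ) (hρr : tsupport ρ ⊆ Metric.closedBall 0 r)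
    {x : EuclideanSpace ℝ (Fin N)} (hx : Metric.closedBall x r ⊆ Ω) :
    gradient (ρ ⋆[ContinuousLinearMap.lsmul ℝ ℝ, volume] Ω.indicator f) x =
      ∫ t in Ω, ρ (x - t) • G t := by
  have hρ1 : ContDiff ℝ 1 ρ := hρ.of_le (by exact_mod_cast le_top)
  have hψ := isTestFunction_comp_sub hρ hρr hx
  have hfi : Integrable f (volume.restrict Ω) := memLp_one_iff_integrable.1 hf.1
  have hGi : Integrable G (volume.restrict Ω) := memLp_one_iff_integrable.1 hf.2.1
  have hf0 : LocallyIntegrable (Ω.indicator f) :=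
    ((integrable_indicator_iff hΩ).2 hfi).locallyIntegrable
  have hcψ := continuous_gradient hψ.contDiff_one
  obtain ⟨A, hA⟩ := hψ.1.continuous.bounded_above_of_compact_support hψ.2.1
  obtain ⟨B, hB⟩ := hcψ.bounded_above_of_compact_support hψ.2.1.gradient
  have i1 : Integrable (fun t => f t • gradient (fun t => ρ (x - t)) t) (volume.restrict Ω) :=
    hfi.smul_bdd B hcψ.aestronglyMeasurable (Eventually.of_forall hB)
  have i2 : Integrable (fun t => ρ (x - t) • G t) (volume.restrict Ω) :=
    hGi.bdd_smul A hψ.1.continuous.aestronglyMeasurable (Eventually.of_forall hA)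
  refine ext_inner_right ℝ fun v => ?_
  have h := congrArg (fun w => inner ℝ v w) (hf.2.2 _ hψ)
  simp only [inner_neg_right] at h
  rw [← integral_inner i1] at h
  rw [inner_gradient_left, fderiv_convolution_lsmul_apply hρ1 hρc hf0, ← real_inner_comm,
    eq_comm, ← neg_inj, ← h, ← integral_neg, ← integral_indicator hΩ]
  refine integral_congr_ae (Eventually.of_forall fun t => ?_)
  -- Differentiating in `t` instead of `x` costs a sign, which cancels the one in the definition of
  -- the weak gradient.
  have hd : HasFDerivAt (fun t => ρ (x - t)) (-(fderiv ℝ ρ (x - t))) t := by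
    have h1 : HasFDerivAt (fun t => x - t) (-ContinuousLinearMap.id ℝ _) t :=
      (hasFDerivAt_id t).const_sub x
    have h2 := (hρ1.differentiable one_ne_zero (x - t)).hasFDerivAt.comp t h1
    rw [ContinuousLinearMap.comp_neg, ContinuousLinearMap.comp_id] at h2
    exact h2
  by_cases ht : t ∈ Ω
  · simp [ht, inner_smul_right, inner_gradient_right, hd.fderiv, mul_comm]
  · simp [ht]

theorem closedBall_subset_unitCube {r : ℝ} {x : EuclideanSpace ℝ (Fin N)}
    (hx : x ∈ openCube N r (1 - r)) : Metric.closedBall x r ⊆ unitCube N := by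
  intro y hy i
  have h1 : |y i - x i| ≤ r := by
    have := (PiLp.norm_apply_le (y - x) i).trans (mem_closedBall_iff_norm.1 hy)
    simpa using this
  have h2 := abs_le.1 h1
  have h3 := hx i
  exact ⟨by linarith [h3.1], by linarith [h3.2]⟩

/-- Young's inequality in `L^1`: averaging the weak gradient against a kernel of mass one does not
increase its norm. -/
theorem lintegral_enorm_setIntegral_smul_le {Ω : Set (EuclideanSpace ℝ (Fin N))}
    {G : EuclideanSpace ℝ (Fin N) → EuclideanSpace ℝ (Fin N)}
    (hG : AEStronglyMeasurable G (volume.restrict Ω)) {ρ : EuclideanSpace ℝ (Fin N) → ℝ}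
    (hρ : Continuous ρ) :
    ∫⁻ x, ‖∫ t in Ω, ρ (x - t) • G t‖ₑ ≤ (∫⁻ x, ‖ρ x‖ₑ) * ∫⁻ t in Ω, ‖G t‖ₑ := by
  have m : AEMeasurable (fun q : EuclideanSpace ℝ (Fin N) × EuclideanSpace ℝ (Fin N) =>
      ‖ρ (q.1 - q.2)‖ₑ * ‖G q.2‖ₑ) (volume.prod (volume.restrict Ω)) :=
    (hρ.comp (continuous_fst.sub continuous_snd)).enorm.measurable.aemeasurable.mul
      hG.enorm.comp_snd
  calc ∫⁻ x, ‖∫ t in Ω, ρ (x - t) • G t‖ₑ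
      ≤ ∫⁻ x, ∫⁻ t in Ω, ‖ρ (x - t)‖ₑ * ‖G t‖ₑ := by
        refine lintegral_mono fun x => (enorm_integral_le_lintegral_enorm _).trans_eq ?_
        simp only [enorm_smul]
    _ = ∫⁻ t in Ω, ∫⁻ x, ‖ρ (x - t)‖ₑ * ‖G t‖ₑ := lintegral_lintegral_swap m
    _ = ∫⁻ t in Ω, (∫⁻ x, ‖ρ x‖ₑ) * ‖G t‖ₑ := by
        refine lintegral_congr fun t => ?_
        have m : Measurable fun x => ‖ρ (x - t)‖ₑ :=
          (hρ.comp (continuous_id.sub continuous_const)).enorm.measurable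
        rw [lintegral_mul_const _ m,
          lintegral_sub_right_eq_self (fun x => ‖ρ x‖ₑ) t]
    _ = _ := lintegral_const_mul'' _ hG.enorm

/-- The symmetric `L^1` Poincaré inequality on the unit cube, for `W^{1,1}` functions. -/
theorem MemSobolev.lintegral_unitCube_enorm_sub_le {f : EuclideanSpace ℝ (Fin N) → ℝ}
    {G : EuclideanSpace ℝ (Fin N) → EuclideanSpace ℝ (Fin N)}
    (hf : MemSobolev (unitCube N) 1 f G) :
    ∫⁻ x in unitCube N, ∫⁻ y in unitCube N, ‖f x - f y‖ₑ ≤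
      ENNReal.ofReal (√N / 2) * ∫⁻ x in unitCube N, ‖G x‖ₑ := by
  have hQo : IsOpen (unitCube N) := isOpen_openCube (N := N) (a := 0) (b := 1)
  have hQ : MeasurableSet (unitCube N) := hQo.measurableSet
  let r : ℕ → ℝ := fun k => 1 / ((k : ℝ) + 1)
  have hr : ∀ k, 0 < r k := fun k => by positivity
  have hr0 : Tendsto r atTop (𝓝 0) := tendsto_one_div_add_atTop_nhds_zero_nat
  let β : ℕ → ContDiffBump (0 : EuclideanSpace ℝ (Fin N)) := fun k =>
    ⟨r k / 2, r k, half_pos (hr k), half_lt_self (hr k)⟩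
  set F : ℕ → EuclideanSpace ℝ (Fin N) → ℝ := fun k =>
    (β k).normed volume ⋆[ContinuousLinearMap.lsmul ℝ ℝ, volume] (unitCube N).indicator f with hF
  have hf0 : LocallyIntegrable ((unitCube N).indicator f) :=
    ((integrable_indicator_iff hQ).2 (memLp_one_iff_integrable.1 hf.1)).locallyIntegrable
  -- The value `K = 2` is the fixed ratio of outer to inner radius of the bumps, a bound on which is
  -- required for convergence at almost every point.
  have hFlim : ∀ᵐ x, Tendsto (fun k => F k x) atTop (𝓝 ((unitCube N).indicator f x)) :=
    ContDiffBump.ae_convolution_tendsto_right_of_locallyIntegrable (K := 2) hr0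
      (Eventually.of_forall fun k => by simp only [β]; linarith) hf0
  have hFlim' : ∀ᵐ x ∂(volume.restrict (unitCube N)), x ∈ unitCube N ∧
      Tendsto (fun k => F k x) atTop (𝓝 (f x)) := by
    filter_upwards [ae_restrict_of_ae hFlim, ae_restrict_mem hQ] with x h1 hx
    exact ⟨hx, by simpa [hx] using h1⟩
  have hFC : ∀ k, ContDiff ℝ 1 (F k) := fun k =>
    (β k).hasCompactSupport_normed.contDiff_convolution_left _ (β k).contDiff_normed hf0
  have hρ1 : ∀ k, ∫⁻ x, ‖(β k).normed volume x‖ₑ = 1 := fun k => by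
    rw [← ofReal_integral_norm_eq_lintegral_enorm (β k).integrable_normed]
    simp only [Real.norm_of_nonneg ((β k).nonneg_normed _), (β k).integral_normed,
      ENNReal.ofReal_one]
  -- On the cube shrunk by `r k` the mollifier sees only the unit cube. Its side is below one, so
  -- the constant `√N / 2` still applies.
  let Q : ℕ → Set (EuclideanSpace ℝ (Fin N)) := fun k => openCube N (r k) (1 - r k)
  have hQk : ∀ k, MeasurableSet (Q k) := fun k => isOpen_openCube.measurableSet
  have hQsub : ∀ k, Q k ⊆ unitCube N := fun k x hx =>
    closedBall_subset_unitCube hx (Metric.mem_closedBall_self (hr k).le)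
  have hbound : ∀ k, ∫⁻ x in Q k, ∫⁻ y in Q k, ‖F k x - F k y‖ₑ ≤
      ENNReal.ofReal (√N / 2) * ∫⁻ x in unitCube N, ‖G x‖ₑ := by
    intro k
    refine (lintegral_openCube_enorm_sub_le (hFC k) (by linarith [hr k])).trans
      (mul_le_mul_right ?_ _)
    calc ∫⁻ x in Q k, ‖gradient (F k) x‖ₑ
        = ∫⁻ x in Q k, ‖∫ t in unitCube N, (β k).normed volume (x - t) • G t‖ₑ := by
          refine setLIntegral_congr_fun (hQk k) fun x hx => ?_
          have := hf.gradient_convolution hQ ((β k).contDiff_normed (μ := volume)) (β k).hasCompactSupport_normed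
            (r := r k) (by rw [(β k).tsupport_normed_eq]) (closedBall_subset_unitCube hx)
          simp only [hF, this]
      _ ≤ ∫⁻ x, ‖∫ t in unitCube N, (β k).normed volume (x - t) • G t‖ₑ :=
          setLIntegral_le_lintegral _ _
      _ ≤ _ := lintegral_enorm_setIntegral_smul_le hf.2.1.1 (β k).continuous_normed
      _ = _ := by rw [hρ1, one_mul]
  -- The cutoffs carry all integrals to the fixed unit cube. Almost everywhere convergence and
  -- Fatou, once in each variable, then suffice for the limit.
  let h : ℕ → EuclideanSpace ℝ (Fin N) → EuclideanSpace ℝ (Fin N) → ENNReal := fun k x y =>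
    (Q k).indicator 1 x * ((Q k).indicator 1 y * ‖F k x - F k y‖ₑ)
  have mQ : ∀ k, Measurable ((Q k).indicator (1 : EuclideanSpace ℝ (Fin N) → ENNReal)) := fun k =>
    measurable_one.indicator (hQk k)
  have mh : ∀ k, Measurable fun q : EuclideanSpace ℝ (Fin N) × EuclideanSpace ℝ (Fin N) =>
      h k q.1 q.2 := fun k =>
    ((mQ k).comp measurable_fst).mul (((mQ k).comp measurable_snd).mul
      (((hFC k).continuous.comp continuous_fst).sub
        ((hFC k).continuous.comp continuous_snd)).enorm.measurable)
  have hev : ∀ x ∈ unitCube N, ∀ᶠ k in atTop, x ∈ Q k := by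
    intro x hx
    simp only [Q, openCube, Set.mem_ofPred_eq]
    refine eventually_all.2 fun i => ?_
    have h1 := hr0.eventually_lt_const (hx i).1
    have h2 := hr0.eventually_lt_const (sub_pos.2 (hx i).2)
    filter_upwards [h1, h2] with k h1 h2 using ⟨h1, by linarith⟩
  have hlim : ∀ᵐ x ∂(volume.restrict (unitCube N)), ∀ᵐ y ∂(volume.restrict (unitCube N)),
      ‖f x - f y‖ₑ ≤ liminf (fun k => h k x y) atTop := by
    filter_upwards [hFlim'] with x hx
    filter_upwards [hFlim'] with y hy
    have l1 : Tendsto (fun k => ‖F k x - F k y‖ₑ) atTop (𝓝 ‖f x - f y‖ₑ) :=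
      (hx.2.sub hy.2).enorm
    refine (Tendsto.liminf_eq (l1.congr' ?_)).ge
    filter_upwards [hev x hx.1, hev y hy.1] with k h1 h2
    simp [h, h1, h2]
  calc ∫⁻ x in unitCube N, ∫⁻ y in unitCube N, ‖f x - f y‖ₑ
      ≤ ∫⁻ x in unitCube N, liminf (fun k => ∫⁻ y in unitCube N, h k x y) atTop := by
        refine lintegral_mono_ae ?_
        filter_upwards [hlim] with x hx
        exact (lintegral_mono_ae hx).trans (lintegral_liminf_le fun k =>
          (mh k).comp (measurable_const.prodMk measurable_id))
    _ ≤ liminf (fun k => ∫⁻ x in unitCube N, ∫⁻ y in unitCube N, h k x y) atTop :=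
        lintegral_liminf_le fun k => (mh k).lintegral_prod_right'
    _ ≤ liminf (fun _ => ENNReal.ofReal (√N / 2) * ∫⁻ x in unitCube N, ‖G x‖ₑ) atTop := by
        refine liminf_le_liminf (Eventually.of_forall fun k => ?_)
        refine le_trans (le_of_eq ?_) (hbound k)
        have step : ∀ g : EuclideanSpace ℝ (Fin N) → ENNReal,
            ∫⁻ x in unitCube N, (Q k).indicator 1 x * g x = ∫⁻ x in Q k, g x := by
          intro g
          have e : ∀ x, (Q k).indicator 1 x * g x = (Q k).indicator g x := fun x => by
            by_cases hx : x ∈ Q k <;> simp [hx]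
          simp only [e]
          rw [lintegral_indicator (hQk k), Measure.restrict_restrict_of_subset (hQsub k)]
        have inner : ∀ x, ∫⁻ y in unitCube N, h k x y =
            (Q k).indicator 1 x * ∫⁻ y in Q k, ‖F k x - F k y‖ₑ := by
          intro x
          rw [← step, ← lintegral_const_mul]
          exact (mQ k).mul (continuous_const.sub (hFC k).continuous).enorm.measurable
        simp only [inner, step]
    _ = _ := liminf_const _

theorem volume_unitCube (N : ℕ) : volume (unitCube N) = 1 := by
  change volume (openCube N 0 1) = 1
  simp [volume_openCube]

/-- As the cube has measure one, `f x - f̄` is the integral of `f x - f y` over `y`, so the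
symmetric inequality dominates the usual one. -/
theorem sqrt_div_two_mem_cubePoincareConstants (N : ℕ) : √(N : ℝ) / 2 ∈ cubePoincareConstants N := by
  refine ⟨by positivity, fun f G hf => ?_⟩
  have : IsProbabilityMeasure (volume.restrict (unitCube N)) := ⟨by simp [volume_unitCube]⟩
  have hfi : Integrable f (volume.restrict (unitCube N)) := hf.1.integrable le_rfl
  have hGi : Integrable G (volume.restrict (unitCube N)) := hf.2.1.integrable le_rfl
  have e1 : ENNReal.ofReal (∫ x in unitCube N, |f x - cubeAverage f|) =
      ∫⁻ x in unitCube N, ‖f x - cubeAverage f‖ₑ :=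
    ofReal_integral_norm_eq_lintegral_enorm (hfi.sub (integrable_const _))
  have e2 : ENNReal.ofReal (∫ x in unitCube N, ‖G x‖) = ∫⁻ x in unitCube N, ‖G x‖ₑ :=
    ofReal_integral_norm_eq_lintegral_enorm hGi
  have h0 : 0 ≤ √(N : ℝ) / 2 * ∫ x in unitCube N, ‖G x‖ :=
    mul_nonneg (by positivity) (integral_nonneg fun x => norm_nonneg _)
  rw [← ENNReal.ofReal_le_ofReal_iff h0, e1, ENNReal.ofReal_mul (by positivity), e2]
  refine le_trans (lintegral_mono fun x => ?_) hf.lintegral_unitCube_enorm_sub_le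
  have : f x - cubeAverage f = ∫ y in unitCube N, (f x - f y) := by
    rw [integral_sub (integrable_const _) hfi]; simp [cubeAverage]
  rw [this]
  exact enorm_integral_le_lintegral_enorm _

/-- Each pair `(f, G)` imposes a closed condition on `c`, so the infimum is itself admissible. -/
theorem isLeast_cubePoincareConstant (N : ℕ) :
    IsLeast (cubePoincareConstants N) (cubePoincareConstant N) := by
  have hb : BddBelow (cubePoincareConstants N) := ⟨0, fun c hc => hc.1⟩
  have hne : (cubePoincareConstants N).Nonempty := ⟨_, sqrt_div_two_mem_cubePoincareConstants N⟩
  refine ⟨⟨le_csInf hne fun c hc => hc.1, fun f G hf => ?_⟩, fun c hc => csInf_le hb hc⟩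
  obtain ⟨c, -, hc, hcm⟩ := exists_seq_tendsto_sInf hne hb
  exact ge_of_tendsto' (hc.mul_const _) fun k => (hcm k).2 f G hf

end Mollification

/-! ### Integrals against an oscillating periodic weight -/

section Periodic

variable {N : ℕ} {w : EuclideanSpace ℝ (Fin N) → ℝ} {a b : ℝ}

/-- The periods of `w` (in the almost everywhere sense). -/
def aePeriods (w : EuclideanSpace ℝ (Fin N) → ℝ) : AddSubgroup (EuclideanSpace ℝ (Fin N)) where
  carrier := {v | ∀ᵐ x, w (x + v) = w x}
  zero_mem' := by simp
  add_mem' := by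
    intro u v hu hv
    simp only [Set.mem_ofPred_eq] at *
    filter_upwards [hu, (measurePreserving_add_right volume u).quasiMeasurePreserving.ae hv]
      with x h1 h2
    rw [← add_assoc, h2, h1]
  neg_mem' := by
    intro v hv
    simp only [Set.mem_ofPred_eq] at *
    filter_upwards [(measurePreserving_add_right volume (-v)).quasiMeasurePreserving.ae hv] with x h
    rw [← h, neg_add_cancel_right]

/-- Almost everywhere periods form a subgroup, so the coordinate periods generate all integer
vectors. -/
theorem toLp_intCast_mem_aePeriods
    (hw : ∀ i : Fin N, ∀ᵐ x, w (x + EuclideanSpace.single i 1) = w x) (k : Fin N → ℤ) :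
    WithLp.toLp 2 (fun i => (k i : ℝ)) ∈ aePeriods w := by
  have e : WithLp.toLp 2 (fun i => (k i : ℝ)) =
      ∑ i, k i • (EuclideanSpace.single i (1 : ℝ) : EuclideanSpace ℝ (Fin N)) := by
    ext j
    simp [Finset.sum_apply, Pi.single_apply]
  rw [e]
  exact sum_mem fun i _ => AddSubgroup.zsmul_mem _ (hw i) _

theorem gridCell_one_zero_ae_eq_unitCube :
    (unitCube N : Set (EuclideanSpace ℝ (Fin N))) =ᵐ[volume] gridCell 1 (0 : Fin N → ℤ) := by
  refine ae_eq_of_subset_of_measure_ge (fun x hx i => ?_) ?_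
    (isOpen_openCube (N := N) (a := 0) (b := 1)).measurableSet.nullMeasurableSet ?_
  · rw [div_one, Pi.zero_apply, Int.floor_eq_zero_iff]
    exact ⟨(hx i).1.le, (hx i).2⟩
  · rw [volume_gridCell one_pos, volume_unitCube]; simp
  · rw [volume_gridCell one_pos]; exact ENNReal.ofReal_ne_top

theorem setIntegral_gridCell_one {F : Type*} [NormedAddCommGroup F] [NormedSpace ℝ F]
    (f : EuclideanSpace ℝ (Fin N) → F) (k : Fin N → ℤ) :
    ∫ x in gridCell 1 k, f x = ∫ x in unitCube N, f (x + WithLp.toLp 2 fun i => (k i : ℝ)) := by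
  set v : EuclideanSpace ℝ (Fin N) := WithLp.toLp 2 fun i => (k i : ℝ) with hv
  rw [setIntegral_congr_set gridCell_one_zero_ae_eq_unitCube,
    ← (measurePreserving_add_right volume v).setIntegral_preimage_emb
      (measurableEmbedding_addRight v) f]
  congr 2
  ext x
  simp [gridCell, hv]

theorem integral_eq_sum_unitCube {F : Type*} [NormedAddCommGroup F] [NormedSpace ℝ F]
    {f : EuclideanSpace ℝ (Fin N) → F} (hf : Integrable f) {S : Finset (Fin N → ℤ)}
    (hS : Function.support f ⊆ ⋃ k ∈ S, gridCell 1 k) :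
    ∫ x, f x = ∑ k ∈ S, ∫ x in unitCube N, f (x + WithLp.toLp 2 fun i => (k i : ℝ)) := by
  rw [← setIntegral_eq_integral_of_forall_compl_eq_zero (s := ⋃ k ∈ S, gridCell 1 k)
    fun x hx => by_contra fun h => hx (hS h),
    integral_biUnion_finset S (fun k _ => measurableSet_gridCell one_pos)
      ((pairwise_disjoint_gridCell 1).set_pairwise _) fun k _ => hf.integrableOn]
  exact Finset.sum_congr rfl fun k _ => setIntegral_gridCell_one f k

theorem gradient_comp_add_right (g : EuclideanSpace ℝ (Fin N) → ℝ) (v x : EuclideanSpace ℝ (Fin N)) :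
    gradient (fun x => g (x + v)) x = gradient g (x + v) := by
  rw [gradient, fderiv_comp_add_right, gradient]

theorem gradient_comp_smul (g : EuclideanSpace ℝ (Fin N) → ℝ) (c : ℝ)
    (x : EuclideanSpace ℝ (Fin N)) :
    gradient (fun x => g (c • x)) x = c • gradient g (c • x) := by
  rw [gradient, fderiv_comp_smul, map_smul, gradient]

theorem isProbabilityMeasure_restrict_unitCube (N : ℕ) :
    IsProbabilityMeasure (volume.restrict (unitCube N)) := ⟨by simp [volume_unitCube]⟩

theorem IsPeriodicWeight.integrableOn_unitCube (hw : IsPeriodicWeight w a b) :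
    Integrable w (volume.restrict (unitCube N)) := by
  have := isProbabilityMeasure_restrict_unitCube N
  refine Integrable.of_bound hw.aestronglyMeasurable.restrict b ?_
  filter_upwards [ae_restrict_of_ae hw.bounds] with x hx
  rw [Real.norm_of_nonneg (hw.pos.le.trans hx.1)]
  exact hx.2

theorem IsPeriodicWeight.cubeAverage_mem (hw : IsPeriodicWeight w a b) :
    a ≤ cubeAverage w ∧ cubeAverage w ≤ b := by
  have := isProbabilityMeasure_restrict_unitCube N
  have h1 := integral_mono_ae (integrable_const a) hw.integrableOn_unitCube (by
    filter_upwards [ae_restrict_of_ae hw.bounds] with x hx using hx.1)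
  have h2 := integral_mono_ae hw.integrableOn_unitCube (integrable_const b) (by
    filter_upwards [ae_restrict_of_ae hw.bounds] with x hx using hx.2)
  simp only [integral_const, probReal_univ, one_smul] at h1 h2
  exact ⟨h1, h2⟩

theorem IsPeriodicWeight.ae_abs_sub_le (hw : IsPeriodicWeight w a b) :
    ∀ᵐ x, |w x - cubeAverage w| ≤ (eLpNorm (fun x => w x - cubeAverage w) ⊤ volume).toReal := by
  have hmem : MemLp (fun x => w x - cubeAverage w) ⊤ volume := by
    refine memLp_top_of_bound (hw.aestronglyMeasurable.sub aestronglyMeasurable_const) (b - a) ?_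
    filter_upwards [hw.bounds] with x hx
    have := hw.cubeAverage_mem
    rw [Real.norm_eq_abs, abs_le]
    constructor <;> linarith
  rw [eLpNorm_exponent_top]
  have hfin : eLpNormEssSup (fun x => w x - cubeAverage w) volume ≠ ⊤ := by
    rw [← eLpNorm_exponent_top]; exact hmem.2.ne
  filter_upwards [ae_le_eLpNormEssSup (f := fun x => w x - cubeAverage w) (μ := volume)] with x hx
  rw [← Real.norm_eq_abs, ← toReal_enorm]
  exact ENNReal.toReal_mono hfin hx

theorem IsPeriodicWeight.aestronglyMeasurable_comp_smul (hw : IsPeriodicWeight w a b) {c : ℝ}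
    (hc : c ≠ 0) : AEStronglyMeasurable (fun x => w (c • x)) volume :=
  hw.aestronglyMeasurable.comp_quasiMeasurePreserving
    (Measure.quasiMeasurePreserving_smul volume hc)

theorem IsPeriodicWeight.bounds_comp_smul (hw : IsPeriodicWeight w a b) {c : ℝ}
    (hc : c ≠ 0) : ∀ᵐ x : EuclideanSpace ℝ (Fin N), a ≤ w (c • x) ∧ w (c • x) ≤ b :=
  (Measure.quasiMeasurePreserving_smul volume hc).ae hw.bounds

/-- The oscillation of the weight on one period cell, tested against `C^1` functions. -/
theorem IsPeriodicWeight.abs_setIntegral_unitCube_le (hw : IsPeriodicWeight w a b)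
    {f : EuclideanSpace ℝ (Fin N) → ℝ} (hf : ContDiff ℝ 1 f) (hfc : HasCompactSupport f) :
    |∫ x in unitCube N, (w x - cubeAverage w) * f x| ≤
      (eLpNorm (fun x => w x - cubeAverage w) ⊤ volume).toReal *
        (cubePoincareConstant N * ∫ x in unitCube N, ‖gradient f x‖) := by
  have := isProbabilityMeasure_restrict_unitCube N
  set K := (eLpNorm (fun x => w x - cubeAverage w) ⊤ volume).toReal with hK
  have hK0 : 0 ≤ K := ENNReal.toReal_nonneg
  have hS : MemSobolev (unitCube N) 1 f (gradient f) :=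
    memSobolev_of_contDiff hf (hf.continuous.memLp_of_hasCompactSupport hfc)
      ((continuous_gradient hf).memLp_of_hasCompactSupport hfc.gradient)
  have hfi : Integrable f (volume.restrict (unitCube N)) := memLp_one_iff_integrable.1 hS.1
  have hwi : Integrable (fun x => w x - cubeAverage w) (volume.restrict (unitCube N)) :=
    hw.integrableOn_unitCube.sub (integrable_const _)
  have hKae : ∀ᵐ x ∂(volume.restrict (unitCube N)), ‖w x - cubeAverage w‖ ≤ K :=
    ae_restrict_of_ae hw.ae_abs_sub_le
  have i1 : Integrable (fun x => (w x - cubeAverage w) * f x) (volume.restrict (unitCube N)) :=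
    hfi.bdd_mul hwi.aestronglyMeasurable hKae
  -- The weight minus its average has mean zero, so subtracting the constant `cubeAverage f` leaves
  -- the integral unchanged; Poincaré then applies.
  have hmean : ∫ x in unitCube N, (w x - cubeAverage w) * cubeAverage f = 0 := by
    rw [integral_mul_const, integral_sub hw.integrableOn_unitCube (integrable_const _)]
    simp [cubeAverage]
  calc |∫ x in unitCube N, (w x - cubeAverage w) * f x|
      = |∫ x in unitCube N, (w x - cubeAverage w) * (f x - cubeAverage f)| := by
        simp only [mul_sub (w _ - _)]
        rw [integral_sub i1 (hwi.mul_const _), hmean, sub_zero]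
    _ ≤ ∫ x in unitCube N, |(w x - cubeAverage w) * (f x - cubeAverage f)| :=
        abs_integral_le_integral_abs
    _ ≤ ∫ x in unitCube N, K * |f x - cubeAverage f| := by
        refine integral_mono_of_nonneg (Eventually.of_forall fun x => abs_nonneg _)
          ((hfi.sub (integrable_const _)).norm.const_mul K) ?_
        filter_upwards [hKae] with x hx
        rw [abs_mul]
        gcongr
        exact hx
    _ ≤ _ := by
        rw [integral_const_mul]
        gcongr
        exact (isLeast_cubePoincareConstant N).1.2 f _ hS

/-- The support of `g` meets finitely many integer cells. Periodicity carries each to the unit cube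
without changing the weight, and the gradient integrals add up to that over the whole space. -/
theorem IsPeriodicWeight.abs_integral_le (hw : IsPeriodicWeight w a b)
    {g : EuclideanSpace ℝ (Fin N) → ℝ} (hg : ContDiff ℝ 1 g) (hgc : HasCompactSupport g) :
    |∫ x, (w x - cubeAverage w) * g x| ≤
      (eLpNorm (fun x => w x - cubeAverage w) ⊤ volume).toReal *
        (cubePoincareConstant N * ∫ x, ‖gradient g x‖) := by
  set K := (eLpNorm (fun x => w x - cubeAverage w) ⊤ volume).toReal with hK
  obtain ⟨S, hS⟩ := exists_finset_subset_iUnion_gridCell one_pos hgc.isCompact.isBounded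
  have hgi : Integrable g := hg.continuous.integrable_of_hasCompactSupport hgc
  have hGi : Integrable fun x => ‖gradient g x‖ :=
    ((continuous_gradient hg).integrable_of_hasCompactSupport hgc.gradient).norm
  have i1 : Integrable fun x => (w x - cubeAverage w) * g x :=
    hgi.bdd_mul (hw.aestronglyMeasurable.sub aestronglyMeasurable_const) hw.ae_abs_sub_le
  have s1 : Function.support (fun x => (w x - cubeAverage w) * g x) ⊆ ⋃ k ∈ S, gridCell 1 k :=
    ((Function.support_mul_subset_right _ _).trans (subset_tsupport g)).trans hS
  have s2 : Function.support (fun x => ‖gradient g x‖) ⊆ ⋃ k ∈ S, gridCell 1 k := by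
    refine subset_trans (fun x hx => ?_) hS
    refine support_fderiv_subset ℝ (f := g) ?_
    rw [Function.mem_support, norm_gradient, norm_ne_zero_iff] at hx
    exact hx
  rw [integral_eq_sum_unitCube i1 s1, integral_eq_sum_unitCube hGi s2, Finset.mul_sum,
    Finset.mul_sum]
  refine (Finset.abs_sum_le_sum_abs _ _).trans (Finset.sum_le_sum fun k _ => ?_)
  have hper : ∀ᵐ x, w (x + WithLp.toLp 2 fun i => (k i : ℝ)) = w x :=
    toLp_intCast_mem_aePeriods hw.periodic k
  set v : EuclideanSpace ℝ (Fin N) := WithLp.toLp 2 fun i => (k i : ℝ)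
  have e : ∫ x in unitCube N, (w (x + v) - cubeAverage w) * g (x + v) =
      ∫ x in unitCube N, (w x - cubeAverage w) * g (x + v) := by
    refine integral_congr_ae ?_
    filter_upwards [ae_restrict_of_ae hper] with x hx
    rw [hx]
  rw [e]
  have h := hw.abs_setIntegral_unitCube_le (f := fun x => g (x + v))
    (hg.comp (contDiff_id.add contDiff_const)) (hgc.comp_homeomorph (Homeomorph.addRight v))
  simpa only [gradient_comp_add_right] using h

/-- The unscaled estimate for `x ↦ g (ε x)`: the Jacobians on the two sides cancel and the chain
rule leaves a single factor `ε`. -/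
theorem IsPeriodicWeight.abs_integral_comp_smul_le (hw : IsPeriodicWeight w a b)
    {g : EuclideanSpace ℝ (Fin N) → ℝ} (hg : ContDiff ℝ 1 g) (hgc : HasCompactSupport g)
    {ε : ℝ} (hε : 0 < ε) :
    |∫ x, (w (ε⁻¹ • x) - cubeAverage w) * g x| ≤
      (eLpNorm (fun x => w x - cubeAverage w) ⊤ volume).toReal *
        (cubePoincareConstant N * (ε * ∫ x, ‖gradient g x‖)) := by
  have h := hw.abs_integral_le (g := fun x => g (ε • x)) (hg.comp (contDiff_const_smul ε))
    (hgc.comp_homeomorph (Homeomorph.smulOfNeZero ε hε.ne'))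
  have h1 := Measure.integral_comp_smul (volume : Measure (EuclideanSpace ℝ (Fin N)))
    (fun x => (w (ε⁻¹ • x) - cubeAverage w) * g x) ε
  have h2 := Measure.integral_comp_smul (volume : Measure (EuclideanSpace ℝ (Fin N)))
    (fun x => ‖gradient g x‖) ε
  simp only [smul_smul, inv_mul_cancel₀ hε.ne', one_smul] at h1
  simp only [gradient_comp_smul, norm_smul, Real.norm_of_nonneg hε.le] at h
  rw [h1, integral_const_mul, h2, smul_eq_mul, smul_eq_mul, abs_mul, abs_abs] at h
  have hc : 0 < |(ε ^ Module.finrank ℝ (EuclideanSpace ℝ (Fin N)))⁻¹| := by positivity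
  refine le_of_mul_le_mul_left (h.trans_eq ?_) hc
  ring

end Periodic

/-! ### Comparison of eigenvalues and the rate of convergence -/

section Rate

variable {N : ℕ} {Ω : Set (EuclideanSpace ℝ (Fin N))} {p : ℝ}

/-- The chain rule gives `|∇|φ|^p| ≤ p |φ|^(p-1) |∇φ|`; Hölder with exponents `p` and `p/(p-1)` does
the rest. -/
theorem IsTestFunction.integral_norm_gradient_rpow_le (hp : 1 < p)
    {φ : EuclideanSpace ℝ (Fin N) → ℝ} (hφ : IsTestFunction Ω φ) :
    ∫ x, ‖gradient (fun x => ‖φ x‖ ^ p) x‖ ≤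
      p * ((∫ x, ‖φ x‖ ^ p) ^ (1 - 1 / p) * (∫ x, ‖gradient φ x‖ ^ p) ^ (1 / p)) := by
  have hp0 : 0 < p := by linarith
  have hφ1 := hφ.contDiff_one
  have hq : p.HolderConjugate (p.conjExponent) := .conjExponent hp
  set q := p.conjExponent with hqdef
  have hq1 : 1 / q = 1 - 1 / p := by
    have := hq.inv_add_inv_eq_one
    rw [one_div, one_div]; linarith
  have hpq : (p - 1) * q = p := hq.sub_one_mul_conj
  have hc : Continuous fun x => ‖φ x‖ ^ (p - 1) :=
    hφ.1.continuous.norm.rpow_const fun _ => Or.inr (by linarith)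
  have hcs : HasCompactSupport fun x => ‖φ x‖ ^ (p - 1) :=
    hφ.2.1.comp_left (g := fun t : ℝ => ‖t‖ ^ (p - 1))
      (by rw [norm_zero, Real.zero_rpow (by linarith)])
  have hgc := (continuous_gradient hφ1).norm
  have hgcs : HasCompactSupport fun x => ‖gradient φ x‖ := hφ.2.1.gradient.norm
  have holder := integral_mul_le_Lp_mul_Lq_of_nonneg (μ := volume) hq
    (f := fun x => ‖gradient φ x‖) (g := fun x => ‖φ x‖ ^ (p - 1))
    (Eventually.of_forall fun x => norm_nonneg _) (Eventually.of_forall fun x => by positivity)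
    (hgc.memLp_of_hasCompactSupport hgcs) (hc.memLp_of_hasCompactSupport hcs)
  simp only [← Real.rpow_mul (norm_nonneg _), hpq, hq1] at holder
  have hG := ContDiff.norm_rpow hφ1 hp
  calc ∫ x, ‖gradient (fun x => ‖φ x‖ ^ p) x‖
      ≤ ∫ x, p * (‖gradient φ x‖ * ‖φ x‖ ^ (p - 1)) := by
        refine integral_mono_of_nonneg (Eventually.of_forall fun x => norm_nonneg _)
          (((hgc.mul hc).integrable_of_hasCompactSupport hgcs.mul_right).const_mul p)
          (Eventually.of_forall fun x => ?_)
        have := norm_fderiv_norm_rpow_le (hφ1.differentiable one_ne_zero) (x := x) hp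
        simp only [norm_gradient]
        linarith
    _ = p * ∫ x, ‖gradient φ x‖ * ‖φ x‖ ^ (p - 1) := integral_const_mul _ _
    _ ≤ _ := by rw [mul_comm (_ ^ (1 - 1 / p))]; gcongr

/-- The oscillation estimate is applied to `g = |φ|^p`, which is `C^1` because `p > 1`, though in
general not smooth. -/
theorem IsPeriodicWeight.abs_integral_norm_rpow_sub_le
    {w : EuclideanSpace ℝ (Fin N) → ℝ} {a b : ℝ} (hw : IsPeriodicWeight w a b) (hp : 1 < p)
    {ε : ℝ} (hε : 0 < ε) {φ : EuclideanSpace ℝ (Fin N) → ℝ} (hφ : IsTestFunction Ω φ) :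
    |(∫ x in Ω, w (ε⁻¹ • x) * ‖φ x‖ ^ p) - ∫ x in Ω, cubeAverage w * ‖φ x‖ ^ p| ≤
      (p * cubePoincareConstant N *
        (eLpNorm (fun x => w x - cubeAverage w) ⊤ volume).toReal * ε) *
      ((∫ x in Ω, ‖φ x‖ ^ p) ^ (1 - 1 / p) * (∫ x in Ω, ‖gradient φ x‖ ^ p) ^ (1 / p)) := by
  have hp0 : 0 < p := by linarith
  have hg : ContDiff ℝ 1 fun x => ‖φ x‖ ^ p := hφ.contDiff_one.norm_rpow hp
  have hgc : HasCompactSupport fun x => ‖φ x‖ ^ p :=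
    hφ.2.1.comp_left (g := fun t : ℝ => ‖t‖ ^ p) (by rw [norm_zero, Real.zero_rpow hp0.ne'])
  have hgi : Integrable fun x => ‖φ x‖ ^ p := hg.continuous.integrable_of_hasCompactSupport hgc
  have hz : ∀ x, x ∉ Ω → ‖φ x‖ ^ p = 0 := fun x hx => by simp [hφ.eq_zero hx, hp0.ne']
  have i1 : Integrable fun x => w (ε⁻¹ • x) * ‖φ x‖ ^ p := by
    refine hgi.bdd_mul (c := b) (hw.aestronglyMeasurable_comp_smul (inv_ne_zero hε.ne')) ?_
    filter_upwards [hw.bounds_comp_smul (inv_ne_zero hε.ne')] with x hx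
    rw [Real.norm_of_nonneg (hw.pos.le.trans hx.1)]
    exact hx.2
  rw [setIntegral_eq_integral_of_forall_compl_eq_zero fun x hx => by rw [hz x hx, mul_zero],
    setIntegral_eq_integral_of_forall_compl_eq_zero fun x hx => by rw [hz x hx, mul_zero],
    setIntegral_eq_integral_of_forall_compl_eq_zero hz,
    setIntegral_eq_integral_of_forall_compl_eq_zero fun x hx => by
      simp [hφ.gradient_eq_zero hx, hp0.ne'],
    ← integral_sub i1 (hgi.const_mul _)]
  simp only [← sub_mul]
  refine (hw.abs_integral_comp_smul_le hg hgc hε).trans ?_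
  have hc0 : 0 ≤ cubePoincareConstant N := (isLeast_cubePoincareConstant N).1.1
  have hK0 : 0 ≤ (eLpNorm (fun x => w x - cubeAverage w) ⊤ volume).toReal := ENNReal.toReal_nonneg
  calc _ ≤ (eLpNorm (fun x => w x - cubeAverage w) ⊤ volume).toReal *
        (cubePoincareConstant N * (ε * (p * ((∫ x, ‖φ x‖ ^ p) ^ (1 - 1 / p) *
          (∫ x, ‖gradient φ x‖ ^ p) ^ (1 / p))))) := by
        gcongr
        exact hφ.integral_norm_gradient_rpow_le hp
    _ = _ := by ring

/-- Comparison of the first eigenvalues of two weights, through their variational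
characterizations. -/
theorem firstEigenvalue_sub_le_of_weights (hp : 1 < p)
    {r₁ r₂ : EuclideanSpace ℝ (Fin N) → ℝ} {a B lam₁ lam₂ mu : ℝ} (ha : 0 < a) (hB : 0 ≤ B)
    (hlam₁ : 0 ≤ lam₁)
    (hP₁ : ∀ φ : EuclideanSpace ℝ (Fin N) → ℝ, IsTestFunction Ω φ →
      a * ∫ x in Ω, ‖φ x‖ ^ p ≤ ∫ x in Ω, r₁ x * ‖φ x‖ ^ p)
    (hP₂ : ∀ φ : EuclideanSpace ℝ (Fin N) → ℝ, IsTestFunction Ω φ →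
      a * ∫ x in Ω, ‖φ x‖ ^ p ≤ ∫ x in Ω, r₂ x * ‖φ x‖ ^ p)
    (h₁ : ∀ φ : EuclideanSpace ℝ (Fin N) → ℝ, IsTestFunction Ω φ →
      lam₁ * ∫ x in Ω, r₁ x * ‖φ x‖ ^ p ≤ ∫ x in Ω, ‖gradient φ x‖ ^ p)
    (h₂ : ∀ c : ℝ, (∀ φ : EuclideanSpace ℝ (Fin N) → ℝ, IsTestFunction Ω φ →
      c * ∫ x in Ω, r₂ x * ‖φ x‖ ^ p ≤ ∫ x in Ω, ‖gradient φ x‖ ^ p) → c ≤ lam₂)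
    (hmu : ∀ c : ℝ, (∀ φ : EuclideanSpace ℝ (Fin N) → ℝ, IsTestFunction Ω φ →
      c * ∫ x in Ω, 1 * ‖φ x‖ ^ p ≤ ∫ x in Ω, ‖gradient φ x‖ ^ p) → c ≤ mu)
    (hE : ∀ φ : EuclideanSpace ℝ (Fin N) → ℝ, IsTestFunction Ω φ →
      (∫ x in Ω, r₂ x * ‖φ x‖ ^ p) - ∫ x in Ω, r₁ x * ‖φ x‖ ^ p ≤
        B * ((∫ x in Ω, ‖φ x‖ ^ p) ^ (1 - 1 / p) * (∫ x in Ω, ‖gradient φ x‖ ^ p) ^ (1 / p))) :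
    lam₁ - lam₂ ≤ B * a ^ (-2 : ℝ) * mu ^ (1 / p + 1) := by
  have hp0 : 0 < p := by linarith
  have hq0 : 0 ≤ 1 - 1 / p := by rw [sub_nonneg, div_le_one hp0]; exact hp.le
  have hnn : ∀ φ : EuclideanSpace ℝ (Fin N) → ℝ, 0 ≤ ∫ x in Ω, ‖φ x‖ ^ p := fun φ =>
    integral_nonneg fun x => by positivity
  -- Since `a ∫|φ|^p ≤ ∫ r₁|φ|^p`, the number `lam₁ a` is admissible for the weight one.
  have hlm : lam₁ * a ≤ mu := hmu _ fun φ hφ => by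
    simp only [one_mul]
    rw [mul_assoc]
    exact (mul_le_mul_of_nonneg_left (hP₁ φ hφ) hlam₁).trans (h₁ φ hφ)
  have hmu0 : 0 ≤ mu := (mul_nonneg hlam₁ ha.le).trans hlm
  set C := B * a ^ (-2 : ℝ) * mu ^ (1 / p + 1) with hC
  have hC0 : 0 ≤ C := by positivity
  suffices lam₁ - C ≤ lam₂ by linarith
  refine h₂ _ fun φ hφ => ?_
  set D := ∫ x in Ω, ‖gradient φ x‖ ^ p with hD
  set P := ∫ x in Ω, ‖φ x‖ ^ p with hP
  set M := ∫ x in Ω, r₂ x * ‖φ x‖ ^ p with hM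
  have hD0 : 0 ≤ D := integral_nonneg fun x => by positivity
  have hP0 : 0 ≤ P := hnn φ
  have hPM : a * P ≤ M := hP₂ φ hφ
  have hM0 : 0 ≤ M := (mul_nonneg ha.le hP0).trans hPM
  -- If `lam₁ M ≤ D`, the claim for `φ` is immediate. Otherwise `D ≤ lam₁ M`, exactly the upper
  -- bound on the gradient energy needed to absorb the error into `M`.
  rcases le_total (lam₁ * M) D with hle | hle
  · nlinarith [mul_nonneg hC0 hM0]
  have e1 : lam₁ * (M - B * (P ^ (1 - 1 / p) * D ^ (1 / p))) ≤ D := by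
    refine le_trans (mul_le_mul_of_nonneg_left ?_ hlam₁) (h₁ φ hφ)
    linarith [hE φ hφ]
  have hl : lam₁ ≤ mu * a⁻¹ := by
    rw [← div_eq_mul_inv, le_div_iff₀ ha]; exact hlm
  -- From `P ≤ M/a` and `D ≤ lam₁ M` the powers of `M` add up to one. With `lam₁ ≤ mu/a` the powers
  -- of `a⁻¹` add up to `(1 - 1/p) + (1/p + 1) = 2`.
  have e2 : lam₁ * (B * (P ^ (1 - 1 / p) * D ^ (1 / p))) ≤ C * M := by
    have hPa : P ≤ a⁻¹ * M := by
      rw [← div_eq_inv_mul, le_div_iff₀ ha]; linarith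
    calc lam₁ * (B * (P ^ (1 - 1 / p) * D ^ (1 / p)))
        ≤ lam₁ * (B * ((a⁻¹ * M) ^ (1 - 1 / p) * (lam₁ * M) ^ (1 / p))) := by gcongr
      _ = B * (a⁻¹) ^ (1 - 1 / p) * (lam₁ ^ (1 / p) * lam₁) *
            (M ^ (1 - 1 / p) * M ^ (1 / p)) := by
          rw [Real.mul_rpow (by positivity) hM0, Real.mul_rpow hlam₁ hM0]; ring
      _ = B * (a⁻¹) ^ (1 - 1 / p) * lam₁ ^ (1 / p + 1) * M := by
          rw [← Real.rpow_add_of_nonneg hM0 hq0 (by positivity), sub_add_cancel, Real.rpow_one,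
            Real.rpow_add_one' hlam₁ (by positivity)]
      _ ≤ B * (a⁻¹) ^ (1 - 1 / p) * (mu * a⁻¹) ^ (1 / p + 1) * M := by gcongr
      _ = B * ((a⁻¹) ^ (1 - 1 / p) * (a⁻¹) ^ (1 / p + 1)) * mu ^ (1 / p + 1) * M := by
          rw [Real.mul_rpow hmu0 (by positivity)]; ring
      _ = C * M := by
          rw [← Real.rpow_add (by positivity), show 1 - 1 / p + (1 / p + 1) = (2 : ℝ) by ring, hC,
            Real.rpow_neg ha.le, Real.inv_rpow ha.le]
  linarith

theorem mul_setIntegral_norm_rpow_le (hp : 1 < p) {r : EuclideanSpace ℝ (Fin N) → ℝ} {a b : ℝ}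
    (ha : 0 < a) (hr : AEStronglyMeasurable r (volume.restrict Ω))
    (hab : ∀ᵐ x ∂(volume.restrict Ω), a ≤ r x ∧ r x ≤ b)
    {φ : EuclideanSpace ℝ (Fin N) → ℝ} (hφ : IsTestFunction Ω φ) :
    a * ∫ x in Ω, ‖φ x‖ ^ p ≤ ∫ x in Ω, r x * ‖φ x‖ ^ p := by
  have hi : Integrable (fun x => ‖φ x‖ ^ p) (volume.restrict Ω) :=
    hφ.memLp.integrable_norm_rpow_ofReal (by linarith)
  rw [← integral_const_mul]
  refine integral_mono_ae (hi.const_mul a) (hi.bdd_mul (c := b) hr ?_) ?_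
  · filter_upwards [hab] with x hx
    rw [Real.norm_of_nonneg (ha.le.trans hx.1)]
    exact hx.2
  · filter_upwards [hab] with x hx
    exact mul_le_mul_of_nonneg_right hx.1 (by positivity)

/-- The first eigenvalues for an oscillating periodic weight, and their rate of convergence. -/
theorem IsPeriodicWeight.firstEigenvalue_rate {w : EuclideanSpace ℝ (Fin N) → ℝ} {a b : ℝ}
    (hw : IsPeriodicWeight w a b) (hΩ : IsOpen Ω) (hne : Ω.Nonempty)
    (hbdd : Bornology.IsBounded Ω) (hp : 1 < p) :
    IsLeast (dirichletEigenvalues Ω p (fun _ => 1)) (firstEigenvalue Ω p (fun _ => 1)) ∧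
    IsLeast (dirichletEigenvalues Ω p (fun _ => cubeAverage w))
      (firstEigenvalue Ω p (fun _ => cubeAverage w)) ∧
    ∀ ε : ℝ, 0 < ε →
      IsLeast (dirichletEigenvalues Ω p (fun x => w (ε⁻¹ • x)))
        (firstEigenvalue Ω p (fun x => w (ε⁻¹ • x))) ∧
      |firstEigenvalue Ω p (fun x => w (ε⁻¹ • x)) - firstEigenvalue Ω p (fun _ => cubeAverage w)| ≤
        rateConstant Ω p w a b * ε := by
  have hp0 : 0 < p := by linarith
  have havg := hw.cubeAverage_mem
  have hab : a ≤ b := havg.1.trans havg.2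
  have habm : ∀ᵐ _x ∂(volume.restrict Ω), a ≤ cubeAverage w ∧ cubeAverage w ≤ b :=
    Eventually.of_forall fun _ => havg
  obtain ⟨mu, hmu0, hmul, -, hmug⟩ := exists_isLeast_dirichletEigenvalues (r := fun _ => 1) (a := 1)
    (b := 1) hΩ hne hbdd hp aestronglyMeasurable_const one_pos (by simp)
  obtain ⟨lam, hlam0, hlaml, hlamt, hlamg⟩ := exists_isLeast_dirichletEigenvalues
    (r := fun _ => cubeAverage w) hΩ hne hbdd hp aestronglyMeasurable_const hw.pos habm
  have e1 : firstEigenvalue Ω p (fun _ => 1) = mu := hmul.csInf_eq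
  have e2 : firstEigenvalue Ω p (fun _ => cubeAverage w) = lam := hlaml.csInf_eq
  refine ⟨by rwa [e1], by rwa [e2], fun ε hε => ?_⟩
  have hmeas : AEStronglyMeasurable (fun x => w (ε⁻¹ • x)) (volume.restrict Ω) :=
    (hw.aestronglyMeasurable_comp_smul (inv_ne_zero hε.ne')).restrict
  have hbd : ∀ᵐ x ∂(volume.restrict Ω), a ≤ w (ε⁻¹ • x) ∧ w (ε⁻¹ • x) ≤ b :=
    ae_restrict_of_ae (hw.bounds_comp_smul (inv_ne_zero hε.ne'))
  obtain ⟨l, hl0, hll, hlt, hlg⟩ := exists_isLeast_dirichletEigenvalues hΩ hne hbdd hp hmeas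
    hw.pos hbd
  have e3 : firstEigenvalue Ω p (fun x => w (ε⁻¹ • x)) = l := hll.csInf_eq
  refine ⟨by rwa [e3], ?_⟩
  have hc0 : 0 ≤ cubePoincareConstant N := (isLeast_cubePoincareConstant N).1.1
  set B := p * cubePoincareConstant N *
    (eLpNorm (fun x => w x - cubeAverage w) ⊤ volume).toReal * ε with hB
  have hB0 : 0 ≤ B := by positivity
  have hE := fun φ (hφ : IsTestFunction Ω φ) => abs_le.1 (hw.abs_integral_norm_rpow_sub_le hp hε hφ)
  have hPε := fun φ (hφ : IsTestFunction Ω φ) =>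
    mul_setIntegral_norm_rpow_le hp hw.pos hmeas hbd hφ
  have hPm := fun φ (hφ : IsTestFunction Ω φ) => mul_setIntegral_norm_rpow_le
    (r := fun _ => cubeAverage w) hp hw.pos aestronglyMeasurable_const habm hφ
  -- The comparison is one-sided, so it is applied twice with the two weights exchanged; the
  -- two-sided bound `hE` supplies both error estimates.
  have up := firstEigenvalue_sub_le_of_weights hp hw.pos hB0 hl0 hPε hPm hlt hlamg hmug
    fun φ hφ => by linarith [(hE φ hφ).1]
  have lo := firstEigenvalue_sub_le_of_weights hp hw.pos hB0 hlam0 hPm hPε hlamt hlg hmug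
    fun φ hφ => (hE φ hφ).2
  have hle : B * a ^ (-2 : ℝ) * mu ^ (1 / p + 1) ≤ rateConstant Ω p w a b * ε := by
    -- The comparison gives the sharper factor `a^(-2)`; the stated constant exceeds it by
    -- `(b/a)^(1/p) ≥ 1`.
    have h1 : a ^ (-2 : ℝ) ≤ b ^ (1 / p) * a ^ (-(1 / p) - 2) := by
      calc a ^ (-2 : ℝ) = a ^ (1 / p) * a ^ (-(1 / p) - 2) := by
            rw [← Real.rpow_add hw.pos]; ring_nf
        _ ≤ _ := by
            have := hw.pos
            gcongr
    calc B * a ^ (-2 : ℝ) * mu ^ (1 / p + 1)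
        ≤ B * (b ^ (1 / p) * a ^ (-(1 / p) - 2)) * mu ^ (1 / p + 1) := by gcongr
      _ = _ := by rw [rateConstant, e1, hB]; ring
  rw [e2, e3, abs_le]
  constructor <;> linarith

end Rate

theorem theorem2p2 {N : ℕ} (hN : 1 ≤ N) (Ω : Set (EuclideanSpace ℝ (Fin N)))
    (hΩ_open : IsOpen Ω) (hΩ_conn : IsConnected Ω) (hΩ_bdd : Bornology.IsBounded Ω)
    (p : ℝ) (hp : 1 < p)
    (m n : EuclideanSpace ℝ (Fin N) → ℝ) (m_lo m_hi n_lo n_hi : ℝ)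
    (hm : IsPeriodicWeight m m_lo m_hi) (hn : IsPeriodicWeight n n_lo n_hi) :
    -- `c₁` is the optimal Poincaré constant (the infimum is attained), and `c₁ ≤ √N / 2`
    IsLeast (cubePoincareConstants N) (cubePoincareConstant N) ∧
    cubePoincareConstant N ≤ √(N : ℝ) / 2 ∧
    -- the first eigenvalues without weight and with averaged weights exist
    IsLeast (dirichletEigenvalues Ω p (fun _ => 1)) (firstEigenvalue Ω p (fun _ => 1)) ∧
    IsLeast (dirichletEigenvalues Ω p (fun _ => cubeAverage m))
      (firstEigenvalue Ω p (fun _ => cubeAverage m)) ∧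
    IsLeast (dirichletEigenvalues Ω p (fun _ => cubeAverage n))
      (firstEigenvalue Ω p (fun _ => cubeAverage n)) ∧
    ∀ ε : ℝ, 0 < ε →
      IsLeast (dirichletEigenvalues Ω p (fun x => m (ε⁻¹ • x)))
        (firstEigenvalue Ω p (fun x => m (ε⁻¹ • x))) ∧
      IsLeast (dirichletEigenvalues Ω p (fun x => n (ε⁻¹ • x)))
        (firstEigenvalue Ω p (fun x => n (ε⁻¹ • x))) ∧
      |firstEigenvalue Ω p (fun x => m (ε⁻¹ • x)) -
          firstEigenvalue Ω p (fun _ => cubeAverage m)| ≤ rateConstant Ω p m m_lo m_hi * ε ∧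
      |firstEigenvalue Ω p (fun x => n (ε⁻¹ • x)) -
          firstEigenvalue Ω p (fun _ => cubeAverage n)| ≤ rateConstant Ω p n n_lo n_hi * ε := by
  have hc := isLeast_cubePoincareConstant N
  obtain ⟨h1, h2, h3⟩ := hm.firstEigenvalue_rate hΩ_open hΩ_conn.nonempty hΩ_bdd hp
  obtain ⟨-, h4, h5⟩ := hn.firstEigenvalue_rate hΩ_open hΩ_conn.nonempty hΩ_bdd hp
  exact ⟨hc, hc.2 (sqrt_div_two_mem_cubePoincareConstants N), h1, h2, h4, fun ε hε =>
    ⟨(h3 ε hε).1, (h5 ε hε).1, (h3 ε hε).2, (h5 ε hε).2⟩⟩
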